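/- Let $m>0$ and let $\eta,\tau\in\mathbb R$ satisfy $\eta^2-\tau^2=4$. Let $\sigma_0$ be the $2\times2$ identity matrix, $\sigma_1=\begin{pmatrix}0&1\\1&0\end{pmatrix}$, $\sigma_2=\begin{pmatrix}0&-i\\i&0\end{pmatrix}$, $\sigma_3=\begin{pmatrix}1&0\\0&-1\end{pmatrix}$, $\sigma\cdot\nabla=\sigma_1\partial_x+\sigma_2\partial_y$, let $\Omega_\pm=\{(x,y)\in\mathbb R^2:\pm x>0\}$, and let $$H(\sigma,\Omega_\pm)=\{f\in L^2(\Omega_\pm;\mathbb C^2):(\sigma\cdot\nabla)f\in L^2(\Omega_\pm;\mathbb C^2)\}$$ (distributional derivatives). The functions of $H(\sigma,\Omega_\pm)$ have Dirichlet traces $\mathcal T^D_\pm f\in H^{-1/2}(\mathbb R;\mathbb C^2)$ on the line $\Sigma=\{x=0\}$, where $\mathcal T^D_\pm$ is the extension by continuity of $u\mapsto u(0,\cdot)$ from the dense subspace of restrictions to $\Omega_\pm$ of functions in $C_c^\infty(\mathbb R^2;\mathbb C^2)$. Let $D_{\eta,\tau}$ be the operator in $L^2(\mathbb R^2;\mathbb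 C^2)$ whose domain consists of all $\psi=\psi_+\oplus\psi_-\in H(\sigma,\Omega_+)\oplus H(\sigma,\Omega_-)$ with $$i\sigma_1(\mathcal T^D_+\psi_+-\mathcal T^D_-\psi_-)=\tfrac12(\eta\sigma_0+\tau\sigma_3)(\mathcal T^D_+\psi_++\mathcal T^D_-\psi_-),$$ acting as $D_{\eta,\tau}\psi=(-i\,\sigma\cdot\nabla+m\sigma_3)\psi_+\oplus(-i\,\sigma\cdot\nabla+m\sigma_3)\psi_-$. Put $z_*=-\frac{\tau}{\eta}m$ and $$\Lambda_{\eta,\tau}=\big[i\sigma_1-\tfrac12(\eta\sigma_0+\tau\sigma_3)\big]^{-1}\big[i\sigma_1+\tfrac12(\eta\sigma_0+\tau\sigma_3)\big].$$ For $\Xi\in L^2(\mathbb R)$ define, for $x\neq0$ and $y\in\mathbb R$, $$\psi_\Xi(x,y)=\frac1{2\sqrt\pi}\big[\theta(x)\Lambda_{\eta,\tau}+\theta(-x)\sigma_0\big]\int_{\mathbb R}\begin{pmatrix}\sqrt{(1-\frac\tau\eta)\big(\sqrt{k^2+\frac{4m^2}{\eta^2}}+k\big)}\\-i\sqrt{(1+\frac\tau\eta)\big(\sqrt{k^2+\frac{4m^2}{\eta^2}}-k\big)}\end{pmatrix}\Xi(k)\,e^{iky-\sqrt{k^2+\frac{4m^2}{\eta^2}}\,|x|}\,dk,$$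 where $\theta$ is the Heaviside function. Then: 1. $z_*$ is an eigenvalue of $D_{\eta,\tau}$ of infinite multiplicity, that is, its eigenspace is infinite-dimensional. 2. For every $\Xi\in L^2(\mathbb R)$ the integral converges absolutely for all $x\ne0$, $y\in\mathbb R$, and $\psi_\Xi\in L^2(\mathbb R^2;\mathbb C^2)$ with $\|\psi_\Xi\|_{L^2(\mathbb R^2;\mathbb C^2)}=\|\Xi\|_{L^2(\mathbb R)}$. 3. The eigenspace of $D_{\eta,\tau}$ for the eigenvalue $z_*$ is exactly $\{\psi_\Xi:\Xi\in L^2(\mathbb R)\}$. -/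

import Mathlib

open MeasureTheory Filter Topology
open scoped ContDiff SchwartzMap ENNReal

noncomputable section

namespace DiracLine

/-- The spinor space `ℂ²` with its Hermitian norm. -/
abbrev Spinor : Type := EuclideanSpace ℂ (Fin 2)

/-- The Hilbert space `L²(ℝ², dx dy; ℂ²)`. -/
abbrev L2Spinor : Type := Lp Spinor 2 (volume : Measure (ℝ × ℝ))

/-! ### Pauli matrices and the half-planes -/

/-- The Pauli matrix `σ₁`. -/
def σ₁ : Matrix (Fin 2) (Fin 2) ℂ := !![0, 1; 1, 0]

/-- The Pauli matrix `σ₂`. -/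
def σ₂ : Matrix (Fin 2) (Fin 2) ℂ := !![0, -Complex.I; Complex.I, 0]

/-- The Pauli matrix `σ₃`. -/
def σ₃ : Matrix (Fin 2) (Fin 2) ℂ := !![1, 0; 0, -1]

/-- The action of a `2 × 2` matrix on spinors. -/
def act (M : Matrix (Fin 2) (Fin 2) ℂ) : Spinor →L[ℂ] Spinor :=
  Matrix.toEuclideanCLM (n := Fin 2) (𝕜 := ℂ) M

/-- `v · σ = v₁ σ₁ + v₂ σ₂` for a vector `v ∈ ℝ²`. -/
def sigmaDot (v : ℝ × ℝ) : Matrix (Fin 2) (Fin 2) ℂ := (v.1 : ℂ) • σ₁ + (v.2 : ℂ) • σ₂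

/-- The open half-plane `Ω₊ = {x > 0}`. -/
def OmegaPlus : Set (ℝ × ℝ) := {p | 0 < p.1}

/-- The open half-plane `Ω₋ = {x < 0}`. -/
def OmegaMinus : Set (ℝ × ℝ) := {p | p.1 < 0}

/-- The unit normal to the line `x = 0` that points out of `Ω₊`. -/
def normal : ℝ × ℝ := (-1, 0)

/-! ### The spaces `H(σ, Ω)` -/

/-- The classical expression `(σ · ∇) u = σ₁ ∂ₓu + σ₂ ∂_y u`. -/
def sigmaGrad (u : ℝ × ℝ → Spinor) (p : ℝ × ℝ) : Spinor :=
  act σ₁ (fderiv ℝ u p (1, 0)) + act σ₂ (fderiv ℝ u p (0, 1))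

/-- `(σ · ∇) f = g` in the sense of distributions on the open set `Ω`. -/
def IsWeakSigmaGrad (Ω : Set (ℝ × ℝ)) (f g : ℝ × ℝ → Spinor) : Prop :=
  ∀ φ : ℝ × ℝ → ℝ, ContDiff ℝ ∞ φ → HasCompactSupport φ → tsupport φ ⊆ Ω →
    ∫ p in Ω, (fderiv ℝ φ p (1, 0) • act σ₁ (f p) + fderiv ℝ φ p (0, 1) • act σ₂ (f p)) =
      -∫ p in Ω, φ p • g p

/-- `f` belongs to `H(σ, Ω) = {f ∈ L²(Ω; ℂ²) | (σ · ∇) f ∈ L²(Ω; ℂ²)}`, with `(σ · ∇) f = g`. -/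
structure HSigma (Ω : Set (ℝ × ℝ)) (f g : ℝ × ℝ → Spinor) : Prop where
  memLp : MemLp f 2 (volume.restrict Ω)
  memLp_grad : MemLp g 2 (volume.restrict Ω)
  weak : IsWeakSigmaGrad Ω f g

/-! ### Dirichlet traces in `H^{-1/2}` of the line -/

/-- The restriction of a Schwartz function to the line `x = 0`, parametrized by `y ↦ (0, y)`. -/
def lineRestrict : 𝓢(ℝ × ℝ, Spinor) →L[ℂ] 𝓢(ℝ, Spinor) :=
  SchwartzMap.compCLMOfAntilipschitz ℂ (K := 1) (g := fun y : ℝ => ((0 : ℝ), y))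
    (ContinuousLinearMap.inr ℝ ℝ ℝ).hasTemperateGrowth
    (by
      refine Isometry.antilipschitz ?_
      intro a b
      simp [Prod.edist_eq])

theorem lineRestrict_apply (u : 𝓢(ℝ × ℝ, Spinor)) (y : ℝ) : lineRestrict u y = u (0, y) := rfl

/-- Norm convergence `T n → t` in the Sobolev space `H^s(ℝ; ℂ²)`: the differences `T n - t`
belong to it, and the `L²` norms of their Bessel potentials of order `s` tend to `0`. -/
def TendstoSobolev (s : ℝ) (T : ℕ → 𝓢'(ℝ, Spinor)) (t : 𝓢'(ℝ, Spinor)) : Prop :=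
  ∃ w : ℕ → Lp Spinor 2 (volume : Measure ℝ),
    (∀ n, TemperedDistribution.besselPotential ℝ Spinor s (T n - t) = (w n : 𝓢'(ℝ, Spinor))) ∧
    Tendsto (fun n => ‖w n‖) atTop (𝓝 0)

/-- `t ∈ H^{-1/2}(ℝ; ℂ²)` is the Dirichlet trace on the line `x = 0` of `f ∈ H(σ, Ω)`, where
`Ω` is one of the half-planes and `g = (σ · ∇) f`. The trace is the extension by continuity of the
restriction map `u ↦ u(0, ·)` from the space of restrictions to `Ω` of functions in
`C_c^∞(ℝ²; ℂ²)`, which is dense in `H(σ, Ω)` for the graph norm, to a map into `H^{-1/2}`. -/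
def IsDirichletTrace (Ω : Set (ℝ × ℝ)) (f g : ℝ × ℝ → Spinor) (t : 𝓢'(ℝ, Spinor)) : Prop :=
  TemperedDistribution.MemSobolev (-1 / 2) 2 t ∧
  ∃ u : ℕ → 𝓢(ℝ × ℝ, Spinor), (∀ n, HasCompactSupport (u n)) ∧
    Tendsto (fun n => eLpNorm (fun p => u n p - f p) 2 (volume.restrict Ω)) atTop (𝓝 0) ∧
    Tendsto (fun n => eLpNorm (fun p => sigmaGrad (u n) p - g p) 2 (volume.restrict Ω))
      atTop (𝓝 0) ∧
    TendstoSobolev (-1 / 2) (fun n => (lineRestrict (u n) : 𝓢'(ℝ, Spinor))) t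

/-- The transmission condition
`-i (n · σ) (t₊ - t₋) = ½ (η σ₀ + τ σ₃) (t₊ + t₋)`, as an identity of distributions on the line. -/
def Transmission (η τ : ℝ) (tp tm : 𝓢'(ℝ, Spinor)) : Prop :=
  ∀ φ : 𝓢(ℝ, ℂ),
    act (-Complex.I • sigmaDot normal) (tp φ - tm φ) =
      act ((1 / 2 : ℂ) • ((η : ℂ) • 1 + (τ : ℂ) • σ₃)) (tp φ + tm φ)

/-! ### The Dirac operator with a delta-shell interaction on the line -/

/-- `ψ = ψ₊ ⊕ ψ₋` lies in the domain of the operator `D_{η,τ}` with mass `m`, and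
`χ = (-i (σ · ∇) + m σ₃) ψ₊ ⊕ (-i (σ · ∇) + m σ₃) ψ₋`. -/
def IsDiracValue (m η τ : ℝ) (ψ χ : L2Spinor) : Prop :=
  ∃ (gp gm : ℝ × ℝ → Spinor) (tp tm : 𝓢'(ℝ, Spinor)),
    HSigma OmegaPlus ψ gp ∧ HSigma OmegaMinus ψ gm ∧
    IsDirichletTrace OmegaPlus ψ gp tp ∧ IsDirichletTrace OmegaMinus ψ gm tm ∧
    Transmission η τ tp tm ∧
    (∀ᵐ p ∂(volume.restrict OmegaPlus), χ p = -Complex.I • gp p + (m : ℂ) • act σ₃ (ψ p)) ∧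
    (∀ᵐ p ∂(volume.restrict OmegaMinus), χ p = -Complex.I • gm p + (m : ℂ) • act σ₃ (ψ p))

theorem integrable_test {Ω : Set (ℝ × ℝ)} {f : ℝ × ℝ → Spinor} {φ : ℝ × ℝ → ℝ}
    (hf : MemLp f 2 (volume.restrict Ω)) (hc : Continuous φ) (hs : HasCompactSupport φ) :
    Integrable (fun p => φ p • f p) (volume.restrict Ω) := by
  have h1 : MemLp φ 2 (volume.restrict Ω) :=
    (hc.memLp_of_hasCompactSupport (μ := volume) hs).restrict Ω
  exact memLp_one_iff_integrable.1 (hf.smul h1)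

theorem integrable_weak {Ω : Set (ℝ × ℝ)} {f : ℝ × ℝ → Spinor} {φ : ℝ × ℝ → ℝ}
    (hf : MemLp f 2 (volume.restrict Ω)) (hc : ContDiff ℝ ∞ φ) (hs : HasCompactSupport φ) :
    Integrable (fun p => fderiv ℝ φ p (1, 0) • act σ₁ (f p) +
      fderiv ℝ φ p (0, 1) • act σ₂ (f p)) (volume.restrict Ω) := by
  have hc' : Continuous (fderiv ℝ φ) := hc.continuous_fderiv (by simp)
  refine Integrable.add ?_ ?_
  · exact integrable_test ((act σ₁).comp_memLp' hf) (hc'.clm_apply continuous_const)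
      (hs.fderiv_apply ℝ (1, 0))
  · exact integrable_test ((act σ₂).comp_memLp' hf) (hc'.clm_apply continuous_const)
      (hs.fderiv_apply ℝ (0, 1))

theorem HSigma.congr {Ω : Set (ℝ × ℝ)} {f f' g : ℝ × ℝ → Spinor} (h : HSigma Ω f g)
    (hf : f =ᵐ[volume.restrict Ω] f') : HSigma Ω f' g := by
  refine ⟨(memLp_congr_ae hf).1 h.memLp, h.memLp_grad, fun φ hφ hs ht => ?_⟩
  rw [← h.weak φ hφ hs ht]
  refine integral_congr_ae ?_
  filter_upwards [hf] with p hp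
  rw [hp]

theorem HSigma.add {Ω : Set (ℝ × ℝ)} {f f' g g' : ℝ × ℝ → Spinor} (h : HSigma Ω f g)
    (h' : HSigma Ω f' g') : HSigma Ω (f + f') (g + g') := by
  refine ⟨h.memLp.add h'.memLp, h.memLp_grad.add h'.memLp_grad, fun φ hφ hs ht => ?_⟩
  have e1 := h.weak φ hφ hs ht
  have e2 := h'.weak φ hφ hs ht
  have i1 := integrable_weak h.memLp hφ hs
  have i2 := integrable_weak h'.memLp hφ hs
  have i3 := integrable_test h.memLp_grad hφ.continuous hs
  have i4 := integrable_test h'.memLp_grad hφ.continuous hs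
  simp only [Pi.add_apply, smul_add, map_add]
  rw [integral_add i3 i4, neg_add, ← e1, ← e2, ← integral_add i1 i2]
  congr 1
  funext p
  abel

theorem HSigma.smul {Ω : Set (ℝ × ℝ)} {f g : ℝ × ℝ → Spinor} (c : ℂ) (h : HSigma Ω f g) :
    HSigma Ω (c • f) (c • g) := by
  refine ⟨h.memLp.const_smul c, h.memLp_grad.const_smul c, fun φ hφ hs ht => ?_⟩
  have e1 := h.weak φ hφ hs ht
  simp only [Pi.smul_apply, map_smul]
  have r : ∀ (a : ℝ) (v : Spinor), a • c • v = c • a • v := fun a v => smul_comm a c v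
  simp only [r, ← smul_add]
  rw [integral_smul, integral_smul, e1, smul_neg]

/-- The weak expression `(σ · ∇) f` is unique up to null sets. -/
theorem HSigma.grad_eq_zero {Ω : Set (ℝ × ℝ)} (hΩ : IsOpen Ω) {f g : ℝ × ℝ → Spinor}
    (h : HSigma Ω f g) (hf : f =ᵐ[volume.restrict Ω] 0) : g =ᵐ[volume.restrict Ω] 0 := by
  have h0 := h.congr hf
  have hloc : LocallyIntegrableOn g Ω := by
    intro x hx
    obtain ⟨K, hK, hxK, hKΩ⟩ := exists_compact_subset hΩ hx
    refine ⟨K, mem_nhdsWithin_of_mem_nhds (mem_interior_iff_mem_nhds.1 hxK), ?_⟩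
    have := h.memLp_grad.mono_measure (Measure.restrict_mono hKΩ le_rfl)
    have hfin : IsFiniteMeasure (volume.restrict K) := ⟨by simpa using hK.measure_lt_top⟩
    exact this.integrable (by norm_num)
  have key := hΩ.ae_eq_zero_of_integral_contDiff_smul_eq_zero (μ := volume) hloc (by
    intro φ hφ hs ht
    have e := h0.weak φ hφ hs ht
    simp only [Pi.zero_apply, map_zero, smul_zero, add_zero, integral_zero] at e
    rw [← setIntegral_eq_integral_of_forall_compl_eq_zero (s := Ω)]
    · exact (neg_eq_zero.1 e.symm)
    · intro x hx
      rw [image_eq_zero_of_notMem_tsupport (fun hh => hx (ht hh)), zero_smul])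
  rw [EventuallyEq, ae_restrict_iff' hΩ.measurableSet]
  exact key

theorem sigmaGrad_add (u v : 𝓢(ℝ × ℝ, Spinor)) (p : ℝ × ℝ) :
    sigmaGrad (u + v : 𝓢(ℝ × ℝ, Spinor)) p = sigmaGrad u p + sigmaGrad v p := by
  have : fderiv ℝ ((u + v : 𝓢(ℝ × ℝ, Spinor)) : ℝ × ℝ → Spinor) p =
      fderiv ℝ u p + fderiv ℝ v p := fderiv_add u.differentiableAt v.differentiableAt
  simp only [sigmaGrad, this, add_apply, map_add]
  abel

theorem sigmaGrad_smul (c : ℂ) (u : 𝓢(ℝ × ℝ, Spinor)) (p : ℝ × ℝ) :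
    sigmaGrad (c • u : 𝓢(ℝ × ℝ, Spinor)) p = c • sigmaGrad u p := by
  have : fderiv ℝ ((c • u : 𝓢(ℝ × ℝ, Spinor)) : ℝ × ℝ → Spinor) p = c • fderiv ℝ u p :=
    fderiv_const_smul u.differentiableAt c
  simp only [sigmaGrad, this, smul_apply, map_smul, smul_add]

theorem continuous_sigmaGrad (u : 𝓢(ℝ × ℝ, Spinor)) : Continuous (sigmaGrad u) := by
  have hc : Continuous (fderiv ℝ u) := (u.smooth 1).continuous_fderiv (by simp)
  exact ((act σ₁).continuous.comp (hc.clm_apply continuous_const)).add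
    ((act σ₂).continuous.comp (hc.clm_apply continuous_const))

theorem TendstoSobolev.add {s : ℝ} {T T' : ℕ → 𝓢'(ℝ, Spinor)} {t t' : 𝓢'(ℝ, Spinor)}
    (h : TendstoSobolev s T t) (h' : TendstoSobolev s T' t') :
    TendstoSobolev s (fun n => T n + T' n) (t + t') := by
  obtain ⟨w, hw, hw0⟩ := h
  obtain ⟨w', hw', hw0'⟩ := h'
  refine ⟨fun n => w n + w' n, fun n => ?_, ?_⟩
  · rw [add_sub_add_comm, map_add, hw, hw', ← Lp.toTemperedDistributionCLM_apply,
      ← Lp.toTemperedDistributionCLM_apply, ← Lp.toTemperedDistributionCLM_apply, map_add]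
  · refine squeeze_zero (fun n => norm_nonneg _) (fun n => norm_add_le _ _) ?_
    simpa using hw0.add hw0'

theorem TendstoSobolev.smul {s : ℝ} {T : ℕ → 𝓢'(ℝ, Spinor)} {t : 𝓢'(ℝ, Spinor)} (c : ℂ)
    (h : TendstoSobolev s T t) : TendstoSobolev s (fun n => c • T n) (c • t) := by
  obtain ⟨w, hw, hw0⟩ := h
  refine ⟨fun n => c • w n, fun n => ?_, ?_⟩
  · change TemperedDistribution.besselPotential ℝ Spinor s (c • T n - c • t) =
      Lp.toTemperedDistribution (c • w n)
    have e : c • T n - c • t = c • (T n - t) := by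
      refine DFunLike.ext _ _ fun φ => ?_
      exact (smul_sub c (T n φ) (t φ)).symm
    rw [e, map_smul, hw, ← Lp.toTemperedDistributionCLM_apply,
      ← Lp.toTemperedDistributionCLM_apply, map_smul]
  · simpa [norm_smul] using hw0.const_mul ‖c‖

theorem tendsto_eLpNorm_add {μ : Measure (ℝ × ℝ)} {a b : ℕ → ℝ × ℝ → Spinor}
    (ha : ∀ n, AEStronglyMeasurable (a n) μ) (hb : ∀ n, AEStronglyMeasurable (b n) μ)
    (ha0 : Tendsto (fun n => eLpNorm (a n) 2 μ) atTop (𝓝 0))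
    (hb0 : Tendsto (fun n => eLpNorm (b n) 2 μ) atTop (𝓝 0)) :
    Tendsto (fun n => eLpNorm (a n + b n) 2 μ) atTop (𝓝 0) := by
  refine tendsto_of_tendsto_of_tendsto_of_le_of_le tendsto_const_nhds
    (by simpa using ha0.add hb0) (fun n => bot_le)
    (fun n => eLpNorm_add_le (ha n) (hb n) (by norm_num))

theorem tendsto_eLpNorm_smul {μ : Measure (ℝ × ℝ)} {a : ℕ → ℝ × ℝ → Spinor} (c : ℂ)
    (ha0 : Tendsto (fun n => eLpNorm (a n) 2 μ) atTop (𝓝 0)) :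
    Tendsto (fun n => eLpNorm (c • a n) 2 μ) atTop (𝓝 0) := by
  simp only [eLpNorm_const_smul]
  simpa using ENNReal.Tendsto.const_mul ha0 (Or.inr enorm_ne_top)

theorem IsDirichletTrace.congr {Ω : Set (ℝ × ℝ)} {f f' g : ℝ × ℝ → Spinor}
    {t : 𝓢'(ℝ, Spinor)} (h : IsDirichletTrace Ω f g t) (hf : f =ᵐ[volume.restrict Ω] f') :
    IsDirichletTrace Ω f' g t := by
  obtain ⟨ht, u, hu, h1, h2, h3⟩ := h
  refine ⟨ht, u, hu, ?_, h2, h3⟩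
  refine h1.congr fun n => eLpNorm_congr_ae ?_
  filter_upwards [hf] with p hp
  rw [hp]

theorem IsDirichletTrace.add {Ω : Set (ℝ × ℝ)} {f f' g g' : ℝ × ℝ → Spinor}
    {t t' : 𝓢'(ℝ, Spinor)} (hH : HSigma Ω f g) (hH' : HSigma Ω f' g')
    (h : IsDirichletTrace Ω f g t) (h' : IsDirichletTrace Ω f' g' t') :
    IsDirichletTrace Ω (f + f') (g + g') (t + t') := by
  obtain ⟨ht, u, hu, h1, h2, h3⟩ := h
  obtain ⟨ht', u', hu', h1', h2', h3'⟩ := h'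
  refine ⟨ht.add ht', fun n => u n + u' n, fun n => (hu n).add (hu' n), ?_, ?_, ?_⟩
  · refine (tendsto_eLpNorm_add (fun n => ?_) (fun n => ?_) h1 h1').congr fun n => ?_
    · exact (u n).continuous.aestronglyMeasurable.sub hH.memLp.1
    · exact (u' n).continuous.aestronglyMeasurable.sub hH'.memLp.1
    · congr 1
      funext p
      simp only [Pi.add_apply, add_apply]
      abel
  · refine (tendsto_eLpNorm_add (fun n => ?_) (fun n => ?_) h2 h2').congr fun n => ?_
    · exact (continuous_sigmaGrad (u n)).aestronglyMeasurable.sub hH.memLp_grad.1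
    · exact (continuous_sigmaGrad (u' n)).aestronglyMeasurable.sub hH'.memLp_grad.1
    · congr 1
      funext p
      simp only [Pi.add_apply, sigmaGrad_add]
      abel
  · simpa only [map_add] using h3.add h3'

theorem IsDirichletTrace.smul {Ω : Set (ℝ × ℝ)} {f g : ℝ × ℝ → Spinor}
    {t : 𝓢'(ℝ, Spinor)} (c : ℂ) (h : IsDirichletTrace Ω f g t) :
    IsDirichletTrace Ω (c • f) (c • g) (c • t) := by
  obtain ⟨ht, u, hu, h1, h2, h3⟩ := h
  refine ⟨ht.smul c, fun n => c • u n,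
    fun n => (hu n).mono' ((Function.support_const_smul_subset c (u n)).trans subset_closure),
    ?_, ?_, ?_⟩
  · refine (tendsto_eLpNorm_smul c h1).congr fun n => ?_
    congr 1
    funext p
    simp [smul_sub]
  · refine (tendsto_eLpNorm_smul c h2).congr fun n => ?_
    congr 1
    funext p
    simp only [sigmaGrad_smul, Pi.smul_apply, smul_sub]
  · simpa only [map_smul] using h3.smul c

theorem isOpen_OmegaPlus : IsOpen OmegaPlus := isOpen_lt continuous_const continuous_fst

theorem isOpen_OmegaMinus : IsOpen OmegaMinus := isOpen_lt continuous_fst continuous_const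

theorem IsDiracValue.zero (m η τ : ℝ) : IsDiracValue m η τ 0 0 := by
  have z : ∀ Ω : Set (ℝ × ℝ), ((0 : L2Spinor) : ℝ × ℝ → Spinor) =ᵐ[volume.restrict Ω] 0 :=
    fun Ω => ae_restrict_of_ae (Lp.coeFn_zero _ _ _)
  have hH : ∀ Ω : Set (ℝ × ℝ), HSigma Ω 0 0 := fun Ω =>
    ⟨MemLp.zero, MemLp.zero, fun φ _ _ _ => by simp⟩
  have hT : ∀ Ω : Set (ℝ × ℝ), IsDirichletTrace Ω 0 0 0 := fun Ω => by
    refine ⟨by simp, fun _ => 0, fun n => by simp [HasCompactSupport.zero], ?_, ?_, ?_⟩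
    · simp
    · have : (fun p => sigmaGrad (0 : 𝓢(ℝ × ℝ, Spinor)) p - (0 : ℝ × ℝ → Spinor) p) = 0 := by
        funext p
        have h := sigmaGrad_smul 0 0 p
        rw [smul_zero, zero_smul] at h
        rw [h]
        simp
      simp only [this, eLpNorm_zero]
      exact tendsto_const_nhds
    · refine ⟨fun _ => 0, fun n => ?_, by simp⟩
      rw [← Lp.toTemperedDistributionCLM_apply]
      simp only [map_zero, sub_zero]
  refine ⟨0, 0, 0, 0, (hH _).congr (z _).symm, (hH _).congr (z _).symm,
    (hT _).congr (z _).symm, (hT _).congr (z _).symm, fun φ => by simp, ?_, ?_⟩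
  · exact Eventually.of_forall fun p => by simp
  · exact Eventually.of_forall fun p => by simp

theorem IsDiracValue.add {m η τ : ℝ} {ψ χ ψ' χ' : L2Spinor} (h : IsDiracValue m η τ ψ χ)
    (h' : IsDiracValue m η τ ψ' χ') : IsDiracValue m η τ (ψ + ψ') (χ + χ') := by
  obtain ⟨gp, gm, tp, tm, a1, a2, a3, a4, a5, a6, a7⟩ := h
  obtain ⟨gp', gm', tp', tm', b1, b2, b3, b4, b5, b6, b7⟩ := h'
  have z : ∀ (Ω : Set (ℝ × ℝ)) (ψ ψ' : L2Spinor),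
      ((ψ + ψ' : L2Spinor) : ℝ × ℝ → Spinor) =ᵐ[volume.restrict Ω] ψ + ψ' :=
    fun Ω ψ ψ' => ae_restrict_of_ae (Lp.coeFn_add _ _)
  refine ⟨gp + gp', gm + gm', tp + tp', tm + tm', (a1.add b1).congr (z _ _ _).symm,
    (a2.add b2).congr (z _ _ _).symm, (a3.add a1 b1 b3).congr (z _ _ _).symm,
    (a4.add a2 b2 b4).congr (z _ _ _).symm, fun φ => ?_, ?_, ?_⟩
  · have e1 := a5 φ
    have e2 := b5 φ
    have r1 : (tp + tp') φ = tp φ + tp' φ := rfl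
    have r2 : (tm + tm') φ = tm φ + tm' φ := rfl
    rw [r1, r2, add_sub_add_comm, add_add_add_comm, map_add, e1, e2, ← map_add]
  · filter_upwards [a6, b6, z OmegaPlus ψ ψ', z OmegaPlus χ χ'] with p h1 h2 h3 h4
    rw [h3, h4]
    simp only [Pi.add_apply, h1, h2, smul_add, map_add]
    abel
  · filter_upwards [a7, b7, z OmegaMinus ψ ψ', z OmegaMinus χ χ'] with p h1 h2 h3 h4
    rw [h3, h4]
    simp only [Pi.add_apply, h1, h2, smul_add, map_add]
    abel

theorem IsDiracValue.smul {m η τ : ℝ} {ψ χ : L2Spinor} (c : ℂ) (h : IsDiracValue m η τ ψ χ) :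
    IsDiracValue m η τ (c • ψ) (c • χ) := by
  obtain ⟨gp, gm, tp, tm, a1, a2, a3, a4, a5, a6, a7⟩ := h
  have z : ∀ (Ω : Set (ℝ × ℝ)) (ψ : L2Spinor),
      ((c • ψ : L2Spinor) : ℝ × ℝ → Spinor) =ᵐ[volume.restrict Ω] c • ψ :=
    fun Ω ψ => ae_restrict_of_ae (Lp.coeFn_smul _ _)
  have r : ∀ (a : ℂ) (v : Spinor), c • a • v = a • c • v := fun a v => smul_comm c a v
  refine ⟨c • gp, c • gm, c • tp, c • tm, (a1.smul c).congr (z _ _).symm,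
    (a2.smul c).congr (z _ _).symm, (a3.smul c).congr (z _ _).symm,
    (a4.smul c).congr (z _ _).symm, fun φ => ?_, ?_, ?_⟩
  · have e1 := a5 φ
    have r1 : (c • tp) φ = c • tp φ := rfl
    have r2 : (c • tm) φ = c • tm φ := rfl
    rw [r1, r2, ← smul_sub, ← smul_add, map_smul, e1, map_smul]
  · filter_upwards [a6, z OmegaPlus ψ, z OmegaPlus χ] with p h1 h3 h4
    rw [h3, h4]
    simp only [Pi.smul_apply, h1, smul_add, map_smul, r]
  · filter_upwards [a7, z OmegaMinus ψ, z OmegaMinus χ] with p h1 h3 h4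
    rw [h3, h4]
    simp only [Pi.smul_apply, h1, smul_add, map_smul, r]

theorem ae_of_ae_halfPlanes {P : ℝ × ℝ → Prop}
    (h1 : ∀ᵐ p ∂((volume : Measure (ℝ × ℝ)).restrict OmegaPlus), P p)
    (h2 : ∀ᵐ p ∂((volume : Measure (ℝ × ℝ)).restrict OmegaMinus), P p) :
    ∀ᵐ p ∂(volume : Measure (ℝ × ℝ)), P p := by
  rw [ae_restrict_iff' isOpen_OmegaPlus.measurableSet] at h1
  rw [ae_restrict_iff' isOpen_OmegaMinus.measurableSet] at h2
  have h3 : ∀ᵐ p ∂(volume : Measure (ℝ × ℝ)), p.1 ≠ 0 := by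
    have : ∀ᵐ x ∂(volume : Measure ℝ), x ≠ 0 := by simp [ae_iff]
    exact Measure.quasiMeasurePreserving_fst.ae this
  filter_upwards [h1, h2, h3] with p a b c
  rcases lt_or_gt_of_ne c with d | d
  · exact b d
  · exact a d

/-- The graph `{(ψ, D_{η,τ} ψ)}` of the Dirac operator, as a subspace of `L² × L²`. -/
def diracGraph (m η τ : ℝ) : Submodule ℂ (L2Spinor × L2Spinor) where
  carrier := {q | IsDiracValue m η τ q.1 q.2}
  zero_mem' := IsDiracValue.zero m η τ
  add_mem' := IsDiracValue.add
  smul_mem' c _ h := h.smul c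

/-- The value `D_{η,τ} ψ` is determined by `ψ`. -/
theorem diracGraph_single_valued (m η τ : ℝ) :
    ∀ q ∈ diracGraph m η τ, q.1 = 0 → q.2 = 0 := by
  rintro ⟨ψ, χ⟩ ⟨gp, gm, tp, tm, a1, a2, a3, a4, a5, a6, a7⟩ h0
  have h0' : ψ = 0 := h0
  subst h0'
  have z : ∀ Ω : Set (ℝ × ℝ), ((0 : L2Spinor) : ℝ × ℝ → Spinor) =ᵐ[volume.restrict Ω] 0 :=
    fun Ω => ae_restrict_of_ae (Lp.coeFn_zero _ _ _)
  refine (Lp.eq_zero_iff_ae_eq_zero).2 (ae_of_ae_halfPlanes ?_ ?_)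
  · filter_upwards [a6, a1.grad_eq_zero isOpen_OmegaPlus (z _)] with p h1 h3
    simp [h1, h3]
  · filter_upwards [a7, a2.grad_eq_zero isOpen_OmegaMinus (z _)] with p h1 h3
    simp [h1, h3]

/-- The unbounded operator `D_{η,τ}` on `L²(ℝ²; ℂ²)`. -/
def diracOp (m η τ : ℝ) : L2Spinor →ₗ.[ℂ] L2Spinor := (diracGraph m η τ).toLinearPMap

theorem diracOp_graph (m η τ : ℝ) : (diracOp m η τ).graph = diracGraph m η τ :=
  Submodule.toLinearPMap_graph_eq _ (diracGraph_single_valued m η τ)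

/-- The eigenspace `{ψ ∈ dom A | A ψ = z ψ}` of an unbounded operator `A`. -/
def eigenspace (A : L2Spinor →ₗ.[ℂ] L2Spinor) (z : ℂ) : Submodule ℂ L2Spinor where
  carrier := {ψ | ∃ h : ψ ∈ A.domain, A ⟨ψ, h⟩ = z • ψ}
  zero_mem' := ⟨A.domain.zero_mem, by
    rw [smul_zero]
    exact A.map_zero⟩
  add_mem' := by
    rintro a b ⟨ha, ea⟩ ⟨hb, eb⟩
    refine ⟨A.domain.add_mem ha hb, ?_⟩
    rw [smul_add, ← ea, ← eb]
    exact A.map_add ⟨a, ha⟩ ⟨b, hb⟩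
  smul_mem' := by
    rintro c a ⟨ha, ea⟩
    refine ⟨A.domain.smul_mem c ha, ?_⟩
    rw [smul_comm, ← ea]
    exact A.map_smul c ⟨a, ha⟩

theorem mem_eigenspace_diracOp_iff {m η τ : ℝ} {z : ℂ} {ψ : L2Spinor} :
    ψ ∈ eigenspace (diracOp m η τ) z ↔ IsDiracValue m η τ ψ (z • ψ) := by
  have h : IsDiracValue m η τ ψ (z • ψ) ↔ (ψ, z • ψ) ∈ (diracOp m η τ).graph := by
    rw [diracOp_graph]
    exact Iff.rfl
  rw [h, LinearPMap.mem_graph_iff]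
  constructor
  · rintro ⟨hd, e⟩
    exact ⟨⟨ψ, hd⟩, rfl, e⟩
  · rintro ⟨⟨y, hy⟩, e1, e2⟩
    have e1' : y = ψ := e1
    subst e1'
    exact ⟨hy, e2⟩

/-! ### The explicit eigenfunctions -/

/-- The point `z_* = -(τ / η) m`. -/
def zStar (m η τ : ℝ) : ℝ := -(τ / η) * m

/-- `Λ_{η,τ} = [i σ₁ - ½ (η σ₀ + τ σ₃)]⁻¹ [i σ₁ + ½ (η σ₀ + τ σ₃)]`. -/
def Lam (η τ : ℝ) : Matrix (Fin 2) (Fin 2) ℂ :=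
  (Complex.I • σ₁ - (1 / 2 : ℂ) • ((η : ℂ) • 1 + (τ : ℂ) • σ₃))⁻¹ *
    (Complex.I • σ₁ + (1 / 2 : ℂ) • ((η : ℂ) • 1 + (τ : ℂ) • σ₃))

/-- The Heaviside function. -/
def heaviside (x : ℝ) : ℂ := if 0 < x then 1 else 0

/-- The decay rate `√(k² + 4 m² / η²)`. -/
def kappa (m η k : ℝ) : ℝ := Real.sqrt (k ^ 2 + 4 * m ^ 2 / η ^ 2)

/-- The spinor amplitude
`(√((1 - τ/η) (√(k² + 4m²/η²) + k)), -i √((1 + τ/η) (√(k² + 4m²/η²) - k)))`. -/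
def amplitude (m η τ k : ℝ) : Spinor :=
  !₂[(Real.sqrt ((1 - τ / η) * (kappa m η k + k)) : ℂ),
    -Complex.I * (Real.sqrt ((1 + τ / η) * (kappa m η k - k)) : ℂ)]

/-- The integrand, as a function of `k`, of the integral that defines `ψ_Ξ(x, y)`. -/
def psiIntegrand (m η τ : ℝ) (Ξ : ℝ → ℂ) (x y k : ℝ) : Spinor :=
  (Ξ k * Complex.exp (Complex.I * k * y - kappa m η k * |x|)) • amplitude m η τ k

/-- The function `ψ_Ξ`. -/
def psiXi (m η τ : ℝ) (Ξ : ℝ → ℂ) (p : ℝ × ℝ) : Spinor :=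
  ((1 / (2 * Real.sqrt Real.pi) : ℝ) : ℂ) •
    act (heaviside p.1 • Lam η τ + heaviside (-p.1) • 1)
      (∫ k : ℝ, psiIntegrand m η τ Ξ p.1 p.2 k)

end DiracLine

end

/-! On either side of the line the equation `D ψ = z ψ` reads `(σ · ∇) ψ = i (z - m σ₃) ψ`. The
Fourier transform in `y`, with `k = 2 π ξ`, turns it into the ordinary differential equation `∂ₓ u =
A(k) u`, where `A(k)` (`symbol`) is a trace-free matrix with `A(k)² = k² + m² - z²`. At `z = z_*`
one has `m² - z² = 4 m² / η²`, so the eigenvalues of `A(k)` are `±κ(k)`. A solution is square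
integrable on the side of sign `s` only if its trace lies in the eigenspace of `-s κ(k)`, and then
it is `e^{-κ |x|}` times its trace.

The two sides are coupled by the transmission condition, which for `η² - τ² = 4` is equivalent to
`t₊ = Λ t₋` with `Λ` antidiagonal (`Lam_eq`, `transmission_iff_eq_act_Lam`). The decisive fact is
`symbol_act_Lam`: at `z_*` the matrix `Λ` anticommutes with `A(k)` for every `k`, hence maps the
`κ`-eigenspace to the `-κ`-eigenspace. The transmission condition therefore imposes nothing on the
left trace, and each frequency keeps one free scalar. The vector `amplitude` spans the
`κ`-eigenspace (`symbol_amplitude`, `eq_smul_amplitude`), so the scalar is `Ξ(k)` up to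
normalization. The identity `‖a‖² + ‖Λ a‖² = 4 κ` for the amplitude `a`, together with `∫ e^{-2 κ x}
dx = 1 / (2 κ)` over `x > 0` and Plancherel, makes `Ξ ↦ ψ_Ξ` isometric. Since `L²(ℝ)` is
infinite-dimensional, so is the eigenspace.

The analysis consists in making this rigorous for traces that are only in `H^{-1/2}`. Such a trace
has Fourier transform `(1 + ξ²)^{1/4} α` with `α ∈ L²` (`sobolevDist`). Because `κ(2 π ξ)` is
comparable to `(1 + ξ²)^{1/2}`, the factor `1 / (2 κ)` compensates the squared weight, and
`H^{-1/2}` traces are what `L²` decaying solutions require. Two lemmas carry the correspondence.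
`halfPlane_solution` shows that a solution is the decaying evolution of its trace: the smooth
approximants in the definition of the trace solve the differential equation up to a defect that
tends to zero. `halfPlane_existence` shows that each decaying evolution belongs to `H(σ, Ω)` with
the expected trace: frequencies are truncated, which makes the solution smooth, and the result is
cut off in space. -/

noncomputable section

namespace DiracLine

open FourierTransform

/-! ### Plancherel's identity for Fourier integrals on `L¹ ∩ L²`. -/

section Plancherel

variable {F : Type*} [NormedAddCommGroup F] [InnerProductSpace ℂ F] [CompleteSpace F]

theorem integral_fourier_smul_eq_of_integrable (g : 𝓢(ℝ, ℂ)) {f : ℝ → F} (hf : Integrable f) :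
    ∫ x, 𝓕 g x • f x = ∫ x, g x • 𝓕 f x := by
  have := VectorFourier.integral_fourierIntegral_smul_eq_flip (L := innerₗ ℝ)
    (μ := (volume : Measure ℝ)) (ν := (volume : Measure ℝ)) (f := (g : ℝ → ℂ)) (g := f)
    Real.continuous_fourierChar continuous_inner g.integrable hf
  rw [flip_innerₗ] at this
  exact this

theorem ae_eq_of_forall_schwartz_smul {f g : ℝ → F} (hf : LocallyIntegrable f)
    (hg : LocallyIntegrable g) (h : ∀ φ : 𝓢(ℝ, ℂ), ∫ x, φ x • f x = ∫ x, φ x • g x) :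
    f =ᵐ[volume] g := by
  refine ae_eq_of_integral_contDiff_smul_eq hf hg fun φ hφ hs => ?_
  have hg₁ : HasCompactSupport (Complex.ofRealCLM ∘ φ) := hs.comp_left rfl
  have hg₂ : ContDiff ℝ ∞ (Complex.ofRealCLM ∘ φ) := by fun_prop
  simpa using h (hg₁.toSchwartzMap hg₂)

/-- On `L¹ ∩ L²` the Fourier transform of `L²` is given by the Fourier integral. -/
theorem coeFn_fourier_toLp {f : ℝ → F} (hf : Integrable f) (hf2 : MemLp f 2) :
    (𝓕 (hf2.toLp f) : Lp F 2 (volume : Measure ℝ)) =ᵐ[volume] 𝓕 f := by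
  refine ae_eq_of_forall_schwartz_smul ((Lp.memLp _).locallyIntegrable (by norm_num))
    ?_ fun φ => ?_
  · have hc : Continuous (𝓕 f) :=
      VectorFourier.fourierIntegral_continuous Real.continuous_fourierChar
        (innerSL ℝ).continuous₂ hf
    exact hc.locallyIntegrable
  · rw [← Lp.toTemperedDistribution_apply, ← Lp.fourier_toTemperedDistribution_eq,
      TemperedDistribution.fourier_apply, Lp.toTemperedDistribution_apply,
      ← integral_fourier_smul_eq_of_integrable φ hf]
    refine integral_congr_ae ?_
    filter_upwards [hf2.coeFn_toLp] with x hx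
    rw [hx]

theorem eLpNorm_fourier {f : ℝ → F} (hf : Integrable f) (hf2 : MemLp f 2) :
    eLpNorm (𝓕 f) 2 volume = eLpNorm f 2 volume := by
  have h1 := Lp.norm_fourier_eq (hf2.toLp f)
  rw [← eLpNorm_congr_ae (coeFn_fourier_toLp hf hf2), ← Lp.enorm_def, ← eLpNorm_congr_ae
    hf2.coeFn_toLp, ← Lp.enorm_def]
  rw [← ofReal_norm, ← ofReal_norm, h1]

theorem eLpNorm_fourierInv {f : ℝ → F} (hf : Integrable f) (hf2 : MemLp f 2) :
    eLpNorm (𝓕⁻ f) 2 volume = eLpNorm f 2 volume := by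
  rw [Real.fourierInv_eq_fourier_comp_neg]
  have mp : MeasurePreserving (fun x : ℝ => -x) := Measure.measurePreserving_neg volume
  rw [eLpNorm_fourier hf.comp_neg (hf2.comp_measurePreserving mp)]
  exact eLpNorm_comp_measurePreserving hf2.1 mp

end Plancherel

/-! ### Partial Fourier transform in `y`. -/

section Slices

variable {F : Type*} [NormedAddCommGroup F] [InnerProductSpace ℂ F]

/-- The Fourier transform in the second variable. -/
def sliceFourier (w : ℝ × ℝ → F) (p : ℝ × ℝ) : F := 𝓕 (fun y => w (p.1, y)) p.2

/-- The inverse Fourier transform in the second variable. -/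
def sliceFourierInv (w : ℝ × ℝ → F) (p : ℝ × ℝ) : F := 𝓕⁻ (fun ξ => w (p.1, ξ)) p.2

theorem sliceFourier_slice (w : ℝ × ℝ → F) (x : ℝ) :
    (fun y => sliceFourier w (x, y)) = 𝓕 fun y => w (x, y) := rfl

theorem sliceFourierInv_slice (w : ℝ × ℝ → F) (x : ℝ) :
    (fun y => sliceFourierInv w (x, y)) = 𝓕⁻ fun ξ => w (x, ξ) := rfl

theorem stronglyMeasurable_sliceFourier {w : ℝ × ℝ → F} (hw : StronglyMeasurable w) :
    StronglyMeasurable (sliceFourier w) := by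
  have : StronglyMeasurable (fun q : (ℝ × ℝ) × ℝ =>
      Complex.exp (↑(-2 * Real.pi * q.2 * q.1.2) * Complex.I) • w (q.1.1, q.2)) := by
    refine StronglyMeasurable.smul ?_ (hw.comp_measurable (by fun_prop))
    exact (by fun_prop : Continuous fun q : (ℝ × ℝ) × ℝ =>
      Complex.exp (↑(-2 * Real.pi * q.2 * q.1.2) * Complex.I)).stronglyMeasurable
  have h2 := this.integral_prod_right' (ν := (volume : Measure ℝ))
  refine (by ext p; rw [sliceFourier, Real.fourier_real_eq_integral_exp_smul] :
    sliceFourier w = _) ▸ h2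

theorem sliceFourierInv_eq (w : ℝ × ℝ → F) (p : ℝ × ℝ) :
    sliceFourierInv w p = sliceFourier w (p.1, -p.2) := by
  rw [sliceFourierInv, sliceFourier, Real.fourierInv_eq_fourier_neg]

theorem stronglyMeasurable_sliceFourierInv {w : ℝ × ℝ → F} (hw : StronglyMeasurable w) :
    StronglyMeasurable (sliceFourierInv w) := by
  rw [funext (sliceFourierInv_eq w)]
  exact (stronglyMeasurable_sliceFourier hw).comp_measurable (by fun_prop)

theorem eLpNorm_two_sq {α : Type*} [MeasurableSpace α] {μ : Measure α} {E : Type*}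
    [NormedAddCommGroup E] (f : α → E) : eLpNorm f 2 μ ^ 2 = ∫⁻ x, ‖f x‖ₑ ^ 2 ∂μ := by
  simpa using eLpNorm_nnreal_pow_eq_lintegral (f := f) (μ := μ) (p := 2) (by norm_num)

theorem eLpNorm_two_prod_sq {E : Type*} [NormedAddCommGroup E] {μ : Measure ℝ} [SFinite μ]
    {w : ℝ × ℝ → E} (hw : StronglyMeasurable w) :
    eLpNorm w 2 (μ.prod volume) ^ 2 = ∫⁻ x, eLpNorm (fun y => w (x, y)) 2 volume ^ 2 ∂μ := by
  rw [eLpNorm_two_sq, lintegral_prod _ (by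
    exact (hw.enorm.pow_const 2).aemeasurable)]
  simp_rw [eLpNorm_two_sq]

/-- By Tonelli the squared norm is the integral over `x` of the squared norms of the slices. -/
theorem eLpNorm_prod_congr {E E' : Type*} [NormedAddCommGroup E] [NormedAddCommGroup E']
    {μ : Measure ℝ} [SFinite μ] {w : ℝ × ℝ → E} {w' : ℝ × ℝ → E'} (hw : StronglyMeasurable w)
    (hw' : StronglyMeasurable w')
    (h : ∀ᵐ x ∂μ, eLpNorm (fun y => w (x, y)) 2 volume = eLpNorm (fun y => w' (x, y)) 2 volume) :
    eLpNorm w 2 (μ.prod volume) = eLpNorm w' 2 (μ.prod volume) := by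
  refine (ENNReal.pow_right_strictMono (n := 2) (by norm_num)).injective ?_
  rw [eLpNorm_two_prod_sq hw, eLpNorm_two_prod_sq hw']
  refine lintegral_congr_ae ?_
  filter_upwards [h] with x hx
  rw [hx]

variable [CompleteSpace F]

/-- Plancherel on almost every slice. The measure in `x` stays arbitrary, so that it can be
restricted to a half-line. -/
theorem eLpNorm_sliceFourier {μ : Measure ℝ} [SFinite μ] {w : ℝ × ℝ → F}
    (hw : StronglyMeasurable w) (h1 : ∀ᵐ x ∂μ, Integrable fun y => w (x, y))
    (h2 : ∀ᵐ x ∂μ, MemLp (fun y => w (x, y)) 2) :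
    eLpNorm (sliceFourier w) 2 (μ.prod volume) = eLpNorm w 2 (μ.prod volume) := by
  refine eLpNorm_prod_congr (stronglyMeasurable_sliceFourier hw) hw ?_
  filter_upwards [h1, h2] with x a b
  rw [sliceFourier_slice, eLpNorm_fourier a b]

theorem eLpNorm_sliceFourierInv {μ : Measure ℝ} [SFinite μ] {w : ℝ × ℝ → F}
    (hw : StronglyMeasurable w) (h1 : ∀ᵐ x ∂μ, Integrable fun y => w (x, y))
    (h2 : ∀ᵐ x ∂μ, MemLp (fun y => w (x, y)) 2) :
    eLpNorm (sliceFourierInv w) 2 (μ.prod volume) = eLpNorm w 2 (μ.prod volume) := by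
  refine eLpNorm_prod_congr (stronglyMeasurable_sliceFourierInv hw) hw ?_
  filter_upwards [h1, h2] with x a b
  rw [sliceFourierInv_slice, eLpNorm_fourierInv a b]

end Slices

/-! ### The weighted `L²` model of `H^{-1/2}` and of the transmission condition. -/

/-- The Bessel weight `(1 + ξ²)^{s/2}`. -/
def besselWeight (s ξ : ℝ) : ℝ := (1 + ‖ξ‖ ^ 2) ^ (s / 2)

theorem besselWeight_pos (s ξ : ℝ) : 0 < besselWeight s ξ := by
  unfold besselWeight; positivity

theorem hasTemperateGrowth_besselWeight (s : ℝ) :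
    (fun ξ => (besselWeight s ξ : ℂ)).HasTemperateGrowth := by
  unfold besselWeight; fun_prop

theorem besselWeight_mul_neg (s ξ : ℝ) : besselWeight s ξ * besselWeight (-s) ξ = 1 := by
  unfold besselWeight
  rw [← Real.rpow_add (by positivity)]
  simp [neg_div]

theorem smulLeft_besselWeight_neg (s : ℝ) (φ : 𝓢(ℝ, ℂ)) :
    SchwartzMap.smulLeftCLM ℂ (fun ξ => (besselWeight s ξ : ℂ))
      (SchwartzMap.smulLeftCLM ℂ (fun ξ => (besselWeight (-s) ξ : ℂ)) φ) = φ := by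
  ext ξ
  rw [SchwartzMap.smulLeftCLM_apply_apply (hasTemperateGrowth_besselWeight s),
    SchwartzMap.smulLeftCLM_apply_apply (hasTemperateGrowth_besselWeight (-s)), smul_smul,
    ← Complex.ofReal_mul, besselWeight_mul_neg]
  simp

theorem toTemperedDistribution_injective {f g : Lp Spinor 2 (volume : Measure ℝ)}
    (h : (f : 𝓢'(ℝ, Spinor)) = g) : f = g := by
  refine LinearMap.ker_eq_bot.1
    (Lp.ker_toTemperedDistributionCLM_eq_bot (F := Spinor) (μ := (volume : Measure ℝ)) (p := 2)) ?_
  exact h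

/-- The element of `H^{-1/2}(ℝ; ℂ²)` whose Fourier transform is `(1 + ξ²)^{1/4} α`. -/
def sobolevDist (α : Lp Spinor 2 (volume : Measure ℝ)) : 𝓢'(ℝ, Spinor) :=
  TemperedDistribution.besselPotential ℝ Spinor (1 / 2)
    ((𝓕⁻ α : Lp Spinor 2 (volume : Measure ℝ)) : 𝓢'(ℝ, Spinor))

theorem besselPotential_sobolevDist (α : Lp Spinor 2 (volume : Measure ℝ)) :
    TemperedDistribution.besselPotential ℝ Spinor (-1 / 2) (sobolevDist α) =
      ((𝓕⁻ α : Lp Spinor 2 (volume : Measure ℝ)) : 𝓢'(ℝ, Spinor)) := by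
  rw [sobolevDist, TemperedDistribution.besselPotential_besselPotential_apply]
  norm_num

theorem memSobolev_sobolevDist (α : Lp Spinor 2 (volume : Measure ℝ)) :
    TemperedDistribution.MemSobolev (-1 / 2) 2 (sobolevDist α) :=
  ⟨_, besselPotential_sobolevDist α⟩

theorem exists_eq_sobolevDist {t : 𝓢'(ℝ, Spinor)}
    (ht : TemperedDistribution.MemSobolev (-1 / 2) 2 t) : ∃ α, t = sobolevDist α := by
  obtain ⟨w, hw⟩ := ht
  refine ⟨𝓕 w, ?_⟩
  rw [sobolevDist, fourierInv_fourier_eq, ← hw,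
    TemperedDistribution.besselPotential_besselPotential_apply]
  norm_num

theorem sobolevDist_apply (α : Lp Spinor 2 (volume : Measure ℝ)) (φ : 𝓢(ℝ, ℂ)) :
    sobolevDist α φ =
      ∫ ξ, (SchwartzMap.smulLeftCLM ℂ (fun ξ => (besselWeight (1 / 2) ξ : ℂ)) (𝓕⁻ φ)) ξ • α ξ := by
  rw [sobolevDist, ← Lp.fourierInv_toTemperedDistribution_eq,
    TemperedDistribution.besselPotential, TemperedDistribution.fourierMultiplierCLM_apply,
    fourier_fourierInv_eq, TemperedDistribution.fourierInv_apply,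
    TemperedDistribution.smulLeftCLM_apply_apply, Lp.toTemperedDistribution_apply]
  rfl

/-- The Fourier transform and the Bessel weight are bijections of the Schwartz space, so every
Schwartz `θ` can be reached as a test function for `α` itself. -/
theorem exists_sobolevDist_apply (θ : 𝓢(ℝ, ℂ)) :
    ∃ φ : 𝓢(ℝ, ℂ), ∀ α, sobolevDist α φ = ∫ ξ, θ ξ • α ξ := by
  refine ⟨𝓕 (SchwartzMap.smulLeftCLM ℂ (fun ξ => (besselWeight (-(1 / 2)) ξ : ℂ)) θ), fun α => ?_⟩
  rw [sobolevDist_apply, fourierInv_fourier_eq, smulLeft_besselWeight_neg]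

theorem integrable_schwartz_smul (θ : 𝓢(ℝ, ℂ)) {f : ℝ → Spinor} (hf : MemLp f 2) :
    Integrable fun ξ => θ ξ • f ξ :=
  memLp_one_iff_integrable.1 (hf.smul (θ.memLp 2 volume))

/-- Constant matrices commute with the Fourier transform and with the scalar weight, so the
condition between distributions becomes pointwise between the `L²` densities. -/
theorem transmission_sobolevDist_iff {η τ : ℝ} {α β : Lp Spinor 2 (volume : Measure ℝ)} :
    Transmission η τ (sobolevDist α) (sobolevDist β) ↔ ∀ᵐ ξ : ℝ,
      act (-Complex.I • sigmaDot normal) (α ξ - β ξ) =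
        act ((1 / 2 : ℂ) • ((η : ℂ) • 1 + (τ : ℂ) • σ₃)) (α ξ + β ξ) := by
  set M := act (-Complex.I • sigmaDot normal)
  set N := act ((1 / 2 : ℂ) • ((η : ℂ) • 1 + (τ : ℂ) • σ₃))
  have key : ∀ (M : Spinor →L[ℂ] Spinor) (f : ℝ → Spinor) (θ : 𝓢(ℝ, ℂ)), MemLp f 2 →
      M (∫ ξ, θ ξ • f ξ) = ∫ ξ, θ ξ • M (f ξ) := fun M f θ hf => by
    rw [← M.integral_comp_comm (integrable_schwartz_smul θ hf)]
    simp
  have hα := Lp.memLp α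
  have hβ := Lp.memLp β
  have sub : ∀ θ : 𝓢(ℝ, ℂ), M ((∫ ξ, θ ξ • α ξ) - ∫ ξ, θ ξ • β ξ) =
      ∫ ξ, θ ξ • M (α ξ - β ξ) := fun θ => by
    rw [← integral_sub (integrable_schwartz_smul θ hα) (integrable_schwartz_smul θ hβ)]
    simp_rw [← smul_sub]
    exact key M (fun ξ => α ξ - β ξ) θ (hα.sub hβ)
  have add : ∀ θ : 𝓢(ℝ, ℂ), N ((∫ ξ, θ ξ • α ξ) + ∫ ξ, θ ξ • β ξ) =
      ∫ ξ, θ ξ • N (α ξ + β ξ) := fun θ => by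
    rw [← integral_add (integrable_schwartz_smul θ hα) (integrable_schwartz_smul θ hβ)]
    simp_rw [← smul_add]
    exact key N (fun ξ => α ξ + β ξ) θ (hα.add hβ)
  constructor
  · intro h
    refine ae_eq_of_forall_schwartz_smul
      ((M.comp_memLp' (hα.sub hβ)).locallyIntegrable (by norm_num))
      ((N.comp_memLp' (hα.add hβ)).locallyIntegrable (by norm_num)) fun θ => ?_
    obtain ⟨φ, hφ⟩ := exists_sobolevDist_apply θ
    have := h φ
    rw [hφ, hφ] at this
    exact (sub θ).symm.trans (this.trans (add θ))
  · intro h φ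
    rw [sobolevDist_apply, sobolevDist_apply]
    refine (sub _).trans (Eq.trans ?_ (add _).symm)
    refine integral_congr_ae ?_
    filter_upwards [h] with ξ hξ
    rw [hξ]

/-- The Fourier transform of a Schwartz function, weighted by `(1 + ξ²)^{-1/4}`. -/
def weightedFourier (v : 𝓢(ℝ, Spinor)) : 𝓢(ℝ, Spinor) :=
  SchwartzMap.smulLeftCLM Spinor (fun ξ => (besselWeight (-1 / 2) ξ : ℂ)) (𝓕 v)

theorem weightedFourier_apply (v : 𝓢(ℝ, Spinor)) (ξ : ℝ) :
    weightedFourier v ξ = (besselWeight (-1 / 2) ξ : ℂ) • 𝓕 v ξ :=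
  SchwartzMap.smulLeftCLM_apply_apply (hasTemperateGrowth_besselWeight _) _ _

theorem besselPotential_schwartz (v : 𝓢(ℝ, Spinor)) :
    TemperedDistribution.besselPotential ℝ Spinor (-1 / 2) (v : 𝓢'(ℝ, Spinor)) =
      ((𝓕⁻ ((weightedFourier v).toLp 2) : Lp Spinor 2 (volume : Measure ℝ)) :
        𝓢'(ℝ, Spinor)) := by
  rw [SchwartzMap.toLp_fourierInv_eq, Lp.toTemperedDistribution_toLp_eq,
    TemperedDistribution.besselPotential]
  exact TemperedDistribution.fourierMultiplierCLM_toTemperedDistributionCLM_eq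
    (hasTemperateGrowth_besselWeight (-1 / 2)) v

/-- The Bessel potential is multiplication by the weight on the Fourier side and `𝓕⁻` is an isometry
of `L²`. The element `w n` of the definition is unique, because `L²` embeds into the tempered
distributions. -/
theorem tendstoSobolev_iff {v : ℕ → 𝓢(ℝ, Spinor)} {α : Lp Spinor 2 (volume : Measure ℝ)} :
    TendstoSobolev (-1 / 2) (fun n => (v n : 𝓢'(ℝ, Spinor))) (sobolevDist α) ↔
      Tendsto (fun n => eLpNorm (fun ξ => (besselWeight (-1 / 2) ξ : ℂ) • 𝓕 (v n) ξ - α ξ) 2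
        volume) atTop (𝓝 0) := by
  have fsub : ∀ β γ : Lp Spinor 2 (volume : Measure ℝ), 𝓕⁻ (β - γ) = 𝓕⁻ β - 𝓕⁻ γ :=
    (Lp.fourierTransformₗᵢ ℝ Spinor).symm.map_sub
  have e : ∀ n, TemperedDistribution.besselPotential ℝ Spinor (-1 / 2)
      ((v n : 𝓢'(ℝ, Spinor)) - sobolevDist α) =
      ((𝓕⁻ ((weightedFourier (v n)).toLp 2 volume - α) : Lp Spinor 2 (volume : Measure ℝ)) :
        𝓢'(ℝ, Spinor)) := fun n => by
    rw [map_sub, besselPotential_schwartz, besselPotential_sobolevDist, fsub,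
      ← Lp.toTemperedDistributionCLM_apply, ← Lp.toTemperedDistributionCLM_apply,
      ← Lp.toTemperedDistributionCLM_apply, map_sub]
  have nrm : ∀ β : Lp Spinor 2 (volume : Measure ℝ), ‖𝓕⁻ β‖ = ‖β‖ :=
    (Lp.fourierTransformₗᵢ ℝ Spinor).symm.norm_map
  have h2 : ∀ n, eLpNorm (fun ξ => (besselWeight (-1 / 2) ξ : ℂ) • 𝓕 (v n) ξ - α ξ) 2 volume =
      eLpNorm (⇑((weightedFourier (v n)).toLp 2 (volume : Measure ℝ)) - ⇑α) 2 volume := fun n => by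
    refine eLpNorm_congr_ae ?_
    filter_upwards [(weightedFourier (v n)).coeFn_toLp 2 volume] with ξ hξ
    rw [Pi.sub_apply, hξ, weightedFourier_apply]
  simp_rw [h2]
  rw [← Lp.tendsto_Lp_iff_tendsto_eLpNorm', tendsto_iff_norm_sub_tendsto_zero]
  constructor
  · rintro ⟨w, hw, h0⟩
    refine h0.congr fun n => ?_
    rw [toTemperedDistribution_injective ((hw n).symm.trans (e n)), nrm]
  · intro h
    exact ⟨_, e, h.congr fun n => (nrm _).symm⟩

/-! ### The symbol of the transverse system -/

theorem act_apply (M : Matrix (Fin 2) (Fin 2) ℂ) (v : Spinor) (i : Fin 2) :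
    act M v i = M i 0 * v 0 + M i 1 * v 1 := by
  simp [act, Matrix.ofLp_toEuclideanCLM, Matrix.mulVec, dotProduct,
    Fin.sum_univ_two]

/-- The matrix `A(k)` such that `(σ₁ ∂ₓ + i k σ₂) u = i (z - m σ₃) u` amounts to `∂ₓ u = A(k) u`. -/
def symbol (m z k : ℝ) : Spinor →L[ℂ] Spinor :=
  act !![(k : ℂ), Complex.I * (z + m); Complex.I * (z - m), -(k : ℂ)]

/-- The multiplication by `i (z - m σ₃)`. -/
def gradTerm (m z : ℝ) : Spinor →L[ℂ] Spinor :=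
  act (Complex.I • ((z : ℂ) • 1 - (m : ℂ) • σ₃))

/-- Multiplication by `σ₁`, with `σ₁² = 1` and `σ₁ σ₂ = i σ₃`, isolates `v`; the term in `σ₂`
becomes `k σ₃ u`. -/
theorem eq_symbol_add {m z k : ℝ} {u v r : Spinor}
    (h : act σ₁ v + act σ₂ ((Complex.I * k) • u) = gradTerm m z u + r) :
    v = symbol m z k u + act σ₁ r := by
  have h0 := congrArg (fun w : Spinor => w 0) h
  have h1 := congrArg (fun w : Spinor => w 1) h
  ext i
  fin_cases i <;>
  simp [act_apply, symbol, gradTerm, σ₁, σ₂, σ₃] at h0 h1 ⊢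
  · linear_combination h1 - (k * u 0) * Complex.I_sq
  · linear_combination h0 + (k * u 1) * Complex.I_sq

theorem act_σ₁_add_act_σ₂_of_symbol (m z k : ℝ) (u : Spinor) :
    act σ₁ (symbol m z k u) + act σ₂ ((Complex.I * k) • u) = gradTerm m z u := by
  ext i
  fin_cases i <;>
  simp [act_apply, symbol, gradTerm, σ₁, σ₂, σ₃]
  · linear_combination (-k * u 1) * Complex.I_sq
  · linear_combination (k * u 0) * Complex.I_sq

theorem kappa_pos {m η : ℝ} (hm : 0 < m) (hη : η ≠ 0) (k : ℝ) : 0 < kappa m η k :=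
  Real.sqrt_pos.2 (by positivity)

theorem kappa_sq (m η k : ℝ) : kappa m η k ^ 2 = k ^ 2 + 4 * m ^ 2 / η ^ 2 :=
  Real.sq_sqrt (by positivity)

theorem continuous_kappa (m η : ℝ) : Continuous (kappa m η) := by
  unfold kappa; fun_prop

/-- Cayley–Hamilton: the trace vanishes and the determinant is `-(k² + m² - z²)`. -/
theorem symbol_symbol {m η z : ℝ} (hz : m ^ 2 - z ^ 2 = 4 * m ^ 2 / η ^ 2) (k : ℝ) (u : Spinor) :
    symbol m z k (symbol m z k u) = ((kappa m η k ^ 2 : ℝ) : ℂ) • u := by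
  rw [kappa_sq, ← hz]
  ext i
  fin_cases i <;>
  simp [act_apply, symbol]
  · linear_combination (z ^ 2 - m ^ 2) * u 0 * Complex.I_sq
  · linear_combination (z ^ 2 - m ^ 2) * u 1 * Complex.I_sq

/-- The spectral projection of `A(k)` for the eigenvalue `ε κ(k)`, where `ε = ±1`. -/
def spectralProj (m η z ε k : ℝ) : Spinor →L[ℂ] Spinor :=
  (1 / 2 : ℂ) • (ContinuousLinearMap.id ℂ Spinor + ((ε / kappa m η k : ℝ) : ℂ) • symbol m z k)

theorem spectralProj_apply (m η z ε k : ℝ) (u : Spinor) : spectralProj m η z ε k u =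
    (1 / 2 : ℂ) • (u + ((ε / kappa m η k : ℝ) : ℂ) • symbol m z k u) := rfl

theorem spectralProj_symbol {m η z ε : ℝ} (hm : 0 < m) (hη : η ≠ 0)
    (hz : m ^ 2 - z ^ 2 = 4 * m ^ 2 / η ^ 2) (hε : ε ^ 2 = 1) (k : ℝ) (u : Spinor) :
    spectralProj m η z ε k (symbol m z k u) =
      ((ε * kappa m η k : ℝ) : ℂ) • spectralProj m η z ε k u := by
  have h := (kappa_pos hm hη k).ne'
  rw [spectralProj_apply, spectralProj_apply, symbol_symbol hz,
    smul_comm ((ε * kappa m η k : ℝ) : ℂ)]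
  have e1 : ε / kappa m η k * kappa m η k ^ 2 = ε * kappa m η k := by field_simp
  have e2 : ε * kappa m η k * (ε / kappa m η k) = 1 := by field_simp; exact hε
  congr 1
  rw [smul_add, smul_smul, smul_smul, ← Complex.ofReal_mul, ← Complex.ofReal_mul, e1, e2]
  simp [add_comm]

theorem spectralProj_add (m η z k : ℝ) (u : Spinor) :
    spectralProj m η z 1 k u + spectralProj m η z (-1) k u = u := by
  simp only [spectralProj_apply, neg_div, Complex.ofReal_neg, neg_smul, ← smul_add]
  rw [add_add_add_comm, add_neg_cancel, add_zero, ← two_smul ℂ u, smul_smul]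
  norm_num

/-- The kernel of one spectral projection is the eigenspace of the opposite eigenvalue. -/
theorem symbol_eq_of_spectralProj_eq_zero {m η z ε k : ℝ} (hm : 0 < m) (hη : η ≠ 0)
    (hε : ε ^ 2 = 1) {u : Spinor} (h : spectralProj m η z ε k u = 0) :
    symbol m z k u = ((-(ε * kappa m η k) : ℝ) : ℂ) • u := by
  have hk := (kappa_pos hm hη k).ne'
  rw [spectralProj_apply] at h
  have h2 := (smul_eq_zero.1 h).resolve_left (by norm_num)
  have h3 : ((ε * kappa m η k : ℝ) : ℂ) • (((ε / kappa m η k : ℝ) : ℂ) • symbol m z k u) =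
      symbol m z k u := by
    rw [smul_smul, ← Complex.ofReal_mul]
    have e2 : ε * kappa m η k * (ε / kappa m η k) = 1 := by field_simp; exact hε
    rw [e2]; simp
  rw [← h3, eq_neg_of_add_eq_zero_right h2]
  simp

/-! ### The system of ordinary differential equations on a half-line -/

/-- The open half-line `{x | 0 < s x}`. -/
def halfLine (s : ℝ) : Set ℝ := {x | 0 < s * x}

theorem measurableSet_halfLine (s : ℝ) : MeasurableSet (halfLine s) :=
  (isOpen_lt continuous_const (by fun_prop)).measurableSet

/-- The inclusion holds only almost everywhere: for `x < 0` the interval is `(x, 0]`, whose endpoint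
`0` is outside the half-line. -/
theorem uIoc_ae_le_halfLine {s x : ℝ} (hx : x ∈ halfLine s) :
    (Set.uIoc 0 x : Set ℝ) ≤ᵐ[volume] halfLine s := by
  have h0 : ∀ᵐ y ∂(volume : Measure ℝ), y ≠ 0 := by simp [ae_iff]
  filter_upwards [h0] with y hy hyx
  have hx' : 0 < s * x := hx
  change 0 < s * y
  have hyx' : y ∈ Set.uIoc 0 x := hyx
  rw [Set.mem_uIoc] at hyx'
  rcases pos_and_pos_or_neg_and_neg_of_mul_pos hx' with ⟨a, b⟩ | ⟨a, b⟩
  · rcases hyx' with h | h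
    · exact mul_pos a h.1
    · exact absurd (h.1.trans_le h.2) (not_lt.2 b.le)
  · rcases hyx' with h | h
    · exact absurd (h.1.trans_le h.2) (not_lt.2 b.le)
    · exact mul_pos_of_neg_of_neg a (lt_of_le_of_ne h.2 hy)

/-- Integrating factor: since `P A = ε κ P`, the factor `e^{-ε κ x}` removes the homogeneous part
and leaves the forcing alone. -/
theorem hasDerivAt_exp_spectralProj {m η z ε k : ℝ} (hm : 0 < m) (hη : η ≠ 0)
    (hz : m ^ 2 - z ^ 2 = 4 * m ^ 2 / η ^ 2) (hε : ε ^ 2 = 1) {U : ℝ → Spinor} {ρ : Spinor}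
    {x : ℝ} (hU : HasDerivAt U (symbol m z k (U x) + ρ) x) :
    HasDerivAt (fun x => Real.exp (-(ε * kappa m η k) * x) • spectralProj m η z ε k (U x))
      (Real.exp (-(ε * kappa m η k) * x) • spectralProj m η z ε k ρ) x := by
  have h1 : HasDerivAt (fun x => spectralProj m η z ε k (U x))
      (spectralProj m η z ε k (symbol m z k (U x) + ρ)) x :=
    ((spectralProj m η z ε k).restrictScalars ℝ).hasFDerivAt.comp_hasDerivAt x hU
  have h2 : HasDerivAt (fun x => Real.exp (-(ε * kappa m η k) * x))
      (Real.exp (-(ε * kappa m η k) * x) * -(ε * kappa m η k)) x := by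
    simpa using ((hasDerivAt_id x).const_mul (-(ε * kappa m η k))).exp
  convert! h2.smul h1 using 1
  rw [map_add, spectralProj_symbol hm hη hz hε, smul_add, Complex.coe_smul, smul_smul, add_assoc,
    add_comm, add_assoc, ← add_smul]
  ring_nf
  simp

/-- Duhamel's formula on the bounded interval between `0` and `x`. There the forcing is small in
`L¹` because it is small in `L²`, so only the initial value survives in the limit. -/
theorem tendsto_exp_spectralProj {m η z ε k s : ℝ} (hm : 0 < m) (hη : η ≠ 0)
    (hz : m ^ 2 - z ^ 2 = 4 * m ^ 2 / η ^ 2) (hε : ε ^ 2 = 1) {U ρ : ℕ → ℝ → Spinor} {D : Spinor}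
    (hU : ∀ n x, HasDerivAt (U n) (symbol m z k (U n x) + ρ n x) x)
    (hc : ∀ n, Continuous (ρ n))
    (hρ : Tendsto (fun n => eLpNorm (ρ n) 2 (volume.restrict (halfLine s))) atTop (𝓝 0))
    (h0 : Tendsto (fun n => U n 0) atTop (𝓝 D)) {x : ℝ} (hx : x ∈ halfLine s) :
    Tendsto (fun n => Real.exp (-(ε * kappa m η k) * x) • spectralProj m η z ε k (U n x)) atTop
      (𝓝 (spectralProj m η z ε k D)) := by
  set P := spectralProj m η z ε k
  set a := -(ε * kappa m η k)
  have hfin : IsFiniteMeasure (volume.restrict (Set.uIoc 0 x)) := ⟨by simp⟩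
  have e : ∀ n, Real.exp (a * x) • P (U n x) =
      P (U n 0) + ∫ y in (0 : ℝ)..x, Real.exp (a * y) • P (ρ n y) := fun n => by
    have hi : Continuous fun y => Real.exp (a * y) • P (ρ n y) := by
      have := hc n
      fun_prop
    rw [intervalIntegral.integral_eq_sub_of_hasDerivAt
      (fun y _ => hasDerivAt_exp_spectralProj hm hη hz hε (hU n y)) (hi.intervalIntegrable 0 x)]
    simp [a, P]
  simp_rw [e]
  have hP : Tendsto (fun n => P (U n 0)) atTop (𝓝 (P D)) := (P.continuous.tendsto D).comp h0
  rw [show P D = P D + 0 by simp]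
  refine hP.add ?_
  -- Bound for `‖e^{a y} P‖` when `y` lies between `0` and `x`.
  set C : ℝ := Real.exp (|a| * |x|) * ‖P‖
  have hbd : ∀ n, ‖∫ y in (0 : ℝ)..x, Real.exp (a * y) • P (ρ n y)‖ₑ ≤
      ENNReal.ofReal C * (eLpNorm (ρ n) 2 (volume.restrict (halfLine s)) *
        volume.restrict (Set.uIoc 0 x) Set.univ ^ (1 / (1 : ℝ≥0∞).toReal - 1 / (2 : ℝ≥0∞).toReal)) := fun n => by
    calc ‖∫ y in (0 : ℝ)..x, Real.exp (a * y) • P (ρ n y)‖ₑ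
        = ‖∫ y in Set.uIoc 0 x, Real.exp (a * y) • P (ρ n y)‖ₑ := by
          rw [← ofReal_norm, ← ofReal_norm, intervalIntegral.norm_intervalIntegral_eq]
      _ ≤ ∫⁻ y in Set.uIoc 0 x, ‖Real.exp (a * y) • P (ρ n y)‖ₑ := enorm_integral_le_lintegral_enorm _
      _ ≤ ∫⁻ y in Set.uIoc 0 x, ENNReal.ofReal C * ‖ρ n y‖ₑ := by
          refine setLIntegral_mono' measurableSet_uIoc fun y hy => ?_
          rw [← ofReal_norm, ← ofReal_norm, ← ENNReal.ofReal_mul (by positivity)]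
          refine ENNReal.ofReal_le_ofReal ?_
          rw [norm_smul, mul_assoc]
          refine mul_le_mul ?_ (P.le_opNorm _) (norm_nonneg _) (by positivity)
          rw [Real.norm_eq_abs, Real.abs_exp, Real.exp_le_exp]
          refine (le_abs_self _).trans ?_
          rw [abs_mul]
          refine mul_le_mul_of_nonneg_left ?_ (abs_nonneg _)
          have := Set.abs_sub_left_of_mem_uIcc (Set.uIoc_subset_uIcc hy)
          simpa using this
      _ = ENNReal.ofReal C * eLpNorm (ρ n) 1 (volume.restrict (Set.uIoc 0 x)) := by
          rw [lintegral_const_mul' _ _ (by simp), eLpNorm_one_eq_lintegral_enorm]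
      _ ≤ _ := by
          -- Cauchy–Schwarz on the finite interval, then enlargement of the interval to the
          -- half-line.
          gcongr
          refine (eLpNorm_le_eLpNorm_mul_rpow_measure_univ (p := 1) (q := 2) (by norm_num)
            (hc n).aestronglyMeasurable).trans ?_
          refine mul_le_mul_left ?_ _
          exact eLpNorm_mono_measure _ (Measure.restrict_mono_ae (uIoc_ae_le_halfLine hx))
  rw [tendsto_zero_iff_enorm_tendsto_zero]
  refine tendsto_of_tendsto_of_tendsto_of_le_of_le tendsto_const_nhds ?_ (fun n => bot_le) hbd
  have hne : volume.restrict (Set.uIoc 0 x) Set.univ ^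
      (1 / (1 : ℝ≥0∞).toReal - 1 / (2 : ℝ≥0∞).toReal) ≠ ⊤ :=
    ENNReal.rpow_ne_top_of_nonneg (by norm_num) (measure_ne_top _ _)
  have := ENNReal.Tendsto.const_mul (a := ENNReal.ofReal C)
    (ENNReal.Tendsto.mul_const hρ (Or.inr hne)) (Or.inr (by simp))
  simpa using this

/-- The solution of `U' = A(k) U` with initial value `D`. -/
def propagate (m η z k x : ℝ) (D : Spinor) : Spinor :=
  Real.exp (kappa m η k * x) • spectralProj m η z 1 k D +
    Real.exp (-kappa m η k * x) • spectralProj m η z (-1) k D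

theorem tendsto_propagate {m η z k s : ℝ} (hm : 0 < m) (hη : η ≠ 0)
    (hz : m ^ 2 - z ^ 2 = 4 * m ^ 2 / η ^ 2) {U ρ : ℕ → ℝ → Spinor} {D : Spinor}
    (hU : ∀ n x, HasDerivAt (U n) (symbol m z k (U n x) + ρ n x) x)
    (hc : ∀ n, Continuous (ρ n))
    (hρ : Tendsto (fun n => eLpNorm (ρ n) 2 (volume.restrict (halfLine s))) atTop (𝓝 0))
    (h0 : Tendsto (fun n => U n 0) atTop (𝓝 D)) {x : ℝ} (hx : x ∈ halfLine s) :
    Tendsto (fun n => U n x) atTop (𝓝 (propagate m η z k x D)) := by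
  have h1 := (tendsto_exp_spectralProj hm hη hz (ε := 1) (by norm_num) hU hc hρ h0 hx).const_smul
    (Real.exp (kappa m η k * x))
  have h2 := (tendsto_exp_spectralProj hm hη hz (ε := -1) (by norm_num) hU hc hρ h0 hx).const_smul
    (Real.exp (-kappa m η k * x))
  refine (h1.add h2).congr fun n => ?_
  rw [smul_smul, smul_smul, ← Real.exp_add, ← Real.exp_add]
  ring_nf
  simp [spectralProj_add]

/-! ### Fourier transform in `y` of compactly supported smooth functions -/

section CompactSupport

variable {E : Type*} [NormedAddCommGroup E]

theorem hasCompactSupport_slice {w : ℝ × ℝ → E} (hs : HasCompactSupport w) (x : ℝ) :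
    HasCompactSupport fun y => w (x, y) :=
  hs.comp_isClosedEmbedding (Isometry.of_dist_eq fun a b => by simp [Prod.dist_eq] :
    Isometry fun y : ℝ => (x, y)).isClosedEmbedding

theorem integrable_slice {w : ℝ × ℝ → E} (hc : Continuous w) (hs : HasCompactSupport w) (x : ℝ) :
    Integrable fun y => w (x, y) :=
  (by fun_prop : Continuous fun y => w (x, y)).integrable_of_hasCompactSupport
    (hasCompactSupport_slice hs x)

theorem memLp_slice {w : ℝ × ℝ → E} (hc : Continuous w) (hs : HasCompactSupport w) (x : ℝ) :
    MemLp (fun y => w (x, y)) 2 volume :=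
  (by fun_prop : Continuous fun y => w (x, y)).memLp_of_hasCompactSupport
    (hasCompactSupport_slice hs x)

end CompactSupport

theorem integrable_fourier_integrand {f : ℝ → Spinor} (hf : Integrable f) (ξ : ℝ) :
    Integrable fun y : ℝ => Complex.exp (↑(-2 * Real.pi * y * ξ) * Complex.I) • f y := by
  have h : Continuous fun y : ℝ => Complex.exp (↑(-2 * Real.pi * y * ξ) * Complex.I) := by fun_prop
  refine hf.mono (h.aestronglyMeasurable.smul hf.1) (Eventually.of_forall fun y => ?_)
  rw [norm_smul, Complex.norm_exp_ofReal_mul_I, one_mul]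

theorem act_fourier (M : Spinor →L[ℂ] Spinor) {f : ℝ → Spinor} (hf : Integrable f) (ξ : ℝ) :
    M (𝓕 f ξ) = 𝓕 (fun y => M (f y)) ξ := by
  rw [Real.fourier_real_eq_integral_exp_smul, Real.fourier_real_eq_integral_exp_smul,
    ← M.integral_comp_comm (integrable_fourier_integrand hf ξ)]
  simp

theorem fourier_fun_add {f g : ℝ → Spinor} (hf : Integrable f) (hg : Integrable g) (ξ : ℝ) :
    𝓕 (fun y => f y + g y) ξ = 𝓕 f ξ + 𝓕 g ξ := by
  rw [Real.fourier_real_eq_integral_exp_smul, Real.fourier_real_eq_integral_exp_smul,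
    Real.fourier_real_eq_integral_exp_smul,
    ← integral_add (integrable_fourier_integrand hf ξ) (integrable_fourier_integrand hg ξ)]
  simp

theorem fourier_fun_sub {f g : ℝ → Spinor} (hf : Integrable f) (hg : Integrable g) (ξ : ℝ) :
    𝓕 (fun y => f y - g y) ξ = 𝓕 f ξ - 𝓕 g ξ := by
  rw [Real.fourier_real_eq_integral_exp_smul, Real.fourier_real_eq_integral_exp_smul,
    Real.fourier_real_eq_integral_exp_smul,
    ← integral_sub (integrable_fourier_integrand hf ξ) (integrable_fourier_integrand hg ξ)]
  simp [smul_sub]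

section Slice

variable {w : ℝ × ℝ → Spinor}

theorem continuous_sliceFourier_left (hc : Continuous w) (hs : HasCompactSupport w) (ξ : ℝ) :
    Continuous fun x => sliceFourier w (x, ξ) := by
  -- The integral lives on the compact projection of the support to the `y`-axis, which does not
  -- depend on `x`.
  have e : (fun x => sliceFourier w (x, ξ)) = fun x =>
      ∫ y in Prod.snd '' tsupport w, Complex.exp (↑(-2 * Real.pi * y * ξ) * Complex.I) •
        w (x, y) := by
    ext1 x
    rw [sliceFourier, Real.fourier_real_eq_integral_exp_smul]
    refine (setIntegral_eq_integral_of_forall_compl_eq_zero fun y hy => ?_).symm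
    rw [image_eq_zero_of_notMem_tsupport (fun h => hy ⟨_, h, rfl⟩), smul_zero]
  rw [e]
  exact continuous_parametric_integral_of_continuous (by fun_prop) (hs.image continuous_snd)

theorem hasDerivAt_slice_left (hw : ContDiff ℝ 1 w) (x y : ℝ) :
    HasDerivAt (fun x => w (x, y)) (fderiv ℝ w (x, y) (1, 0)) x := by
  have h1 : HasDerivAt (fun x : ℝ => (x, y)) ((1 : ℝ), (0 : ℝ)) x :=
    (hasDerivAt_id x).prodMk (hasDerivAt_const x y)
  exact ((hw.differentiable (by norm_num)) (x, y)).hasFDerivAt.comp_hasDerivAt x h1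

theorem hasDerivAt_slice_right (hw : ContDiff ℝ 1 w) (x y : ℝ) :
    HasDerivAt (fun y => w (x, y)) (fderiv ℝ w (x, y) (0, 1)) y := by
  have h1 : HasDerivAt (fun y : ℝ => (x, y)) ((0 : ℝ), (1 : ℝ)) y :=
    (hasDerivAt_const y x).prodMk (hasDerivAt_id y)
  exact ((hw.differentiable (by norm_num)) (x, y)).hasFDerivAt.comp_hasDerivAt y h1

theorem continuous_fderiv_dir (hw : ContDiff ℝ 1 w) (v : ℝ × ℝ) :
    Continuous fun p => fderiv ℝ w p v :=
  (hw.continuous_fderiv (by norm_num)).clm_apply continuous_const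

theorem hasDerivAt_sliceFourier (hw : ContDiff ℝ 1 w) (hs : HasCompactSupport w) (x ξ : ℝ) :
    HasDerivAt (fun x => sliceFourier w (x, ξ))
      (sliceFourier (fun p => fderiv ℝ w p (1, 0)) (x, ξ)) x := by
  have hc := continuous_fderiv_dir hw (1, 0)
  have hs' : HasCompactSupport fun p => fderiv ℝ w p (1, 0) := hs.fderiv_apply ℝ (1, 0)
  obtain ⟨C, hC⟩ := hs'.exists_bound_of_continuous hc
  have hK : IsCompact (Prod.snd '' tsupport w) := hs.image continuous_snd
  have e : ∀ u : ℝ × ℝ → Spinor, (fun x => sliceFourier u (x, ξ)) = fun x =>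
      ∫ y, Complex.exp (↑(-2 * Real.pi * y * ξ) * Complex.I) • u (x, y) := fun u => by
    ext1 x
    rw [sliceFourier, Real.fourier_real_eq_integral_exp_smul]
  have e' := congrFun (e fun p => fderiv ℝ w p (1, 0)) x
  beta_reduce at e'
  rw [e w, e']
  refine (hasDerivAt_integral_of_dominated_loc_of_deriv_le (F := fun x y =>
    Complex.exp (↑(-2 * Real.pi * y * ξ) * Complex.I) • w (x, y)) (F' := fun x y =>
    Complex.exp (↑(-2 * Real.pi * y * ξ) * Complex.I) • fderiv ℝ w (x, y) (1, 0))
    -- A constant on the `y`-projection of the support dominates the derivative for all `x` at once.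
    (bound := (Prod.snd '' tsupport w).indicator fun _ => C)
    univ_mem (Eventually.of_forall fun x => ?_) ?_ ?_ ?_ ?_ ?_).2
  · have := hw.continuous
    exact (by fun_prop : Continuous fun y : ℝ =>
      Complex.exp (↑(-2 * Real.pi * y * ξ) * Complex.I) • w (x, y)).aestronglyMeasurable
  · exact integrable_fourier_integrand (integrable_slice hw.continuous hs x) ξ
  · exact (integrable_fourier_integrand (integrable_slice hc hs' x) ξ).aestronglyMeasurable
  · refine Eventually.of_forall fun y x _ => ?_
    rw [norm_smul, Complex.norm_exp_ofReal_mul_I, one_mul]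
    by_cases hy : y ∈ Prod.snd '' tsupport w
    · rw [Set.indicator_of_mem hy]
      exact hC _
    · rw [Set.indicator_of_notMem hy, image_eq_zero_of_notMem_tsupport (f := fderiv ℝ w)
        (fun h => hy ⟨_, tsupport_fderiv_subset ℝ h, rfl⟩)]
      simp
  · rw [integrable_indicator_iff hK.measurableSet]
    exact integrableOn_const hK.measure_lt_top.ne
  · exact Eventually.of_forall fun y x _ => (hasDerivAt_slice_left hw x y).fun_const_smul _

theorem sliceFourier_fderiv_right (hw : ContDiff ℝ 1 w) (hs : HasCompactSupport w) (x ξ : ℝ) :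
    sliceFourier (fun p => fderiv ℝ w p (0, 1)) (x, ξ) =
      (Complex.I * ↑(2 * Real.pi * ξ)) • sliceFourier w (x, ξ) := by
  have hd : deriv (fun y => w (x, y)) = fun y => fderiv ℝ w (x, y) (0, 1) :=
    funext fun y => (hasDerivAt_slice_right hw x y).deriv
  have := Real.fourier_deriv (f := fun y => w (x, y)) (integrable_slice hw.continuous hs x)
    (fun y => (hasDerivAt_slice_right hw x y).differentiableAt) (by
      rw [hd]
      exact integrable_slice (continuous_fderiv_dir hw (0, 1)) (hs.fderiv_apply ℝ (0, 1)) x)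
  rw [hd] at this
  refine (congrFun this ξ).trans ?_
  rw [show (2 * Real.pi * Complex.I * ξ : ℂ) = Complex.I * ↑(2 * Real.pi * ξ) by
    push_cast; ring]
  rfl

/-- The defect `(σ · ∇) w - i (z - m σ₃) w`. -/
def defect (m z : ℝ) (w : ℝ × ℝ → Spinor) (p : ℝ × ℝ) : Spinor :=
  sigmaGrad w p - gradTerm m z (w p)

theorem continuous_defect (m z : ℝ) (hw : ContDiff ℝ 1 w) : Continuous (defect m z w) := by
  have h1 := continuous_fderiv_dir hw (1, 0)
  have h2 := continuous_fderiv_dir hw (0, 1)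
  have h3 := hw.continuous
  unfold defect sigmaGrad
  fun_prop

theorem hasCompactSupport_defect (m z : ℝ) (hs : HasCompactSupport w) :
    HasCompactSupport (defect m z w) := by
  refine hs.mono' fun p hp => by_contra fun h => hp ?_
  have h1 : fderiv ℝ w p = 0 := image_eq_zero_of_notMem_tsupport
    fun h' => h (tsupport_fderiv_subset ℝ h')
  simp [defect, sigmaGrad, h1, image_eq_zero_of_notMem_tsupport h]

/-- Any compactly supported `C¹` function satisfies the transverse differential equation with its
own defect as forcing. Applied to approximants of a solution, whose defects tend to zero, it
replaces regularity of the solution itself. -/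
theorem hasDerivAt_sliceFourier_symbol (m z : ℝ) (hw : ContDiff ℝ 1 w) (hs : HasCompactSupport w)
    (x ξ : ℝ) : HasDerivAt (fun x => sliceFourier w (x, ξ))
      (symbol m z (2 * Real.pi * ξ) (sliceFourier w (x, ξ)) +
        act σ₁ (sliceFourier (defect m z w) (x, ξ))) x := by
  have h1 := integrable_slice (continuous_fderiv_dir hw (1, 0)) (hs.fderiv_apply ℝ (1, 0)) x
  have h2 := integrable_slice (continuous_fderiv_dir hw (0, 1)) (hs.fderiv_apply ℝ (0, 1)) x
  have h3 := integrable_slice hw.continuous hs x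
  have h1' := (act σ₁).integrable_comp h1
  have h2' := (act σ₂).integrable_comp h2
  rw [← eq_symbol_add (v := sliceFourier (fun p => fderiv ℝ w p (1, 0)) (x, ξ))]
  · exact hasDerivAt_sliceFourier hw hs x ξ
  · rw [← sliceFourier_fderiv_right hw hs, sliceFourier, sliceFourier, sliceFourier, sliceFourier,
      act_fourier _ h1, act_fourier _ h2, act_fourier _ h3, ← fourier_fun_add h1' h2']
    refine eq_add_of_sub_eq' ?_
    exact (fourier_fun_sub (h1'.add h2') ((gradTerm m z).integrable_comp h3) ξ).symm

end Slice

/-! ### Half-planes and decaying exponentials -/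

/-- The open half-plane `{(x, y) | 0 < s x}`. -/
def halfPlane (s : ℝ) : Set (ℝ × ℝ) := {p | 0 < s * p.1}

theorem halfPlane_one : halfPlane 1 = OmegaPlus := by ext p; simp [halfPlane, OmegaPlus]

theorem halfPlane_neg_one : halfPlane (-1) = OmegaMinus := by ext p; simp [halfPlane, OmegaMinus]

theorem isOpen_halfPlane (s : ℝ) : IsOpen (halfPlane s) :=
  isOpen_lt continuous_const (by fun_prop)

theorem volume_restrict_halfPlane (s : ℝ) : (volume : Measure (ℝ × ℝ)).restrict (halfPlane s) =
    (volume.restrict (halfLine s)).prod volume := by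
  have : halfPlane s = halfLine s ×ˢ Set.univ := by ext p; simp [halfPlane, halfLine]
  rw [this, Measure.volume_eq_prod, ← Measure.prod_restrict, Measure.restrict_univ]

theorem ae_mem_halfLine (s : ℝ) : ∀ᵐ x ∂(volume.restrict (halfLine s)), x ∈ halfLine s :=
  ae_restrict_mem (measurableSet_halfLine s)

theorem lintegral_exp_halfLine {s a : ℝ} (hs : s ^ 2 = 1) (ha : 0 < a) :
    ∫⁻ x in halfLine s, ENNReal.ofReal (Real.exp (-(s * a) * x)) = ENNReal.ofReal (1 / a) := by
  rcases sq_eq_one_iff.1 hs with rfl | rfl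
  · have e : halfLine 1 = Set.Ioi 0 := by ext x; simp [halfLine]
    rw [e, ← ofReal_integral_eq_lintegral_ofReal
      (by simpa [IntegrableOn] using integrableOn_exp_mul_Ioi (neg_lt_zero.2 ha) 0)
      (Eventually.of_forall fun x => (Real.exp_pos _).le)]
    have := integral_exp_mul_Ioi (neg_lt_zero.2 ha) 0
    simp only [one_mul]
    rw [this]
    simp
  · have e : halfLine (-1) = Set.Iio 0 := by ext x; simp [halfLine]
    rw [e, Measure.restrict_congr_set Iio_ae_eq_Iic, ← ofReal_integral_eq_lintegral_ofReal
      (by simpa [IntegrableOn] using integrableOn_exp_mul_Iic ha 0)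
      (Eventually.of_forall fun x => (Real.exp_pos _).le)]
    have := integral_exp_mul_Iic ha 0
    simp only [neg_mul, one_mul, neg_neg]
    rw [this]
    simp

/-- The positive mass keeps `κ` away from zero at low frequencies; at high frequencies `2 π ≥ 1`
suffices. -/
theorem exists_kappa_sq_ge {m η : ℝ} (hm : 0 < m) (hη : η ≠ 0) :
    ∃ c > 0, ∀ ξ, c * (1 + ξ ^ 2) ≤ kappa m η (2 * Real.pi * ξ) ^ 2 := by
  refine ⟨min 1 (4 * m ^ 2 / η ^ 2), lt_min one_pos (by positivity), fun ξ => ?_⟩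
  rw [kappa_sq]
  have h1 : min 1 (4 * m ^ 2 / η ^ 2) * 1 ≤ 4 * m ^ 2 / η ^ 2 := by simp
  have h2 : min 1 (4 * m ^ 2 / η ^ 2) * ξ ^ 2 ≤ 1 * ξ ^ 2 := by gcongr; exact min_le_left _ _
  have h3 : 1 * ξ ^ 2 ≤ (2 * Real.pi * ξ) ^ 2 := by
    rw [mul_pow]
    gcongr
    nlinarith [Real.pi_gt_three]
  linarith

theorem besselWeight_half_sq (ξ : ℝ) : besselWeight (1 / 2) ξ ^ 2 = Real.sqrt (1 + ξ ^ 2) := by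
  rw [besselWeight, ← Real.rpow_natCast, ← Real.rpow_mul (by positivity), Real.sqrt_eq_rpow]
  norm_num

theorem exists_besselWeight_sq_le {m η : ℝ} (hm : 0 < m) (hη : η ≠ 0) :
    ∃ C : ℝ, 0 < C ∧ ∀ ξ, besselWeight (1 / 2) ξ ^ 2 ≤ C * kappa m η (2 * Real.pi * ξ) := by
  obtain ⟨c, hc, h⟩ := exists_kappa_sq_ge hm hη
  refine ⟨1 / Real.sqrt c, by positivity, fun ξ => ?_⟩
  rw [besselWeight_half_sq, div_mul_eq_mul_div, one_mul, le_div_iff₀ (by positivity),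
    mul_comm, ← Real.sqrt_mul hc.le]
  exact Real.sqrt_le_iff.2 ⟨(kappa_pos hm hη _).le, h ξ⟩

/-- The exponential `e^{-s κ x}`, where `κ = κ(2π ξ)`, as a function of `(x, ξ)`. -/
def decayExp (m η s : ℝ) (p : ℝ × ℝ) : ℝ :=
  Real.exp (-(s * kappa m η (2 * Real.pi * p.2)) * p.1)

theorem decayExp_pos (m η s : ℝ) (p : ℝ × ℝ) : 0 < decayExp m η s p := Real.exp_pos _

theorem continuous_decayExp (m η s : ℝ) : Continuous (decayExp m η s) := by
  have := continuous_kappa m η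
  unfold decayExp
  fun_prop

theorem exists_decayExp_mul_besselWeight_le {m η s x : ℝ} (hm : 0 < m) (hη : η ≠ 0)
    (hx : x ∈ halfLine s) :
    ∃ C : ℝ, ∀ ξ, decayExp m η s (x, ξ) * besselWeight (1 / 2) ξ ≤ C * (1 + ξ ^ 2)⁻¹ := by
  obtain ⟨c, hc, h⟩ := exists_kappa_sq_ge hm hη
  have hx' : 0 < s * x := hx
  -- From `e^q ≥ q⁴ / 4!` with `q = κ s x` and `q² ≥ c (1 + ξ²) (s x)²`. The fourth power yields `(1
  -- + ξ²)²`; one factor absorbs the Bessel weight and the other remains.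
  refine ⟨24 / (c * (s * x) ^ 2) ^ 2, fun ξ => ?_⟩
  have hκ := kappa_pos hm hη (2 * Real.pi * ξ)
  set q := kappa m η (2 * Real.pi * ξ) * (s * x)
  have hq : 0 < q := by positivity
  have e1 : decayExp m η s (x, ξ) = (Real.exp q)⁻¹ := by
    rw [← Real.exp_neg, decayExp]
    congr 1
    ring
  have e2 := Real.pow_div_factorial_le_exp q hq.le 4
  have e3 : (c * (s * x) ^ 2) ^ 2 * (1 + ξ ^ 2) ^ 2 ≤ q ^ 4 := by
    have := mul_le_mul_of_nonneg_right (h ξ) (sq_nonneg (s * x))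
    calc (c * (s * x) ^ 2) ^ 2 * (1 + ξ ^ 2) ^ 2 = (c * (1 + ξ ^ 2) * (s * x) ^ 2) ^ 2 := by ring
      _ ≤ (kappa m η (2 * Real.pi * ξ) ^ 2 * (s * x) ^ 2) ^ 2 := by gcongr
      _ = q ^ 4 := by ring
  have e4 : besselWeight (1 / 2) ξ ≤ 1 + ξ ^ 2 := by
    rw [besselWeight, Real.norm_eq_abs, sq_abs]
    refine (Real.rpow_le_rpow_of_exponent_le (y := 1 / 2 / 2) (z := 1)
      (by nlinarith [sq_nonneg ξ]) (by norm_num)).trans_eq (Real.rpow_one _)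
  have e5 : (c * (s * x) ^ 2) ^ 2 * (1 + ξ ^ 2) ^ 2 / 24 ≤ Real.exp q := by
    refine le_trans ?_ e2
    norm_num [Nat.factorial]
    linarith
  have hpos : 0 < (c * (s * x) ^ 2) ^ 2 * (1 + ξ ^ 2) ^ 2 / 24 := by positivity
  calc decayExp m η s (x, ξ) * besselWeight (1 / 2) ξ
      ≤ ((c * (s * x) ^ 2) ^ 2 * (1 + ξ ^ 2) ^ 2 / 24)⁻¹ * (1 + ξ ^ 2) := by
        rw [e1]
        exact mul_le_mul (inv_anti₀ hpos e5) e4 (besselWeight_pos _ _).le (by positivity)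
    _ = 24 / (c * (s * x) ^ 2) ^ 2 * (1 + ξ ^ 2)⁻¹ := by
        have : (1 + ξ ^ 2) ≠ 0 := by positivity
        field_simp

/-- The function `(x, ξ) ↦ e^{-s κ x} D(ξ)`. -/
def evolve (m η s : ℝ) (D : ℝ → Spinor) (p : ℝ × ℝ) : Spinor := decayExp m η s p • D p.2

theorem stronglyMeasurable_evolve (m η s : ℝ) {D : ℝ → Spinor} (hD : StronglyMeasurable D) :
    StronglyMeasurable (evolve m η s D) :=
  (continuous_decayExp m η s).stronglyMeasurable.smul (hD.comp_measurable measurable_snd)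

theorem enorm_decayExp_sq (m η s x ξ : ℝ) : ‖decayExp m η s (x, ξ)‖ₑ ^ 2 =
    ENNReal.ofReal (Real.exp (-(s * (2 * kappa m η (2 * Real.pi * ξ))) * x)) := by
  rw [← ofReal_norm, ← ENNReal.ofReal_pow (norm_nonneg _), decayExp, Real.norm_eq_abs, sq_abs,
    ← Real.exp_nat_mul]
  congr 2
  push_cast
  ring

theorem lintegral_decayExp_sq {m η s : ℝ} (hm : 0 < m) (hη : η ≠ 0) (hs : s ^ 2 = 1) (ξ : ℝ) :
    ∫⁻ x in halfLine s, ‖decayExp m η s (x, ξ)‖ₑ ^ 2 =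
      ENNReal.ofReal (1 / (2 * kappa m η (2 * Real.pi * ξ))) := by
  simp_rw [enorm_decayExp_sq]
  exact lintegral_exp_halfLine hs (mul_pos two_pos (kappa_pos hm hη _))

/-- Tonelli, with the integral in `x` taken first: `e^{-2 κ |x|}` integrates to `1 / (2 κ)`. -/
theorem eLpNorm_evolve_sq {m η s : ℝ} (hm : 0 < m) (hη : η ≠ 0) (hs : s ^ 2 = 1)
    {D : ℝ → Spinor} (hD : StronglyMeasurable D) :
    eLpNorm (evolve m η s D) 2 (volume.restrict (halfPlane s)) ^ 2 =
      ∫⁻ ξ, ‖D ξ‖ₑ ^ 2 * ENNReal.ofReal (1 / (2 * kappa m η (2 * Real.pi * ξ))) := by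
  rw [eLpNorm_two_sq, volume_restrict_halfPlane, lintegral_prod_symm _
    ((stronglyMeasurable_evolve m η s hD).enorm.pow_const 2).aemeasurable]
  refine lintegral_congr fun ξ => ?_
  simp only [evolve, enorm_smul, mul_pow]
  rw [lintegral_mul_const' _ _ (by simp), lintegral_decayExp_sq hm hη hs, mul_comm]

/-- The function `ξ ↦ (1 + ξ²)^{1/4} α(ξ)`. -/
def unweight (α : ℝ → Spinor) (ξ : ℝ) : Spinor := besselWeight (1 / 2) ξ • α ξ

theorem continuous_besselWeight (s : ℝ) : Continuous (besselWeight s) := by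
  unfold besselWeight
  exact Continuous.rpow_const (by fun_prop) fun ξ => Or.inl (by positivity)

theorem stronglyMeasurable_unweight {α : ℝ → Spinor} (hα : StronglyMeasurable α) :
    StronglyMeasurable (unweight α) :=
  (continuous_besselWeight _).stronglyMeasurable.smul hα

/-- The squared weight `(1 + ξ²)^{1/2}` is at most a constant times `κ`, which the integration in
`x` divides out. This is where the exponent `-1/2` of the trace space fits. -/
theorem exists_eLpNorm_evolve_unweight_le {m η s : ℝ} (hm : 0 < m) (hη : η ≠ 0) (hs : s ^ 2 = 1) :
    ∃ C : ℝ, ∀ α : ℝ → Spinor, StronglyMeasurable α →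
      eLpNorm (evolve m η s (unweight α)) 2 (volume.restrict (halfPlane s)) ^ 2 ≤
        ENNReal.ofReal C * eLpNorm α 2 volume ^ 2 := by
  obtain ⟨C, hC, h⟩ := exists_besselWeight_sq_le hm hη
  refine ⟨C / 2, fun α hα => ?_⟩
  rw [eLpNorm_evolve_sq hm hη hs (stronglyMeasurable_unweight hα), eLpNorm_two_sq,
    ← lintegral_const_mul' _ _ (by simp)]
  refine lintegral_mono fun ξ => ?_
  have hκ := kappa_pos hm hη (2 * Real.pi * ξ)
  simp only [unweight, enorm_smul, mul_pow]
  rw [mul_comm, ← mul_assoc]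
  gcongr
  rw [← ofReal_norm, ← ENNReal.ofReal_pow (norm_nonneg _), ← ENNReal.ofReal_mul (by positivity)]
  refine ENNReal.ofReal_le_ofReal ?_
  rw [Real.norm_eq_abs, sq_abs, one_div, inv_mul_le_iff₀ (by positivity)]
  linarith [h ξ]

theorem memLp_evolve_unweight {m η s : ℝ} (hm : 0 < m) (hη : η ≠ 0) (hs : s ^ 2 = 1)
    {α : ℝ → Spinor} (hα : StronglyMeasurable α) (h2 : MemLp α 2) :
    MemLp (evolve m η s (unweight α)) 2 (volume.restrict (halfPlane s)) := by
  obtain ⟨C, hC⟩ := exists_eLpNorm_evolve_unweight_le hm hη hs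
  refine ⟨(stronglyMeasurable_evolve m η s (stronglyMeasurable_unweight hα)).aestronglyMeasurable,
    ?_⟩
  have := (hC α hα).trans_lt (ENNReal.mul_lt_top ENNReal.ofReal_lt_top (ENNReal.pow_lt_top h2.2))
  exact (ENNReal.pow_lt_top_iff.1 this).resolve_right (by norm_num)

theorem memLp_two_inv_one_add_sq : MemLp (fun ξ : ℝ => (1 + ξ ^ 2)⁻¹) 2 volume := by
  have hc : Continuous fun ξ : ℝ => (1 + ξ ^ 2)⁻¹ :=
    Continuous.inv₀ (by fun_prop) fun ξ => by positivity
  rw [memLp_two_iff_integrable_sq hc.aestronglyMeasurable]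
  refine integrable_inv_one_add_sq.mono (hc.pow 2).aestronglyMeasurable
    (Eventually.of_forall fun ξ => ?_)
  have h1 : (1 + ξ ^ 2)⁻¹ ≤ 1 := inv_le_one_of_one_le₀ (by nlinarith [sq_nonneg ξ])
  rw [norm_pow]
  refine pow_le_of_le_one (norm_nonneg _) ?_ two_ne_zero
  rwa [Real.norm_eq_abs, abs_of_nonneg (by positivity)]

section SliceEvolve

variable {m η s x : ℝ} {α : ℝ → Spinor}

theorem memLp_two_decayExp_mul_besselWeight (hm : 0 < m) (hη : η ≠ 0) (hx : x ∈ halfLine s) :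
    MemLp (fun ξ => decayExp m η s (x, ξ) * besselWeight (1 / 2) ξ) 2 volume := by
  obtain ⟨C, hC⟩ := exists_decayExp_mul_besselWeight_le hm hη hx
  have hc : Continuous fun ξ => decayExp m η s (x, ξ) * besselWeight (1 / 2) ξ :=
    ((continuous_decayExp m η s).comp (by fun_prop)).mul (continuous_besselWeight _)
  refine (memLp_two_inv_one_add_sq.const_mul C).mono' hc.aestronglyMeasurable
    (Eventually.of_forall fun ξ => ?_)
  rw [Real.norm_eq_abs, abs_of_pos (mul_pos (decayExp_pos _ _ _ _) (besselWeight_pos _ _))]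
  exact hC ξ

theorem evolve_unweight_slice : (fun ξ => evolve m η s (unweight α) (x, ξ)) =
    fun ξ => (decayExp m η s (x, ξ) * besselWeight (1 / 2) ξ) • α ξ := by
  ext1 ξ
  rw [evolve, unweight, smul_smul]

/-- Off the line the exponential beats the weight, so the slice is a product of two `L²` functions
and the inverse Fourier integral converges absolutely. -/
theorem integrable_evolve_unweight_slice (hm : 0 < m) (hη : η ≠ 0) (hx : x ∈ halfLine s)
    (h2 : MemLp α 2) : Integrable fun ξ => evolve m η s (unweight α) (x, ξ) := by
  rw [evolve_unweight_slice]
  exact memLp_one_iff_integrable.1 (h2.smul (memLp_two_decayExp_mul_besselWeight hm hη hx))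

theorem memLp_evolve_unweight_slice (hm : 0 < m) (hη : η ≠ 0) (hx : x ∈ halfLine s)
    (h2 : MemLp α 2) : MemLp (fun ξ => evolve m η s (unweight α) (x, ξ)) 2 := by
  rw [evolve_unweight_slice]
  obtain ⟨C, hC⟩ := exists_decayExp_mul_besselWeight_le hm hη hx
  refine h2.of_le_mul (c := C) ((memLp_two_decayExp_mul_besselWeight hm hη hx).1.smul h2.1)
    (Eventually.of_forall fun ξ => ?_)
  have hC0 : 0 ≤ C := by
    have := (mul_pos (Real.exp_pos _) (besselWeight_pos (1 / 2) 0)).le.trans (hC 0)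
    simpa using this
  rw [norm_smul, Real.norm_eq_abs, abs_of_pos (mul_pos (decayExp_pos _ _ _ _) (besselWeight_pos _ _))]
  refine mul_le_mul_of_nonneg_right ((hC ξ).trans ?_) (norm_nonneg _)
  exact mul_le_of_le_one_right hC0 (inv_le_one_of_one_le₀ (by nlinarith [sq_nonneg ξ]))

end SliceEvolve

/-! ### Almost everywhere convergence from summable bounds -/

/-- Borel–Cantelli in integral form: the sum over `n` has finite integral, hence is finite almost
everywhere. -/
theorem ae_tendsto_zero_of_lintegral_le {X : Type*} [MeasurableSpace X] {μ : Measure X}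
    {a : ℕ → X → ℝ≥0∞} (ha : ∀ n, AEMeasurable (a n) μ)
    (h : ∀ n, ∫⁻ x, a n x ∂μ ≤ 2⁻¹ ^ n) : ∀ᵐ x ∂μ, Tendsto (fun n => a n x) atTop (𝓝 0) := by
  have h1 : ∫⁻ x, ∑' n, a n x ∂μ ≠ ⊤ := by
    rw [lintegral_tsum ha]
    refine ne_top_of_le_ne_top ?_ (ENNReal.tsum_le_tsum h)
    rw [ENNReal.tsum_geometric]
    simp
  filter_upwards [ae_lt_top' (AEMeasurable.tsum ha) h1] with x hx
  exact ENNReal.tendsto_atTop_zero_of_tsum_ne_top hx.ne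

/-! ### Solutions on a half-plane are determined by their traces -/

theorem tendsto_eLpNorm_clm {X : Type*} [MeasurableSpace X] {μ : Measure X}
    (L : Spinor →L[ℂ] Spinor) {h : ℕ → X → Spinor}
    (h0 : Tendsto (fun n => eLpNorm (h n) 2 μ) atTop (𝓝 0)) :
    Tendsto (fun n => eLpNorm (fun p => L (h n p)) 2 μ) atTop (𝓝 0) := by
  refine tendsto_of_tendsto_of_tendsto_of_le_of_le tendsto_const_nhds
    (by simpa using ENNReal.Tendsto.const_mul h0 (Or.inr (ENNReal.ofReal_ne_top (r := ‖L‖))))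
    (fun n => bot_le) (fun n => ?_)
  refine (eLpNorm_le_mul_eLpNorm_of_ae_le_mul
    (Eventually.of_forall fun p => L.le_opNorm _) 2).trans_eq ?_
  rw [ofReal_norm]

/-- For a solution, `g` cancels in `(σ · ∇) u - i (z - m σ₃) u`, which leaves only the two
approximation errors. -/
theorem tendsto_eLpNorm_defect {μ : Measure (ℝ × ℝ)} {m z : ℝ} {f g : ℝ × ℝ → Spinor}
    (hf : AEStronglyMeasurable f μ) (hfg : ∀ᵐ p ∂μ, g p = gradTerm m z (f p))
    {u : ℕ → 𝓢(ℝ × ℝ, Spinor)}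
    (h1 : Tendsto (fun n => eLpNorm (fun p => u n p - f p) 2 μ) atTop (𝓝 0))
    (h2 : Tendsto (fun n => eLpNorm (fun p => sigmaGrad (u n) p - g p) 2 μ) atTop (𝓝 0)) :
    Tendsto (fun n => eLpNorm (defect m z (u n)) 2 μ) atTop (𝓝 0) := by
  have hg : AEStronglyMeasurable g μ :=
    ((gradTerm m z).continuous.comp_aestronglyMeasurable hf).congr (hfg.mono fun p hp => hp.symm)
  refine (tendsto_eLpNorm_add (fun n => ?_) (fun n => ?_) h2
    (tendsto_eLpNorm_clm (-gradTerm m z) h1)).congr fun n => eLpNorm_congr_ae ?_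
  · exact (continuous_sigmaGrad (u n)).aestronglyMeasurable.sub hg
  · exact (-gradTerm m z).continuous.comp_aestronglyMeasurable
      ((u n).continuous.aestronglyMeasurable.sub hf)
  · filter_upwards [hfg] with p hp
    simp only [Pi.add_apply, hp, defect, neg_apply, map_sub]
    abel

theorem eLpNorm_sliceFourier_of_hasCompactSupport {μ : Measure ℝ} [SFinite μ]
    {w : ℝ × ℝ → Spinor} (hc : Continuous w) (hs : HasCompactSupport w) :
    eLpNorm (sliceFourier w) 2 (μ.prod volume) = eLpNorm w 2 (μ.prod volume) :=
  eLpNorm_sliceFourier hc.stronglyMeasurable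
    (Eventually.of_forall fun x => integrable_slice hc hs x)
    (Eventually.of_forall fun x => memLp_slice hc hs x)

theorem sliceFourier_fun_sub {w w' : ℝ × ℝ → Spinor} (hc : Continuous w)
    (hs : HasCompactSupport w) (hc' : Continuous w') (hs' : HasCompactSupport w') :
    sliceFourier (w - w') = sliceFourier w - sliceFourier w' := by
  ext1 p
  exact fourier_fun_sub (integrable_slice hc hs p.1) (integrable_slice hc' hs' p.1) p.2

/-- A slice of a compactly supported Schwartz function. -/
def sliceSchwartz (u : 𝓢(ℝ × ℝ, Spinor)) (hu : HasCompactSupport u) (x : ℝ) : 𝓢(ℝ, Spinor) :=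
  (hasCompactSupport_slice hu x).toSchwartzMap
    ((u.smooth ⊤).comp (by fun_prop : ContDiff ℝ ∞ fun y : ℝ => (x, y)))

theorem sliceFourier_eq_fourier_sliceSchwartz (u : 𝓢(ℝ × ℝ, Spinor)) (hu : HasCompactSupport u)
    (x : ℝ) : (fun ξ => sliceFourier u (x, ξ)) = 𝓕 (sliceSchwartz u hu x) := rfl

theorem sliceFourierInv_sliceFourier (u : 𝓢(ℝ × ℝ, Spinor)) (hu : HasCompactSupport u) :
    sliceFourierInv (sliceFourier u) = u := by
  ext1 ⟨x, y⟩
  have h1 : sliceFourierInv (sliceFourier u) (x, y) =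
      (𝓕⁻ (𝓕 (sliceSchwartz u hu x)) : 𝓢(ℝ, Spinor)) y := by
    rw [SchwartzMap.fourierInv_coe, ← sliceFourier_eq_fourier_sliceSchwartz]
    rfl
  rw [h1, fourierInv_fourier_eq]
  rfl

theorem fourierInv_fun_sub {f g : ℝ → Spinor} (hf : Integrable f) (hg : Integrable g) (y : ℝ) :
    𝓕⁻ (fun ξ => f ξ - g ξ) y = 𝓕⁻ f y - 𝓕⁻ g y := by
  simp_rw [Real.fourierInv_eq_fourier_neg]
  exact fourier_fun_sub hf hg _

theorem measure_halfLine {s : ℝ} (hs : s ^ 2 = 1) : volume (halfLine s) = ⊤ := by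
  rcases sq_eq_one_iff.1 hs with rfl | rfl
  · have e : halfLine 1 = Set.Ioi 0 := by ext x; simp [halfLine]
    rw [e, Real.volume_Ioi]
  · have e : halfLine (-1) = Set.Iio 0 := by ext x; simp [halfLine]
    rw [e, Real.volume_Iio]

theorem memLp_decayExp {m η s : ℝ} (hm : 0 < m) (hη : η ≠ 0) (hs : s ^ 2 = 1) (ξ : ℝ) :
    MemLp (fun x => decayExp m η s (x, ξ)) 2 (volume.restrict (halfLine s)) := by
  refine ⟨((continuous_decayExp m η s).comp (by fun_prop :
    Continuous fun x : ℝ => (x, ξ))).aestronglyMeasurable, ?_⟩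
  have h : eLpNorm (fun x => decayExp m η s (x, ξ)) 2 (volume.restrict (halfLine s)) ^ 2 < ⊤ := by
    rw [eLpNorm_two_sq, lintegral_decayExp_sq hm hη hs]
    exact ENNReal.ofReal_lt_top
  exact (ENNReal.pow_lt_top_iff.1 h).resolve_right (by norm_num)

theorem propagate_eq {m η z s : ℝ} (hs : s ^ 2 = 1) (x ξ : ℝ) (D : Spinor) :
    propagate m η z (2 * Real.pi * ξ) x D =
      (decayExp m η s (x, ξ))⁻¹ • spectralProj m η z s (2 * Real.pi * ξ) D +
        decayExp m η s (x, ξ) • spectralProj m η z (-s) (2 * Real.pi * ξ) D := by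
  rw [decayExp, ← Real.exp_neg, propagate]
  rcases sq_eq_one_iff.1 hs with rfl | rfl
  · simp
  · simp [add_comm]

/-- After the decaying part is subtracted, the growing component remains in `L²`. Its norm is at
least that of the constant `P D`, and a constant in `L²` of a half-line vanishes. -/
theorem spectralProj_eq_zero_of_memLp {m η z s : ℝ} (hm : 0 < m) (hη : η ≠ 0) (hs : s ^ 2 = 1)
    {ξ : ℝ} {D : Spinor} (h : MemLp (fun x => propagate m η z (2 * Real.pi * ξ) x D) 2
      (volume.restrict (halfLine s))) : spectralProj m η z s (2 * Real.pi * ξ) D = 0 := by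
  have h1 : MemLp (fun x => decayExp m η s (x, ξ) • spectralProj m η z (-s) (2 * Real.pi * ξ) D) 2
      (volume.restrict (halfLine s)) := by
    refine (memLp_decayExp hm hη hs ξ).of_le_mul
      (c := ‖spectralProj m η z (-s) (2 * Real.pi * ξ) D‖)
      ((memLp_decayExp hm hη hs ξ).1.smul aestronglyMeasurable_const)
      (Eventually.of_forall fun x => ?_)
    rw [norm_smul, mul_comm]
  have h2 := h.sub h1
  have h3 : MemLp (fun _ : ℝ => spectralProj m η z s (2 * Real.pi * ξ) D) 2
      (volume.restrict (halfLine s)) := by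
    refine h2.mono aestronglyMeasurable_const ?_
    filter_upwards [ae_mem_halfLine s] with x hx
    rw [Pi.sub_apply, propagate_eq hs, add_sub_cancel_right, norm_smul]
    refine le_mul_of_one_le_left (norm_nonneg _) ?_
    rw [norm_inv, Real.norm_eq_abs, abs_of_pos (decayExp_pos _ _ _ _)]
    refine (one_le_inv₀ (decayExp_pos _ _ _ _)).2 ?_
    rw [decayExp, Real.exp_le_one_iff]
    have hx' : 0 < s * x := hx
    have := mul_pos (kappa_pos hm hη (2 * Real.pi * ξ)) hx'
    dsimp only
    linarith
  rw [memLp_const_iff (by norm_num) (by norm_num)] at h3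
  refine h3.resolve_right ?_
  rw [Measure.restrict_apply_univ, measure_halfLine hs]
  simp

/-- `F` stands for the partial Fourier transform of `f`, whose slices need not be integrable. It is
produced by completeness, since Plancherel carries the Cauchy property of `u n` over to the
transforms. -/
theorem exists_tendsto_sliceFourier {s : ℝ} {f : ℝ × ℝ → Spinor}
    (hf : MemLp f 2 (volume.restrict (halfPlane s))) {u : ℕ → 𝓢(ℝ × ℝ, Spinor)}
    (hu : ∀ n, HasCompactSupport (u n))
    (h : Tendsto (fun n => eLpNorm (fun p => u n p - f p) 2 (volume.restrict (halfPlane s)))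
      atTop (𝓝 0)) :
    ∃ F : ℝ × ℝ → Spinor, StronglyMeasurable F ∧ MemLp F 2 (volume.restrict (halfPlane s)) ∧
      Tendsto (fun n => eLpNorm (fun p => sliceFourier (u n) p - F p) 2
        (volume.restrict (halfPlane s))) atTop (𝓝 0) := by
  set μ := (volume : Measure (ℝ × ℝ)).restrict (halfPlane s)
  have hμ : μ = (volume.restrict (halfLine s)).prod volume := volume_restrict_halfPlane s
  have hum : ∀ n, MemLp (u n) 2 μ := fun n => ((u n).memLp 2 volume).restrict _
  have hsm : ∀ n, StronglyMeasurable (sliceFourier (u n)) := fun n =>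
    stronglyMeasurable_sliceFourier (u n).continuous.stronglyMeasurable
  have hU : ∀ n, MemLp (sliceFourier (u n)) 2 μ := fun n => by
    refine ⟨(hsm n).aestronglyMeasurable, ?_⟩
    rw [hμ, eLpNorm_sliceFourier_of_hasCompactSupport (u n).continuous (hu n), ← hμ]
    exact (hum n).2
  have hcau : CauchySeq fun n => (hum n).toLp (u n) := by
    refine Tendsto.cauchySeq (x := hf.toLp f) ?_
    rw [Lp.tendsto_Lp_iff_tendsto_eLpNorm'']
    exact h
  have hcau' : CauchySeq fun n => (hU n).toLp (sliceFourier (u n)) := by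
    rw [EMetric.cauchySeq_iff] at hcau ⊢
    intro ε hε
    obtain ⟨N, hN⟩ := hcau ε hε
    refine ⟨N, fun k hk l hl => ?_⟩
    have := hN k hk l hl
    rw [Lp.edist_toLp_toLp] at this ⊢
    rw [← sliceFourier_fun_sub (u k).continuous (hu k) (u l).continuous (hu l), hμ,
      eLpNorm_sliceFourier_of_hasCompactSupport ((u k).continuous.sub (u l).continuous)
      ((hu k).sub (hu l)), ← hμ]
    exact this
  obtain ⟨F, hF⟩ := cauchySeq_tendsto_of_complete hcau'
  refine ⟨F, Lp.stronglyMeasurable F, Lp.memLp F, ?_⟩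
  rw [Lp.tendsto_Lp_iff_tendsto_eLpNorm'] at hF
  refine hF.congr fun n => eLpNorm_congr_ae ?_
  filter_upwards [(hU n).coeFn_toLp] with p hp
  rw [Pi.sub_apply, hp]

theorem ae_halfPlane_of_ae_snd {s : ℝ} {P : ℝ → Prop} (h : ∀ᵐ ξ : ℝ, P ξ) :
    ∀ᵐ p ∂((volume : Measure (ℝ × ℝ)).restrict (halfPlane s)), P p.2 :=
  ae_restrict_of_ae (Measure.quasiMeasurePreserving_snd.ae h)

theorem ae_halfPlane_mem (s : ℝ) :
    ∀ᵐ p ∂((volume : Measure (ℝ × ℝ)).restrict (halfPlane s)), p.1 ∈ halfLine s :=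
  ae_restrict_mem (isOpen_halfPlane s).measurableSet

theorem measurable_eLpNorm_slice_sq {E : Type*} [NormedAddCommGroup E] {μ : Measure ℝ} [SFinite μ]
    {w : ℝ × ℝ → E} (hw : StronglyMeasurable w) :
    Measurable fun ξ => eLpNorm (fun x => w (x, ξ)) 2 μ ^ 2 := by
  simp_rw [eLpNorm_two_sq]
  exact Measurable.lintegral_prod_left' (hw.enorm.pow_const 2)

theorem lintegral_eLpNorm_slice_sq {E : Type*} [NormedAddCommGroup E] {μ : Measure ℝ} [SFinite μ]
    {w : ℝ × ℝ → E} (hw : StronglyMeasurable w) :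
    ∫⁻ ξ, eLpNorm (fun x => w (x, ξ)) 2 μ ^ 2 = eLpNorm w 2 (μ.prod volume) ^ 2 := by
  rw [eLpNorm_two_sq, lintegral_prod_symm _ (hw.enorm.pow_const 2).aemeasurable]
  simp_rw [eLpNorm_two_sq]

theorem tendsto_zero_of_sq {a : ℕ → ℝ≥0∞} (h : Tendsto (fun n => a n ^ 2) atTop (𝓝 0)) :
    Tendsto a atTop (𝓝 0) := by
  have := h.ennrpow_const (1 / 2)
  rw [ENNReal.zero_rpow_of_pos (by norm_num)] at this
  refine this.congr fun n => ?_
  rw [← ENNReal.rpow_natCast, ← ENNReal.rpow_mul]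
  norm_num

theorem ae_memLp_slice_left {E : Type*} [NormedAddCommGroup E] {μ : Measure ℝ} [SFinite μ]
    {w : ℝ × ℝ → E} (hw : StronglyMeasurable w) (h : MemLp w 2 (μ.prod volume)) :
    ∀ᵐ ξ : ℝ, MemLp (fun x => w (x, ξ)) 2 μ := by
  have h2 : ∫⁻ ξ, eLpNorm (fun x => w (x, ξ)) 2 μ ^ 2 ≠ ⊤ := by
    rw [lintegral_eLpNorm_slice_sq hw]
    exact ENNReal.pow_ne_top h.2.ne
  filter_upwards [ae_lt_top (measurable_eLpNorm_slice_sq hw) h2] with ξ hξ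
  exact ⟨(hw.comp_measurable (by fun_prop)).aestronglyMeasurable,
    (ENNReal.pow_lt_top_iff.1 hξ).resolve_right (by norm_num)⟩

theorem stronglyMeasurable_propagate (m η z : ℝ) {D : ℝ → Spinor} (hD : StronglyMeasurable D) :
    StronglyMeasurable fun p : ℝ × ℝ => propagate m η z (2 * Real.pi * p.2) p.1 (D p.2) := by
  have hκ := continuous_kappa m η
  have smul' : ∀ {a : ℝ × ℝ → ℂ} {b : ℝ × ℝ → Spinor}, Measurable a → Measurable b →
      Measurable fun p => a p • b p := fun ha hb => ha.smul hb
  have hDm : Measurable fun p : ℝ × ℝ => D p.2 := hD.measurable.comp measurable_snd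
  have hsym : Measurable fun p : ℝ × ℝ => symbol m z (2 * Real.pi * p.2) (D p.2) := by
    -- The symbol is affine in `k`; splitting off `k σ₃` leaves constant matrices, for which joint
    -- measurability is immediate.
    have : ∀ p : ℝ × ℝ, symbol m z (2 * Real.pi * p.2) (D p.2) =
        ((2 * Real.pi * p.2 : ℝ) : ℂ) • act σ₃ (D p.2) +
        act !![0, Complex.I * (z + m); Complex.I * (z - m), 0] (D p.2) := fun p => by
      ext i
      fin_cases i <;> simp [symbol, act_apply, σ₃]
      ring
    simp_rw [this]
    exact (smul' (by fun_prop) ((act σ₃).continuous.measurable.comp hDm)).add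
      ((act _).continuous.measurable.comp hDm)
  have h1 : ∀ ε : ℝ, Measurable fun p : ℝ × ℝ =>
      spectralProj m η z ε (2 * Real.pi * p.2) (D p.2) := fun ε => by
    simp_rw [spectralProj_apply]
    refine smul' measurable_const (hDm.add (smul' ?_ hsym))
    have : Measurable fun p : ℝ × ℝ => ε / kappa m η (2 * Real.pi * p.2) := by fun_prop
    exact Complex.measurable_ofReal.comp this
  refine Measurable.stronglyMeasurable ?_
  simp_rw [propagate, ← Complex.coe_smul]
  exact (smul' (by fun_prop) (h1 1)).add (smul' (by fun_prop) (h1 (-1)))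

theorem ae_tendsto_of_eLpNorm_sq_le {X : Type*} [MeasurableSpace X] {μ : Measure X}
    {a : ℕ → X → Spinor} {b : X → Spinor} (ha : ∀ n, AEStronglyMeasurable (a n) μ)
    (hb : AEStronglyMeasurable b μ)
    (h : ∀ n, eLpNorm (fun x => a n x - b x) 2 μ ^ 2 ≤ 2⁻¹ ^ n) :
    ∀ᵐ x ∂μ, Tendsto (fun n => a n x) atTop (𝓝 (b x)) := by
  filter_upwards [ae_tendsto_zero_of_lintegral_le (a := fun n x => ‖a n x - b x‖ₑ ^ 2)
    (fun n => ((ha n).sub hb).enorm.pow_const 2)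
    (fun n => (eLpNorm_two_sq _).symm.trans_le (h n))] with x hx
  rw [tendsto_iff_edist_tendsto_0]
  simp_rw [edist_eq_enorm_sub]
  exact tendsto_zero_of_sq hx

theorem exists_subseq_eLpNorm_sq_le {a b c : ℕ → ℝ≥0∞} (ha : Tendsto a atTop (𝓝 0))
    (hb : Tendsto b atTop (𝓝 0)) (hc : Tendsto c atTop (𝓝 0)) :
    ∃ φ : ℕ → ℕ, StrictMono φ ∧ ∀ n, a (φ n) ^ 2 ≤ 2⁻¹ ^ n ∧ b (φ n) ^ 2 ≤ 2⁻¹ ^ n ∧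
      c (φ n) ^ 2 ≤ 2⁻¹ ^ n := by
  have key : ∀ {a : ℕ → ℝ≥0∞}, Tendsto a atTop (𝓝 0) →
      ∀ n : ℕ, ∀ᶠ k in atTop, a k ^ 2 ≤ 2⁻¹ ^ n := fun {a} ha n => by
    have h2 : Tendsto (fun k => a k ^ 2) atTop (𝓝 0) := by
      simpa [Function.comp_def] using ((ENNReal.continuous_pow 2).tendsto 0).comp ha
    exact h2.eventually (Iic_mem_nhds (ENNReal.pow_pos (by simp) n))
  exact extraction_forall_of_eventually fun n => (key ha n).and ((key hb n).and (key hc n))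

/-- The transforms of the approximants have two limits: an `L²` limit `F`, and pointwise the
propagation of the trace by the differential equation. Their equality puts the propagated function
in `L²` in `x` for almost every `ξ`, which excludes the growing mode. The inverse transform then
returns `f`. -/
theorem halfPlane_solution {m η z s : ℝ} (hm : 0 < m) (hη : η ≠ 0)
    (hz : m ^ 2 - z ^ 2 = 4 * m ^ 2 / η ^ 2) (hs : s ^ 2 = 1) {f g : ℝ × ℝ → Spinor}
    (hf : MemLp f 2 (volume.restrict (halfPlane s)))
    (hfg : ∀ᵐ p ∂(volume.restrict (halfPlane s)), g p = gradTerm m z (f p))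
    {u : ℕ → 𝓢(ℝ × ℝ, Spinor)} (hu : ∀ n, HasCompactSupport (u n))
    (h1 : Tendsto (fun n => eLpNorm (fun p => u n p - f p) 2 (volume.restrict (halfPlane s)))
      atTop (𝓝 0))
    (h2 : Tendsto (fun n => eLpNorm (fun p => sigmaGrad (u n) p - g p) 2
      (volume.restrict (halfPlane s))) atTop (𝓝 0))
    {α : ℝ → Spinor} (hα : StronglyMeasurable α) (hα2 : MemLp α 2)
    (h3 : Tendsto (fun n => eLpNorm (fun ξ => (besselWeight (-1 / 2) ξ : ℂ) •
      𝓕 (lineRestrict (u n)) ξ - α ξ) 2 volume) atTop (𝓝 0)) :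
    (∀ᵐ ξ : ℝ, symbol m z (2 * Real.pi * ξ) (unweight α ξ) =
      ((-(s * kappa m η (2 * Real.pi * ξ)) : ℝ) : ℂ) • unweight α ξ) ∧
    f =ᵐ[volume.restrict (halfPlane s)] sliceFourierInv (evolve m η s (unweight α)) := by
  set μ := (volume : Measure (ℝ × ℝ)).restrict (halfPlane s) with hμd
  have hμ : μ = (volume.restrict (halfLine s)).prod volume := volume_restrict_halfPlane s
  obtain ⟨F, hFm, hF2, hF⟩ := exists_tendsto_sliceFourier hf hu h1
  have hd := tendsto_eLpNorm_defect hf.1 hfg h1 h2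
  -- One subsequence serves all three convergences, with errors summable enough for convergence
  -- almost everywhere.
  obtain ⟨φ, hφ, hle⟩ := exists_subseq_eLpNorm_sq_le hF hd h3
  have hsmooth : ∀ n, ContDiff ℝ 1 (u n) := fun n => (u n).smooth 1
  have hUm : ∀ n, StronglyMeasurable (sliceFourier (u n)) := fun n =>
    stronglyMeasurable_sliceFourier (u n).continuous.stronglyMeasurable
  have hrc : ∀ n, Continuous (defect m z (u n)) := fun n => continuous_defect m z (hsmooth n)
  have hrs : ∀ n, HasCompactSupport (defect m z (u n)) := fun n => hasCompactSupport_defect m z (hu n)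
  have hrm : ∀ n, StronglyMeasurable (sliceFourier (defect m z (u n))) := fun n =>
    stronglyMeasurable_sliceFourier (hrc n).stronglyMeasurable
  have c1 : ∀ᵐ p ∂μ, Tendsto (fun n => sliceFourier (u (φ n)) p) atTop (𝓝 (F p)) :=
    ae_tendsto_of_eLpNorm_sq_le (fun n => (hUm _).aestronglyMeasurable)
      hFm.aestronglyMeasurable fun n => (hle n).1
  have c2 : ∀ᵐ ξ : ℝ, Tendsto (fun n => eLpNorm (fun x => sliceFourier (defect m z (u (φ n)))
      (x, ξ)) 2 (volume.restrict (halfLine s))) atTop (𝓝 0) := by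
    filter_upwards [ae_tendsto_zero_of_lintegral_le (a := fun n ξ =>
      eLpNorm (fun x => sliceFourier (defect m z (u (φ n))) (x, ξ)) 2
        (volume.restrict (halfLine s)) ^ 2)
      (fun n => (measurable_eLpNorm_slice_sq (hrm _)).aemeasurable) (fun n => by
        rw [lintegral_eLpNorm_slice_sq (hrm _),
          eLpNorm_sliceFourier_of_hasCompactSupport (hrc _) (hrs _), ← hμ]
        exact (hle n).2.1)] with ξ hξ
    exact tendsto_zero_of_sq hξ
  have c3 : ∀ᵐ ξ : ℝ, Tendsto (fun n => sliceFourier (u (φ n)) (0, ξ)) atTop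
      (𝓝 (unweight α ξ)) := by
    filter_upwards [ae_tendsto_of_eLpNorm_sq_le (fun n =>
      ((hasTemperateGrowth_besselWeight (-1 / 2)).1.continuous.smul
        (𝓕 (lineRestrict (u (φ n)))).continuous).aestronglyMeasurable)
      hα.aestronglyMeasurable fun n => (hle n).2.2] with ξ hξ
    -- Multiplication by the inverse weight is harmless for pointwise convergence, although it is
    -- unbounded on `L²`.
    refine (hξ.const_smul (besselWeight (1 / 2) ξ)).congr fun n => ?_
    have e := besselWeight_mul_neg (1 / 2) ξ
    rw [← neg_div] at e
    rw [Pi.smul_apply', Complex.coe_smul, smul_smul, e, one_smul]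
    rfl
  have c4 : ∀ᵐ ξ : ℝ, ∀ x ∈ halfLine s, Tendsto (fun n => sliceFourier (u (φ n)) (x, ξ)) atTop
      (𝓝 (propagate m η z (2 * Real.pi * ξ) x (unweight α ξ))) := by
    filter_upwards [c2, c3] with ξ a b x hx
    exact tendsto_propagate (U := fun n x => sliceFourier (u (φ n)) (x, ξ))
      (ρ := fun n x => act σ₁ (sliceFourier (defect m z (u (φ n))) (x, ξ))) hm hη hz
      (fun n x => hasDerivAt_sliceFourier_symbol m z (hsmooth _) (hu _) x ξ)
      (fun n => (act σ₁).continuous.comp (continuous_sliceFourier_left (hrc _) (hrs _) ξ))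
      (tendsto_eLpNorm_clm _ a) b hx
  have hDm := stronglyMeasurable_unweight hα
  have c5 : ∀ᵐ p ∂μ, F p = propagate m η z (2 * Real.pi * p.2) p.1 (unweight α p.2) := by
    filter_upwards [c1, ae_halfPlane_of_ae_snd c4, ae_halfPlane_mem s] with p a b c
    exact tendsto_nhds_unique a (b p.1 c)
  have c6 : ∀ᵐ ξ : ℝ, spectralProj m η z s (2 * Real.pi * ξ) (unweight α ξ) = 0 := by
    -- By Fubini the propagated trace is square integrable in `x` for almost every `ξ`.
    have := (memLp_congr_ae c5).1 hF2
    rw [hμ] at this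
    filter_upwards [ae_memLp_slice_left (stronglyMeasurable_propagate m η z hDm) this] with ξ hξ
    exact spectralProj_eq_zero_of_memLp hm hη hs hξ
  have c7 : F =ᵐ[μ] evolve m η s (unweight α) := by
    filter_upwards [c5, ae_halfPlane_of_ae_snd c6] with p a b
    have e : spectralProj m η z (-s) (2 * Real.pi * p.2) (unweight α p.2) = unweight α p.2 := by
      have e1 := spectralProj_add m η z (2 * Real.pi * p.2) (unweight α p.2)
      rcases sq_eq_one_iff.1 hs with rfl | rfl
      · rwa [b, zero_add] at e1
      · rwa [b, add_zero, ← neg_neg (1 : ℝ)] at e1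
    rw [a, propagate_eq hs, b, e, smul_zero, zero_add]
    rfl
  refine ⟨c6.mono fun ξ h => symbol_eq_of_spectralProj_eq_zero hm hη hs h, ?_⟩
  set W := evolve m η s (unweight α)
  have hWm : StronglyMeasurable W := stronglyMeasurable_evolve m η s hDm
  -- Plancherel backwards: `u n` converges to `f` by assumption and now also to the inverse
  -- transform of `W`.
  have lim : Tendsto (fun n => eLpNorm (fun p => u n p - sliceFourierInv W p) 2 μ) atTop (𝓝 0) := by
    refine hF.congr fun n => ?_
    have i1 : ∀ x, Integrable fun ξ => sliceFourier (u n) (x, ξ) := fun x =>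
      (𝓕 (sliceSchwartz (u n) (hu n) x)).integrable
    have i2 : ∀ x, MemLp (fun ξ => sliceFourier (u n) (x, ξ)) 2 := fun x =>
      (𝓕 (sliceSchwartz (u n) (hu n) x)).memLp 2 volume
    have e1 : eLpNorm (fun p => sliceFourier (u n) p - F p) 2 μ =
        eLpNorm (fun p => sliceFourier (u n) p - W p) 2 μ := eLpNorm_congr_ae <| by
      filter_upwards [c7] with p hp
      rw [hp]
    have e2 : eLpNorm (fun p => u n p - sliceFourierInv W p) 2 μ =
        eLpNorm (sliceFourierInv fun p => sliceFourier (u n) p - W p) 2 μ := eLpNorm_congr_ae <| by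
      filter_upwards [ae_halfPlane_mem s] with p hp
      have e3 := fourierInv_fun_sub (i1 p.1) (integrable_evolve_unweight_slice hm hη hp hα2) p.2
      have e4 := congrFun (sliceFourierInv_sliceFourier (u n) (hu n)) p
      rw [← e4]
      exact e3.symm
    rw [e1, e2, hμ]
    refine (eLpNorm_sliceFourierInv ((hUm n).sub hWm) ?_ ?_).symm
    · filter_upwards [ae_mem_halfLine s] with x hx
      exact (i1 x).sub (integrable_evolve_unweight_slice hm hη hx hα2)
    · filter_upwards [ae_mem_halfLine s] with x hx
      exact (i2 x).sub (memLp_evolve_unweight_slice hm hη hx hα2)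
  have hSm : AEStronglyMeasurable (sliceFourierInv W) μ :=
    (stronglyMeasurable_sliceFourierInv hWm).aestronglyMeasurable
  -- Only two sequences are needed here; the third slot repeats the second.
  obtain ⟨ψ, -, hψ⟩ := exists_subseq_eLpNorm_sq_le h1 lim lim
  filter_upwards [ae_tendsto_of_eLpNorm_sq_le (fun n => (u (ψ n)).continuous.aestronglyMeasurable)
    hf.1 fun n => (hψ n).1, ae_tendsto_of_eLpNorm_sq_le
    (fun n => (u (ψ n)).continuous.aestronglyMeasurable) hSm fun n => (hψ n).2.1] with p a b
  exact tendsto_nhds_unique a b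

/-! ### Superpositions of exponentials -/

/-- The function `(x, y) ↦ ∫ e^{a(ξ) x + b(ξ) y} w(ξ) dξ`. -/
def expIntegral (a b : ℝ → ℂ) (w : ℝ → Spinor) (p : ℝ × ℝ) : Spinor :=
  ∫ ξ, Complex.exp (a ξ * p.1 + b ξ * p.2) • w ξ

section ExpIntegral

variable {a b : ℝ → ℂ} {M : ℝ}

theorem norm_exp_phase_le {α β : ℂ} (hα : ‖α‖ ≤ M) (hβ : ‖β‖ ≤ M) (p : ℝ × ℝ) :
    ‖Complex.exp (α * p.1 + β * p.2)‖ ≤ Real.exp (2 * M * ‖p‖) := by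
  rw [Complex.norm_exp, Real.exp_le_exp]
  refine (Complex.re_le_norm _).trans ((norm_add_le _ _).trans ?_)
  rw [norm_mul, norm_mul, Complex.norm_real, Complex.norm_real]
  have hM : 0 ≤ M := (norm_nonneg _).trans hα
  have h1 := mul_le_mul hα (norm_fst_le p) (norm_nonneg _) hM
  have h2 := mul_le_mul hβ (norm_snd_le p) (norm_nonneg _) hM
  linarith

/-- The exponents matter only where `w` does not vanish, and there they are bounded by `M`. -/
theorem integrable_expIntegrand (ha : Continuous a) (hb : Continuous b) {w : ℝ → Spinor}
    (hw : Integrable w) (hM : ∀ ξ, w ξ ≠ 0 → ‖a ξ‖ ≤ M ∧ ‖b ξ‖ ≤ M) (p : ℝ × ℝ) :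
    Integrable fun ξ => Complex.exp (a ξ * p.1 + b ξ * p.2) • w ξ := by
  have hc : Continuous fun ξ => Complex.exp (a ξ * p.1 + b ξ * p.2) := by fun_prop
  refine (hw.norm.const_mul (Real.exp (2 * M * ‖p‖))).mono' (hc.aestronglyMeasurable.smul hw.1)
    (Eventually.of_forall fun ξ => ?_)
  rw [norm_smul]
  by_cases h : w ξ = 0
  · simp [h]
  · exact mul_le_mul_of_nonneg_right (norm_exp_phase_le (hM ξ h).1 (hM ξ h).2 p) (norm_nonneg _)

theorem integrable_coeff_smul {c : ℝ → ℂ} (hc : Continuous c) {w : ℝ → Spinor}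
    (hw : Integrable w) (hM : ∀ ξ, w ξ ≠ 0 → ‖c ξ‖ ≤ M) : Integrable fun ξ => c ξ • w ξ := by
  refine (hw.norm.const_mul M).mono' (hc.aestronglyMeasurable.smul hw.1)
    (Eventually.of_forall fun ξ => ?_)
  rw [norm_smul]
  by_cases h : w ξ = 0
  · simp [h]
  · exact mul_le_mul_of_nonneg_right (hM ξ h) (norm_nonneg _)

/-- The Fréchet derivative with given partial derivatives. -/
def pairDeriv (A B : Spinor) : ℝ × ℝ →L[ℝ] Spinor :=
  (ContinuousLinearMap.fst ℝ ℝ ℝ).smulRight A + (ContinuousLinearMap.snd ℝ ℝ ℝ).smulRight B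

theorem pairDeriv_apply (A B : Spinor) (v : ℝ × ℝ) : pairDeriv A B v = v.1 • A + v.2 • B := rfl

theorem norm_pairDeriv_le (A B : Spinor) : ‖pairDeriv A B‖ ≤ ‖A‖ + ‖B‖ := by
  refine ContinuousLinearMap.opNorm_le_bound _ (by positivity) fun v => ?_
  rw [pairDeriv_apply, add_mul]
  refine (norm_add_le _ _).trans (add_le_add ?_ ?_)
  · rw [norm_smul, mul_comm]
    exact mul_le_mul_of_nonneg_left (norm_fst_le v) (norm_nonneg _)
  · rw [norm_smul, mul_comm]
    exact mul_le_mul_of_nonneg_left (norm_snd_le v) (norm_nonneg _)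

/-- The map `A ↦ (v ↦ v₁ A)`. -/
def fstSmulRight : Spinor →L[ℝ] ℝ × ℝ →L[ℝ] Spinor :=
  ContinuousLinearMap.smulRightL ℝ (ℝ × ℝ) Spinor (ContinuousLinearMap.fst ℝ ℝ ℝ)

/-- The map `B ↦ (v ↦ v₂ B)`. -/
def sndSmulRight : Spinor →L[ℝ] ℝ × ℝ →L[ℝ] Spinor :=
  ContinuousLinearMap.smulRightL ℝ (ℝ × ℝ) Spinor (ContinuousLinearMap.snd ℝ ℝ ℝ)

theorem pairDeriv_eq (A B : Spinor) : pairDeriv A B = fstSmulRight A + sndSmulRight B := rfl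

theorem hasFDerivAt_expIntegral (ha : Continuous a) (hb : Continuous b) {w : ℝ → Spinor}
    (hw : Integrable w) (hM : ∀ ξ, w ξ ≠ 0 → ‖a ξ‖ ≤ M ∧ ‖b ξ‖ ≤ M) (p : ℝ × ℝ) :
    HasFDerivAt (expIntegral a b w)
      (pairDeriv (expIntegral a b (fun ξ => a ξ • w ξ) p) (expIntegral a b (fun ξ => b ξ • w ξ) p))
      p := by
  have hwa := integrable_coeff_smul ha hw fun ξ h => (hM ξ h).1
  have hwb := integrable_coeff_smul hb hw fun ξ h => (hM ξ h).2
  have hMa : ∀ ξ, a ξ • w ξ ≠ 0 → ‖a ξ‖ ≤ M ∧ ‖b ξ‖ ≤ M := fun ξ h => hM ξ (right_ne_zero_of_smul h)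
  have hMb : ∀ ξ, b ξ • w ξ ≠ 0 → ‖a ξ‖ ≤ M ∧ ‖b ξ‖ ≤ M := fun ξ h => hM ξ (right_ne_zero_of_smul h)
  have ia := integrable_expIntegrand ha hb hwa hMa p
  have ib := integrable_expIntegrand ha hb hwb hMb p
  set F' : ℝ × ℝ → ℝ → ℝ × ℝ →L[ℝ] Spinor := fun q ξ =>
    pairDeriv (Complex.exp (a ξ * q.1 + b ξ * q.2) • a ξ • w ξ)
      (Complex.exp (a ξ * q.1 + b ξ * q.2) • b ξ • w ξ)
  have hF'i : ∫ ξ, F' p ξ = pairDeriv (expIntegral a b (fun ξ => a ξ • w ξ) p)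
      (expIntegral a b (fun ξ => b ξ • w ξ) p) := by
    simp only [F', pairDeriv_eq]
    rw [integral_add (fstSmulRight.integrable_comp ia) (sndSmulRight.integrable_comp ib),
      fstSmulRight.integral_comp_comm ia, sndSmulRight.integral_comp_comm ib]
    rfl
  have hF'm : AEStronglyMeasurable (F' p) volume := by
    simp only [F', pairDeriv_eq]
    exact ((fstSmulRight.integrable_comp ia).add (sndSmulRight.integrable_comp ib)).1
  rw [← hF'i]
  refine hasFDerivAt_integral_of_dominated_of_fderiv_le
    -- Uniform on the unit ball around `p`. The absolute value is needed because `M` may be negative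
    -- when `w` vanishes identically.
    (bound := fun ξ => Real.exp (2 * |M| * (‖p‖ + 1)) * (‖a ξ • w ξ‖ + ‖b ξ • w ξ‖))
    (Metric.ball_mem_nhds p one_pos)
    (Eventually.of_forall fun q => (integrable_expIntegrand ha hb hw hM q).1)
    (integrable_expIntegrand ha hb hw hM p) hF'm (Eventually.of_forall fun ξ q hq => ?_)
    ((hwa.norm.add hwb.norm).const_mul _) (Eventually.of_forall fun ξ q _ => ?_)
  · refine (norm_pairDeriv_le _ _).trans ?_
    rw [norm_smul _ (a ξ • w ξ), norm_smul _ (b ξ • w ξ), ← mul_add]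
    by_cases h : w ξ = 0
    · simp [h]
    refine mul_le_mul_of_nonneg_right ((norm_exp_phase_le (hM ξ h).1 (hM ξ h).2 q).trans ?_)
      (by positivity)
    rw [Real.exp_le_exp]
    have h1 : ‖q‖ ≤ ‖p‖ + 1 := by
      have h2 := norm_add_le p (q - p)
      have h3 : ‖q - p‖ < 1 := by rwa [← dist_eq_norm]
      rw [add_sub_cancel] at h2
      linarith
    have h4 : 2 * M ≤ 2 * |M| := by linarith [le_abs_self M]
    exact mul_le_mul h4 h1 (norm_nonneg _) (by positivity)
  · have hp1 : HasFDerivAt (fun q : ℝ × ℝ => (q.1 : ℂ))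
        (Complex.ofRealCLM.comp (ContinuousLinearMap.fst ℝ ℝ ℝ)) q :=
      (Complex.ofRealCLM.comp (ContinuousLinearMap.fst ℝ ℝ ℝ)).hasFDerivAt
    have hp2 : HasFDerivAt (fun q : ℝ × ℝ => (q.2 : ℂ))
        (Complex.ofRealCLM.comp (ContinuousLinearMap.snd ℝ ℝ ℝ)) q :=
      (Complex.ofRealCLM.comp (ContinuousLinearMap.snd ℝ ℝ ℝ)).hasFDerivAt
    have h := (((hp1.const_mul (a ξ)).add (hp2.const_mul (b ξ))).cexp).smul_const (w ξ)
    convert! h using 1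
    refine ContinuousLinearMap.ext fun v => ?_
    simp only [F', pairDeriv_apply, ContinuousLinearMap.smulRight_apply, smul_apply, add_apply,
      ContinuousLinearMap.comp_apply, ContinuousLinearMap.coe_fst', ContinuousLinearMap.coe_snd',
      Complex.ofRealCLM_apply, smul_eq_mul, Pi.add_apply, ← Complex.coe_smul, smul_smul, ← add_smul]
    congr 1
    ring

/-- The partial derivatives are integrals of the same kind, with `w` replaced by `a w` and `b w`,
which satisfy the same hypotheses. Hence the induction runs over all `w` simultaneously. -/
theorem contDiff_expIntegral (ha : Continuous a) (hb : Continuous b) (n : ℕ) :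
    ∀ {w : ℝ → Spinor}, Integrable w → (∀ ξ, w ξ ≠ 0 → ‖a ξ‖ ≤ M ∧ ‖b ξ‖ ≤ M) →
      ContDiff ℝ n (expIntegral a b w) := by
  induction n with
  | zero =>
    intro w hw hM
    rw [Nat.cast_zero, contDiff_zero]
    exact continuous_iff_continuousAt.2 fun p => (hasFDerivAt_expIntegral ha hb hw hM p).continuousAt
  | succ n ih =>
    intro w hw hM
    have h1 := ih (integrable_coeff_smul ha hw fun ξ h => (hM ξ h).1)
      fun ξ h => hM ξ (right_ne_zero_of_smul h)
    have h2 := ih (integrable_coeff_smul hb hw fun ξ h => (hM ξ h).2)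
      fun ξ h => hM ξ (right_ne_zero_of_smul h)
    rw [Nat.cast_succ, contDiff_succ_iff_hasFDerivAt]
    refine ⟨_, ?_, hasFDerivAt_expIntegral ha hb hw hM⟩
    simp only [pairDeriv_eq]
    exact (fstSmulRight.contDiff.comp h1).add (sndSmulRight.contDiff.comp h2)

theorem sigmaGrad_expIntegral {m z : ℝ} (ha : Continuous a) (hb : Continuous b) {w : ℝ → Spinor}
    (hw : Integrable w) (hM : ∀ ξ, w ξ ≠ 0 → ‖a ξ‖ ≤ M ∧ ‖b ξ‖ ≤ M)
    (h : ∀ᵐ ξ, act σ₁ (a ξ • w ξ) + act σ₂ (b ξ • w ξ) = gradTerm m z (w ξ)) (p : ℝ × ℝ) :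
    sigmaGrad (expIntegral a b w) p = gradTerm m z (expIntegral a b w p) := by
  have hwa := integrable_coeff_smul ha hw fun ξ h => (hM ξ h).1
  have hwb := integrable_coeff_smul hb hw fun ξ h => (hM ξ h).2
  have hMa : ∀ ξ, a ξ • w ξ ≠ 0 → ‖a ξ‖ ≤ M ∧ ‖b ξ‖ ≤ M := fun ξ h => hM ξ (right_ne_zero_of_smul h)
  have hMb : ∀ ξ, b ξ • w ξ ≠ 0 → ‖a ξ‖ ≤ M ∧ ‖b ξ‖ ≤ M := fun ξ h => hM ξ (right_ne_zero_of_smul h)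
  have ia := integrable_expIntegrand ha hb hwa hMa p
  have ib := integrable_expIntegrand ha hb hwb hMb p
  rw [sigmaGrad, (hasFDerivAt_expIntegral ha hb hw hM p).fderiv, pairDeriv_apply, pairDeriv_apply]
  simp only [one_smul, zero_smul, add_zero, zero_add]
  simp only [expIntegral]
  rw [← (act σ₁).integral_comp_comm ia, ← (act σ₂).integral_comp_comm ib,
    ← (gradTerm m z).integral_comp_comm (integrable_expIntegrand ha hb hw hM p),
    ← integral_add ((act σ₁).integrable_comp ia) ((act σ₂).integrable_comp ib)]
  refine integral_congr_ae (h.mono fun ξ hξ => ?_)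
  beta_reduce
  rw [(act σ₁).map_smul, (act σ₂).map_smul, ← smul_add, hξ, map_smul]

end ExpIntegral

/-! ### Weak derivatives as limits -/

theorem tendsto_eLpNorm_of_dominated {X : Type*} [MeasurableSpace X] {μ : Measure X}
    {E E' : Type*} [NormedAddCommGroup E] [NormedAddCommGroup E'] {h : ℕ → X → E} {G : X → E'}
    {C : ℝ} (hm : ∀ n, AEStronglyMeasurable (h n) μ) (hG : MemLp G 2 μ)
    (hb : ∀ n, ∀ᵐ x ∂μ, ‖h n x‖ ≤ C * ‖G x‖)
    (hl : ∀ᵐ x ∂μ, Tendsto (fun n => h n x) atTop (𝓝 0)) :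
    Tendsto (fun n => eLpNorm (h n) 2 μ) atTop (𝓝 0) := by
  refine tendsto_zero_of_sq ?_
  simp_rw [eLpNorm_two_sq]
  have key := tendsto_lintegral_of_dominated_convergence' (μ := μ)
    (F := fun n x => ‖h n x‖ₑ ^ 2) (f := fun _ => 0)
    (fun x => ENNReal.ofReal C ^ 2 * ‖G x‖ₑ ^ 2) (fun n => (hm n).enorm.pow_const 2)
    (fun n => ?_) ?_ ?_
  · simpa using key
  · filter_upwards [hb n] with x hx
    rw [← mul_pow]
    gcongr
    rw [← ofReal_norm, ← ofReal_norm, ← ENNReal.ofReal_mul' (norm_nonneg _)]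
    exact ENNReal.ofReal_le_ofReal hx
  · rw [lintegral_const_mul' _ _ (by simp), ← eLpNorm_two_sq]
    exact ENNReal.mul_ne_top (by simp) (ENNReal.pow_ne_top hG.2.ne)
  · filter_upwards [hl] with x hx
    have := ((ENNReal.continuous_pow 2).tendsto 0).comp (tendsto_zero_iff_enorm_tendsto_zero.1 hx)
    simpa [Function.comp_def] using this

/-- Integration by parts on the whole plane; the test function is supported in `Ω`, so no boundary
term appears. -/
theorem isWeakSigmaGrad_schwartz {Ω : Set (ℝ × ℝ)} (u : 𝓢(ℝ × ℝ, Spinor)) :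
    IsWeakSigmaGrad Ω u (sigmaGrad u) := by
  intro φ hφ hs ht
  have hd : Differentiable ℝ u := u.differentiable
  have hφd : Differentiable ℝ φ := hφ.differentiable (by simp)
  have hφ' : Continuous (fderiv ℝ φ) := hφ.continuous_fderiv (by simp)
  have hu' : Continuous (fderiv ℝ u) := (u.smooth 1).continuous_fderiv (by simp)
  have zero : ∀ p ∉ Ω, p ∉ tsupport φ := fun p hp h => hp (ht h)
  have e1 : ∫ p in Ω, (fderiv ℝ φ p (1, 0) • act σ₁ (u p) + fderiv ℝ φ p (0, 1) • act σ₂ (u p)) =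
      ∫ p, (fderiv ℝ φ p (1, 0) • act σ₁ (u p) + fderiv ℝ φ p (0, 1) • act σ₂ (u p)) := by
    refine setIntegral_eq_integral_of_forall_compl_eq_zero fun p hp => ?_
    rw [image_eq_zero_of_notMem_tsupport fun h => zero p hp (tsupport_fderiv_subset ℝ h)]
    simp
  have e2 : ∫ p in Ω, φ p • sigmaGrad u p = ∫ p, φ p • sigmaGrad u p := by
    refine setIntegral_eq_integral_of_forall_compl_eq_zero fun p hp => ?_
    rw [image_eq_zero_of_notMem_tsupport (zero p hp), zero_smul]
  have ibp : ∀ (M : Spinor →L[ℂ] Spinor) (v : ℝ × ℝ),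
      Integrable (fun p => fderiv ℝ φ p v • M (u p)) ∧
      Integrable (fun p => φ p • M (fderiv ℝ u p v)) ∧
      ∫ p, φ p • M (fderiv ℝ u p v) = -∫ p, fderiv ℝ φ p v • M (u p) := fun M v => by
    have hM : ∀ p, fderiv ℝ (fun p => M (u p)) p = (M.restrictScalars ℝ).comp (fderiv ℝ u p) :=
      fun p => ((M.restrictScalars ℝ).hasFDerivAt.comp p (hd p).hasFDerivAt).fderiv
    have i1 : Integrable (fun p => fderiv ℝ φ p v • M (u p)) :=
      ((hφ'.clm_apply continuous_const).smul
        (M.continuous.comp u.continuous)).integrable_of_hasCompactSupport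
        ((hs.fderiv_apply ℝ v).smul_right)
    have i2 : Integrable (fun p => φ p • M (fderiv ℝ u p v)) :=
      (hφ.continuous.smul
        (M.continuous.comp (hu'.clm_apply continuous_const))).integrable_of_hasCompactSupport
        hs.smul_right
    have i3 : Integrable (fun p => φ p • M (u p)) :=
      (hφ.continuous.smul (M.continuous.comp u.continuous)).integrable_of_hasCompactSupport
        hs.smul_right
    refine ⟨i1, i2, ?_⟩
    have := integral_smul_fderiv_eq_neg_fderiv_smul_of_integrable (μ := (volume : Measure (ℝ × ℝ)))
      (f := φ) (g := fun p => M (u p)) (v := v) i1 (by simpa [hM] using i2) i3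
      (fun p _ => hφd p) (fun p _ => (M.restrictScalars ℝ).differentiableAt.comp p (hd p))
    simpa [hM] using this
  obtain ⟨a1, b1, c1⟩ := ibp (act σ₁) (1, 0)
  obtain ⟨a2, b2, c2⟩ := ibp (act σ₂) (0, 1)
  rw [e1, e2, integral_add a1 a2]
  simp only [sigmaGrad, smul_add]
  rw [integral_add b1 b2, c1, c2]
  abel

theorem tendsto_integral_smul {μ : Measure (ℝ × ℝ)} {φ : ℝ × ℝ → ℝ} (hφ : MemLp φ 2 μ)
    {h : ℕ → ℝ × ℝ → Spinor} (hm : ∀ n, AEStronglyMeasurable (h n) μ)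
    (h0 : Tendsto (fun n => eLpNorm (h n) 2 μ) atTop (𝓝 0)) :
    Tendsto (fun n => ∫ p, φ p • h n p ∂μ) atTop (𝓝 0) := by
  have up : Tendsto (fun n => eLpNorm φ 2 μ * eLpNorm (h n) 2 μ) atTop (𝓝 0) := by
    simpa using ENNReal.Tendsto.const_mul h0 (Or.inr hφ.2.ne)
  have bd : ∀ n, eLpNorm (φ • h n) 1 μ ≤ eLpNorm φ 2 μ * eLpNorm (h n) 2 μ := fun n =>
    eLpNorm_smul_le_mul_eLpNorm (hm n) hφ.1
  rw [tendsto_zero_iff_enorm_tendsto_zero]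
  refine tendsto_of_tendsto_of_tendsto_of_le_of_le tendsto_const_nhds up (fun n => bot_le)
    (fun n => (enorm_integral_le_lintegral_enorm _).trans ?_)
  have := bd n
  rwa [eLpNorm_one_eq_lintegral_enorm] at this

/-- The weak gradient is a closed operator: both sides of the defining identity are continuous for
`L²` convergence. -/
theorem isWeakSigmaGrad_of_tendsto {Ω : Set (ℝ × ℝ)} {f g : ℝ × ℝ → Spinor}
    (hf : MemLp f 2 (volume.restrict Ω)) (hg : MemLp g 2 (volume.restrict Ω))
    {u : ℕ → 𝓢(ℝ × ℝ, Spinor)}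
    (h1 : Tendsto (fun n => eLpNorm (fun p => u n p - f p) 2 (volume.restrict Ω)) atTop (𝓝 0))
    (h2 : Tendsto (fun n => eLpNorm (fun p => sigmaGrad (u n) p - g p) 2 (volume.restrict Ω))
      atTop (𝓝 0)) : IsWeakSigmaGrad Ω f g := by
  intro φ hφ hs ht
  have hφ' : Continuous (fderiv ℝ φ) := hφ.continuous_fderiv (by simp)
  have hum : ∀ n, MemLp (u n) 2 (volume.restrict Ω) := fun n => ((u n).memLp 2 volume).restrict _
  have md : ∀ v : ℝ × ℝ, MemLp (fun p => fderiv ℝ φ p v) 2 (volume.restrict Ω) := fun v =>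
    ((hφ'.clm_apply continuous_const).memLp_of_hasCompactSupport (μ := volume)
      (hs.fderiv_apply ℝ v)).restrict Ω
  have mφ : MemLp φ 2 (volume.restrict Ω) :=
    (hφ.continuous.memLp_of_hasCompactSupport (μ := volume) hs).restrict Ω
  have key : ∀ (M : Spinor →L[ℂ] Spinor) (v : ℝ × ℝ),
      Tendsto (fun n => ∫ p in Ω, fderiv ℝ φ p v • (M (u n p) - M (f p))) atTop (𝓝 0) :=
    fun M v => by
      refine tendsto_integral_smul (md v) (fun n => ?_) ?_
      · exact (M.comp_memLp' (hum n)).1.sub (M.comp_memLp' hf).1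
      · simpa only [map_sub] using tendsto_eLpNorm_clm M h1
  have i1 : ∀ n, Integrable (fun p => fderiv ℝ φ p (1, 0) • act σ₁ (u n p) +
      fderiv ℝ φ p (0, 1) • act σ₂ (u n p)) (volume.restrict Ω) := fun n =>
    integrable_weak (hum n) hφ hs
  have i2 := integrable_weak hf hφ hs
  have i3 : ∀ n, Integrable (fun p => φ p • sigmaGrad (u n) p) (volume.restrict Ω) := fun n =>
    ((hφ.continuous.smul (continuous_sigmaGrad (u n))).integrable_of_hasCompactSupport
      hs.smul_right).restrict
  have i4 := integrable_test hg hφ.continuous hs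
  have L1 : Tendsto (fun n => ∫ p in Ω, (fderiv ℝ φ p (1, 0) • act σ₁ (u n p) +
      fderiv ℝ φ p (0, 1) • act σ₂ (u n p))) atTop (𝓝 (∫ p in Ω, (fderiv ℝ φ p (1, 0) •
        act σ₁ (f p) + fderiv ℝ φ p (0, 1) • act σ₂ (f p)))) := by
    rw [tendsto_iff_norm_sub_tendsto_zero, ← tendsto_zero_iff_norm_tendsto_zero]
    have := (key (act σ₁) (1, 0)).add (key (act σ₂) (0, 1))
    rw [add_zero] at this
    refine this.congr fun n => ?_
    have m1 := ((act σ₁).comp_memLp' (hum n)).sub ((act σ₁).comp_memLp' hf)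
    have m2 := ((act σ₂).comp_memLp' (hum n)).sub ((act σ₂).comp_memLp' hf)
    rw [← integral_sub (i1 n) i2]
    refine (integral_add (memLp_one_iff_integrable.1 (m1.smul (md (1, 0))))
      (memLp_one_iff_integrable.1 (m2.smul (md (0, 1))))).symm.trans ?_
    congr 1
    ext1 p
    simp only [Pi.smul_apply', Pi.sub_apply, smul_sub, Function.comp_apply]
    abel
  have L2 : Tendsto (fun n => -∫ p in Ω, φ p • sigmaGrad (u n) p) atTop
      (𝓝 (-∫ p in Ω, φ p • g p)) := by
    refine Tendsto.neg ?_
    rw [tendsto_iff_norm_sub_tendsto_zero, ← tendsto_zero_iff_norm_tendsto_zero]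
    refine (tendsto_integral_smul mφ (fun n =>
      (continuous_sigmaGrad (u n)).aestronglyMeasurable.sub hg.1) h2).congr fun n => ?_
    rw [← integral_sub (i3 n) i4]
    refine integral_congr_ae (Eventually.of_forall fun p => ?_)
    exact smul_sub _ _ _
  refine tendsto_nhds_unique L1 (L2.congr fun n => ?_)
  exact (isWeakSigmaGrad_schwartz (u n) φ hφ hs ht).symm

/-! ### The inverse Fourier transform on `L¹ ∩ L²` -/

theorem coeFn_fourierInv_toLp {f : ℝ → Spinor} (hf : Integrable f) (hf2 : MemLp f 2) :
    (𝓕⁻ (hf2.toLp f) : Lp Spinor 2 (volume : Measure ℝ)) =ᵐ[volume] 𝓕⁻ f := by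
  have hc : Continuous (𝓕 f) :=
    VectorFourier.fourierIntegral_continuous Real.continuous_fourierChar
      (innerSL ℝ).continuous₂ hf
  have hinv : 𝓕⁻ f = fun y => 𝓕 f (-y) := by
    ext1 y; exact Real.fourierInv_eq_fourier_neg f y
  refine ae_eq_of_forall_schwartz_smul ((Lp.memLp _).locallyIntegrable (by norm_num))
    ?_ fun φ => ?_
  · rw [hinv]
    exact (hc.comp continuous_neg).locallyIntegrable
  · rw [← Lp.toTemperedDistribution_apply, ← Lp.fourierInv_toTemperedDistribution_eq,
      TemperedDistribution.fourierInv_apply, Lp.toTemperedDistribution_apply]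
    have e1 : ∫ x, φ x • 𝓕⁻ f x = ∫ x, φ (-x) • 𝓕 f x := by
      simpa [hinv] using integral_neg_eq_self (fun x => φ (-x) • 𝓕 f x) volume
    rw [e1]
    have h2 := VectorFourier.integral_fourierIntegral_smul_eq_flip (L := innerₗ ℝ)
      (μ := (volume : Measure ℝ)) (ν := (volume : Measure ℝ)) (f := fun x : ℝ => φ (-x)) (g := f)
      Real.continuous_fourierChar continuous_inner φ.integrable.comp_neg hf
    rw [flip_innerₗ] at h2
    refine Eq.trans ?_ h2
    refine integral_congr_ae ?_
    filter_upwards [hf2.coeFn_toLp] with x hx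
    rw [hx, SchwartzMap.fourierInv_coe, Real.fourierInv_eq_fourier_comp_neg]
    rfl

/-- `𝓕⁻ D` need not be integrable, so Plancherel is applied to the difference inside `L²` and the
integrals are identified term by term. -/
theorem eLpNorm_fourier_sub {v D : ℝ → Spinor} (hv : Integrable v) (hv2 : MemLp v 2)
    (hD : Integrable D) (hD2 : MemLp D 2) :
    eLpNorm (fun ξ => 𝓕 v ξ - D ξ) 2 volume = eLpNorm (fun y => v y - 𝓕⁻ D y) 2 volume := by
  have e : 𝓕 (hv2.toLp v) - hD2.toLp D = 𝓕 (hv2.toLp v - 𝓕⁻ (hD2.toLp D)) := by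
    have := (Lp.fourierTransformₗᵢ ℝ Spinor).map_sub (hv2.toLp v) (𝓕⁻ (hD2.toLp D))
    refine Eq.trans ?_ this.symm
    congr 1
    exact ((Lp.fourierTransformₗᵢ ℝ Spinor).apply_symm_apply (hD2.toLp D)).symm
  have h1 : eLpNorm (fun ξ => 𝓕 v ξ - D ξ) 2 volume = ‖𝓕 (hv2.toLp v) - hD2.toLp D‖ₑ := by
    rw [Lp.enorm_def]
    refine eLpNorm_congr_ae ?_
    filter_upwards [Lp.coeFn_sub (𝓕 (hv2.toLp v)) (hD2.toLp D), coeFn_fourier_toLp hv hv2,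
      hD2.coeFn_toLp] with ξ a b c
    rw [a, Pi.sub_apply, b, c]
  have h2 : eLpNorm (fun y => v y - 𝓕⁻ D y) 2 volume = ‖hv2.toLp v - 𝓕⁻ (hD2.toLp D)‖ₑ := by
    rw [Lp.enorm_def]
    refine eLpNorm_congr_ae ?_
    filter_upwards [Lp.coeFn_sub (hv2.toLp v) (𝓕⁻ (hD2.toLp D)), coeFn_fourierInv_toLp hD hD2,
      hv2.coeFn_toLp] with ξ a b c
    rw [a, Pi.sub_apply, b, c]
  rw [h1, h2, e, ← ofReal_norm, ← ofReal_norm, Lp.norm_fourier_eq]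

/-! ### Cutoff functions -/

theorem exists_cutoff : ∃ χ : ℝ × ℝ → ℝ, ContDiff ℝ ∞ χ ∧ HasCompactSupport χ ∧
    (∀ p, χ p ∈ Set.Icc (0 : ℝ) 1) ∧ ∀ p ∈ Metric.ball (0 : ℝ × ℝ) 1, χ p = 1 := by
  let f : ContDiffBump (0 : ℝ × ℝ) := ⟨1, 2, one_pos, one_lt_two⟩
  exact ⟨f, f.contDiff, f.hasCompactSupport, fun p => ⟨f.nonneg, f.le_one⟩,
    fun p hp => f.one_of_mem_closedBall (Metric.ball_subset_closedBall hp)⟩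

/-- The rescaled function `p ↦ χ(p / (n + 1))`. -/
def rescale (χ : ℝ × ℝ → ℝ) (n : ℕ) (p : ℝ × ℝ) : ℝ := χ (((n : ℝ) + 1)⁻¹ • p)

section Rescale

variable {χ : ℝ × ℝ → ℝ}

theorem contDiff_rescale (hχ : ContDiff ℝ ∞ χ) (n : ℕ) : ContDiff ℝ ∞ (rescale χ n) :=
  hχ.comp (contDiff_const_smul _)

theorem hasCompactSupport_rescale (hs : HasCompactSupport χ) (n : ℕ) :
    HasCompactSupport (rescale χ n) :=
  hs.comp_smul (by positivity)

theorem tendsto_inv_smul (p : ℝ × ℝ) :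
    Tendsto (fun n : ℕ => ((n : ℝ) + 1)⁻¹ • p) atTop (𝓝 0) := by
  have : Tendsto (fun n : ℕ => ((n : ℝ) + 1)⁻¹) atTop (𝓝 0) := by
    simpa using tendsto_one_div_add_atTop_nhds_zero_nat (𝕜 := ℝ)
  simpa using this.smul_const p

theorem eventually_rescale_eq_one (h1 : ∀ p ∈ Metric.ball (0 : ℝ × ℝ) 1, χ p = 1) (p : ℝ × ℝ) :
    ∀ᶠ n in atTop, rescale χ n p = 1 :=
  ((tendsto_inv_smul p).eventually (Metric.ball_mem_nhds 0 one_pos)).mono fun _ hn => h1 _ hn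

theorem fderiv_rescale (hχ : ContDiff ℝ ∞ χ) (n : ℕ) (p : ℝ × ℝ) :
    fderiv ℝ (rescale χ n) p = ((n : ℝ) + 1)⁻¹ • fderiv ℝ χ (((n : ℝ) + 1)⁻¹ • p) := by
  have h1 := ((hχ.differentiable (by simp)) (((n : ℝ) + 1)⁻¹ • p)).hasFDerivAt
  have h2 : HasFDerivAt (fun p : ℝ × ℝ => ((n : ℝ) + 1)⁻¹ • p)
      (((n : ℝ) + 1)⁻¹ • ContinuousLinearMap.id ℝ (ℝ × ℝ)) p :=
    (hasFDerivAt_id p).fun_const_smul _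
  have := (h1.comp p h2).fderiv
  refine this.trans ?_
  ext <;> simp

theorem exists_norm_fderiv_rescale_le (hχ : ContDiff ℝ ∞ χ) (hs : HasCompactSupport χ) :
    ∃ C : ℝ, 0 ≤ C ∧ ∀ n p v, |fderiv ℝ (rescale χ n) p v| ≤ ((n : ℝ) + 1)⁻¹ * C * ‖v‖ := by
  obtain ⟨C, hC⟩ := (hs.fderiv ℝ).exists_bound_of_continuous (hχ.continuous_fderiv (by simp))
  refine ⟨C, (norm_nonneg _).trans (hC 0), fun n p v => ?_⟩
  rw [fderiv_rescale hχ, smul_apply, smul_eq_mul, abs_mul, abs_of_pos (by positivity), mul_assoc]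
  refine mul_le_mul_of_nonneg_left ?_ (by positivity)
  exact ((fderiv ℝ χ _).le_opNorm v).trans (mul_le_mul_of_nonneg_right (hC _) (norm_nonneg _))

end Rescale

theorem sigmaGrad_smul_fun {χ : ℝ × ℝ → ℝ} {v : ℝ × ℝ → Spinor} {p : ℝ × ℝ}
    (hχ : DifferentiableAt ℝ χ p) (hv : DifferentiableAt ℝ v p) :
    sigmaGrad (fun q => χ q • v q) p = χ p • sigmaGrad v p +
      (fderiv ℝ χ p (1, 0) • act σ₁ (v p) + fderiv ℝ χ p (0, 1) • act σ₂ (v p)) := by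
  have h : fderiv ℝ (fun q => χ q • v q) p = χ p • fderiv ℝ v p + (fderiv ℝ χ p).smulRight (v p) :=
    (hχ.hasFDerivAt.smul hv.hasFDerivAt).fderiv
  have r : ∀ (M : Spinor →L[ℂ] Spinor) (a : ℝ) (w : Spinor), M (a • w) = a • M w :=
    fun M a w => map_real_smul M.toLinearMap.toAddMonoidHom M.continuous a w
  simp only [sigmaGrad, h, add_apply, smul_apply, ContinuousLinearMap.smulRight_apply, map_add, r,
    smul_add]
  abel

/-- Cutting off a smooth solution. -/
theorem exists_schwartz_approx {μ : Measure (ℝ × ℝ)} {m z : ℝ} {v : ℝ × ℝ → Spinor}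
    (hv : ContDiff ℝ ∞ v) (hg : ∀ p, sigmaGrad v p = gradTerm m z (v p)) (hv2 : MemLp v 2 μ)
    (hv0 : MemLp (fun y => v (0, y)) 2 volume) {ε : ℝ≥0∞} (hε : 0 < ε) :
    ∃ u : 𝓢(ℝ × ℝ, Spinor), HasCompactSupport u ∧
      eLpNorm (fun p => u p - v p) 2 μ ≤ ε ∧
      eLpNorm (fun p => sigmaGrad u p - gradTerm m z (v p)) 2 μ ≤ ε ∧
      eLpNorm (fun y => lineRestrict u y - v (0, y)) 2 volume ≤ ε := by
  obtain ⟨χ, hχ, hs, h01, h1⟩ := exists_cutoff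
  obtain ⟨C, hC0, hC⟩ := exists_norm_fderiv_rescale_le hχ hs
  have hr : ∀ n, ContDiff ℝ ∞ (rescale χ n) := contDiff_rescale hχ
  have hrs := hasCompactSupport_rescale hs
  have hr01 : ∀ n p, |rescale χ n p - 1| ≤ 1 := fun n p => by
    have := h01 (((n : ℝ) + 1)⁻¹ • p)
    rw [abs_le]
    exact ⟨by simpa [rescale] using this.1, by linarith [this.2, show rescale χ n p ≤ 1 from this.2]⟩
  have hvd : Differentiable ℝ v := hv.differentiable (by simp)
  have hsm : ∀ n, ContDiff ℝ ∞ fun p => rescale χ n p • v p := fun n => (hr n).smul hv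
  have hcs : ∀ n, HasCompactSupport fun p => rescale χ n p • v p := fun n => (hrs n).smul_right
  set u : ℕ → 𝓢(ℝ × ℝ, Spinor) := fun n => (hcs n).toSchwartzMap (hsm n) with hu
  have hu_coe : ∀ n, (u n : ℝ × ℝ → Spinor) = fun p => rescale χ n p • v p := fun n => rfl
  have hsub : ∀ n p, u n p - v p = (rescale χ n p - 1) • v p := fun n p => by
    rw [sub_smul, one_smul]; rfl
  have lim0 : ∀ p, Tendsto (fun n => u n p - v p) atTop (𝓝 0) := fun p =>
    tendsto_const_nhds.congr' <| (eventually_rescale_eq_one h1 p).mono fun n hn => by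
      beta_reduce; rw [hsub, hn, sub_self, zero_smul]
  have bd0 : ∀ n p, ‖u n p - v p‖ ≤ 1 * ‖v p‖ := fun n p => by
    rw [hsub, norm_smul]
    exact mul_le_mul_of_nonneg_right (hr01 n p) (norm_nonneg _)
  have L1 : Tendsto (fun n => eLpNorm (fun p => u n p - v p) 2 μ) atTop (𝓝 0) :=
    tendsto_eLpNorm_of_dominated
      (fun n => ((u n).continuous.sub hv.continuous).aestronglyMeasurable) hv2
      (fun n => Eventually.of_forall (bd0 n)) (Eventually.of_forall lim0)
  have L3 : Tendsto (fun n => eLpNorm (fun y => lineRestrict (u n) y - v (0, y)) 2 volume) atTop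
      (𝓝 0) :=
    tendsto_eLpNorm_of_dominated
      (fun n => ((lineRestrict (u n)).continuous.sub
        (hv.continuous.comp (by fun_prop : Continuous fun y : ℝ => ((0 : ℝ), y)))).aestronglyMeasurable)
      hv0 (fun n => Eventually.of_forall fun y => bd0 n (0, y))
      (Eventually.of_forall fun y => lim0 (0, y))
  -- The error splits into the cut-off tail of the equation and the commutator of `σ · ∇` with the
  -- cutoff, which is of size `1 / (n + 1)`.
  have hgr : ∀ n p, sigmaGrad (u n) p - gradTerm m z (v p) =
      (rescale χ n p - 1) • gradTerm m z (v p) + (fderiv ℝ (rescale χ n) p (1, 0) • act σ₁ (v p) +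
        fderiv ℝ (rescale χ n) p (0, 1) • act σ₂ (v p)) := fun n p => by
    rw [hu_coe, sigmaGrad_smul_fun (((hr n).differentiable (by simp)) p) (hvd p), hg, sub_smul,
      one_smul]
    abel
  have e1 : ‖((1 : ℝ), (0 : ℝ))‖ = 1 := by simp [Prod.norm_def]
  have e2 : ‖((0 : ℝ), (1 : ℝ))‖ = 1 := by simp [Prod.norm_def]
  have L2 : Tendsto (fun n => eLpNorm (fun p => sigmaGrad (u n) p - gradTerm m z (v p)) 2 μ) atTop
      (𝓝 0) := by
    refine tendsto_eLpNorm_of_dominated (C := ‖gradTerm m z‖ + (C * ‖act σ₁‖ + C * ‖act σ₂‖))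
      (fun n => ?_) hv2 (fun n => Eventually.of_forall fun p => ?_)
      (Eventually.of_forall fun p => ?_)
    · exact ((continuous_sigmaGrad (u n)).sub
        ((gradTerm m z).continuous.comp hv.continuous)).aestronglyMeasurable
    · rw [hgr, add_mul, add_mul]
      have hinv : ((n : ℝ) + 1)⁻¹ ≤ 1 := inv_le_one_of_one_le₀ (by simp)
      have hd : ∀ w : ℝ × ℝ, ‖w‖ = 1 → |fderiv ℝ (rescale χ n) p w| ≤ C := fun w hw => by
        refine (hC n p w).trans ?_
        rw [hw, mul_one]
        exact mul_le_of_le_one_left hC0 hinv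
      refine (norm_add_le _ _).trans (add_le_add ?_ ((norm_add_le _ _).trans (add_le_add ?_ ?_)))
      · rw [norm_smul]
        exact (mul_le_of_le_one_left (norm_nonneg _) (hr01 n p)).trans ((gradTerm m z).le_opNorm _)
      · rw [norm_smul, mul_assoc]
        exact mul_le_mul (hd _ e1) ((act σ₁).le_opNorm _) (norm_nonneg _) hC0
      · rw [norm_smul, mul_assoc]
        exact mul_le_mul (hd _ e2) ((act σ₂).le_opNorm _) (norm_nonneg _) hC0
    · have t : Tendsto (fun n : ℕ => ((n : ℝ) + 1)⁻¹ * C * 1) atTop (𝓝 0) := by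
        have := (tendsto_one_div_add_atTop_nhds_zero_nat (𝕜 := ℝ)).mul_const (C * 1)
        simpa [mul_assoc] using this
      have hd : ∀ w : ℝ × ℝ, ‖w‖ = 1 →
          Tendsto (fun n => fderiv ℝ (rescale χ n) p w) atTop (𝓝 0) := fun w hw =>
        squeeze_zero_norm (fun n => by
          have := hC n p w
          rwa [hw] at this) t
      have a1 : Tendsto (fun n => (rescale χ n p - 1) • gradTerm m z (v p)) atTop (𝓝 0) :=
        tendsto_const_nhds.congr' <| (eventually_rescale_eq_one h1 p).mono fun n hn => by
          beta_reduce; rw [hn, sub_self, zero_smul]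
      have := a1.add (((hd _ e1).smul_const (act σ₁ (v p))).add
        ((hd _ e2).smul_const (act σ₂ (v p))))
      simp only [zero_smul, add_zero] at this
      exact this.congr fun n => (hgr n p).symm
  have ev := (L1.eventually (Iic_mem_nhds hε)).and
    ((L2.eventually (Iic_mem_nhds hε)).and (L3.eventually (Iic_mem_nhds hε)))
  obtain ⟨n, a, b, c⟩ := ev.exists
  exact ⟨u n, hcs n, a, b, c⟩

/-! ### Solutions on a half-plane with prescribed traces -/

/-- The truncation of a function to the interval `[-N, N]`. -/
def truncate (N : ℕ) (α : ℝ → Spinor) : ℝ → Spinor := (Set.Icc (-(N : ℝ)) N).indicator α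

theorem stronglyMeasurable_truncate (N : ℕ) {α : ℝ → Spinor} (hα : StronglyMeasurable α) :
    StronglyMeasurable (truncate N α) := hα.indicator measurableSet_Icc

theorem memLp_truncate (N : ℕ) {α : ℝ → Spinor} (h2 : MemLp α 2) : MemLp (truncate N α) 2 :=
  h2.indicator measurableSet_Icc

theorem norm_truncate_le (N : ℕ) (α : ℝ → Spinor) (ξ : ℝ) : ‖truncate N α ξ‖ ≤ ‖α ξ‖ :=
  norm_indicator_le_norm_self _ _

theorem mem_of_truncate_ne_zero {N : ℕ} {α : ℝ → Spinor} {ξ : ℝ} (h : truncate N α ξ ≠ 0) :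
    ξ ∈ Set.Icc (-(N : ℝ)) N := Set.mem_of_indicator_ne_zero h

theorem truncate_eq_or (N : ℕ) (α : ℝ → Spinor) (ξ : ℝ) :
    truncate N α ξ = α ξ ∨ truncate N α ξ = 0 := by
  by_cases h : ξ ∈ Set.Icc (-(N : ℝ)) N
  · exact Or.inl (Set.indicator_of_mem h _)
  · exact Or.inr (Set.indicator_of_notMem h _)

theorem tendsto_eLpNorm_truncate_sub {α : ℝ → Spinor} (h2 : MemLp α 2) :
    Tendsto (fun N => eLpNorm (fun ξ => truncate N α ξ - α ξ) 2 volume) atTop (𝓝 0) := by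
  refine tendsto_eLpNorm_of_dominated (C := 2) (fun N => ((memLp_truncate N h2).sub h2).1) h2
    (fun N => Eventually.of_forall fun ξ => ?_) (Eventually.of_forall fun ξ => ?_)
  · rw [two_mul]
    exact (norm_sub_le _ _).trans (add_le_add_left (norm_truncate_le N α ξ) _)
  · obtain ⟨N, hN⟩ := exists_nat_ge |ξ|
    refine tendsto_const_nhds.congr' ((eventually_ge_atTop N).mono fun n hn => ?_)
    have h : ξ ∈ Set.Icc (-(n : ℝ)) n := abs_le.1 (hN.trans (by exact_mod_cast hn))
    beta_reduce
    rw [truncate, Set.indicator_of_mem h, sub_self]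

theorem norm_unweight_truncate_le (N : ℕ) (α : ℝ → Spinor) :
    ∃ C : ℝ, ∀ ξ, ‖unweight (truncate N α) ξ‖ ≤ C * ‖truncate N α ξ‖ := by
  obtain ⟨C, hC⟩ := (isCompact_Icc (a := -(N : ℝ)) (b := N)).exists_bound_of_continuousOn
    (continuous_besselWeight (1 / 2)).continuousOn
  refine ⟨C, fun ξ => ?_⟩
  by_cases h : truncate N α ξ = 0
  · simp [unweight, h]
  · rw [unweight, norm_smul]
    exact mul_le_mul_of_nonneg_right (hC ξ (mem_of_truncate_ne_zero h)) (norm_nonneg _)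

theorem memLp_unweight_truncate (N : ℕ) {α : ℝ → Spinor} (hα : StronglyMeasurable α)
    (h2 : MemLp α 2) : MemLp (unweight (truncate N α)) 2 := by
  obtain ⟨C, hC⟩ := norm_unweight_truncate_le N α
  exact (memLp_truncate N h2).of_le_mul
    (stronglyMeasurable_unweight (stronglyMeasurable_truncate N hα)).aestronglyMeasurable
    (Eventually.of_forall hC)

theorem integrable_unweight_truncate (N : ℕ) {α : ℝ → Spinor} (hα : StronglyMeasurable α)
    (h2 : MemLp α 2) : Integrable (unweight (truncate N α)) := by
  have hs : ∀ ξ ∉ Set.Icc (-(N : ℝ)) N, unweight (truncate N α) ξ = 0 := fun ξ hξ => by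
    rw [unweight, truncate, Set.indicator_of_notMem hξ, smul_zero]
  have h := ((memLp_unweight_truncate N hα h2).restrict (Set.Icc (-(N : ℝ)) N)).integrable
    (by norm_num)
  exact (integrableOn_iff_integrable_of_support_subset
    fun ξ hξ => by by_contra h; exact hξ (hs ξ h)).1 h

section Solution

variable {m η z s : ℝ}

theorem ae_symbol_truncate (N : ℕ) {α : ℝ → Spinor} (h : ∀ᵐ ξ : ℝ,
      symbol m z (2 * Real.pi * ξ) (unweight α ξ) =
        ((-(s * kappa m η (2 * Real.pi * ξ)) : ℝ) : ℂ) • unweight α ξ) :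
    ∀ᵐ ξ : ℝ, symbol m z (2 * Real.pi * ξ) (unweight (truncate N α) ξ) =
        ((-(s * kappa m η (2 * Real.pi * ξ)) : ℝ) : ℂ) • unweight (truncate N α) ξ := by
  filter_upwards [h] with ξ hξ
  rcases truncate_eq_or N α ξ with e | e
  · simpa only [unweight, e] using hξ
  · simp [unweight, e]

theorem expIntegral_eq_sliceFourierInv (D : ℝ → Spinor) :
    expIntegral (fun ξ => ((-(s * kappa m η (2 * Real.pi * ξ)) : ℝ) : ℂ))
      (fun ξ => Complex.I * (2 * Real.pi * ξ : ℝ)) D = sliceFourierInv (evolve m η s D) := by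
  ext1 p
  rw [expIntegral, sliceFourierInv, Real.fourierInv_eq']
  refine integral_congr_ae (Eventually.of_forall fun ξ => ?_)
  simp only [evolve, decayExp, RCLike.inner_apply, conj_trivial]
  rw [← Complex.coe_smul, smul_smul, Complex.ofReal_exp, ← Complex.exp_add]
  congr 2
  push_cast
  ring

/-- Bounded frequencies bound the exponents, so the integral is smooth on the whole plane, the line
`x = 0` included, and may be differentiated under the integral sign. -/
theorem contDiff_sliceFourierInv_evolve {D : ℝ → Spinor} (hD : Integrable D) {R : ℝ}
    (hR : ∀ ξ, D ξ ≠ 0 → ξ ∈ Set.Icc (-R) R) :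
    ContDiff ℝ ∞ (sliceFourierInv (evolve m η s D)) ∧
    ((∀ᵐ ξ : ℝ, symbol m z (2 * Real.pi * ξ) (D ξ) =
        ((-(s * kappa m η (2 * Real.pi * ξ)) : ℝ) : ℂ) • D ξ) →
      ∀ p, sigmaGrad (sliceFourierInv (evolve m η s D)) p =
        gradTerm m z (sliceFourierInv (evolve m η s D) p)) := by
  have hκ := continuous_kappa m η
  set a : ℝ → ℂ := fun ξ => ((-(s * kappa m η (2 * Real.pi * ξ)) : ℝ) : ℂ) with had
  set b : ℝ → ℂ := fun ξ => Complex.I * (2 * Real.pi * ξ : ℝ) with hbd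
  have ha : Continuous a := by fun_prop
  have hb : Continuous b := by fun_prop
  obtain ⟨A, hA⟩ := isCompact_Icc.exists_bound_of_continuousOn (ha.continuousOn (s := Set.Icc (-R) R))
  obtain ⟨B, hB⟩ := isCompact_Icc.exists_bound_of_continuousOn (hb.continuousOn (s := Set.Icc (-R) R))
  have hM : ∀ ξ, D ξ ≠ 0 → ‖a ξ‖ ≤ max A B ∧ ‖b ξ‖ ≤ max A B := fun ξ hξ =>
    ⟨(hA ξ (hR ξ hξ)).trans (le_max_left _ _), (hB ξ (hR ξ hξ)).trans (le_max_right _ _)⟩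
  rw [← expIntegral_eq_sliceFourierInv]
  refine ⟨contDiff_infty.2 fun n => contDiff_expIntegral ha hb n hD hM, fun h p =>
    sigmaGrad_expIntegral ha hb hD hM ?_ p⟩
  filter_upwards [h] with ξ hξ
  rw [had, hbd]
  beta_reduce
  rw [← hξ]
  exact act_σ₁_add_act_σ₂_of_symbol m z _ _

theorem eLpNorm_sliceFourierInv_evolve (hm : 0 < m) (hη : η ≠ 0) {α : ℝ → Spinor}
    (hα : StronglyMeasurable α) (h2 : MemLp α 2) :
    eLpNorm (sliceFourierInv (evolve m η s (unweight α))) 2 (volume.restrict (halfPlane s)) =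
      eLpNorm (evolve m η s (unweight α)) 2 (volume.restrict (halfPlane s)) := by
  rw [volume_restrict_halfPlane]
  refine eLpNorm_sliceFourierInv
    (stronglyMeasurable_evolve m η s (stronglyMeasurable_unweight hα)) ?_ ?_
  · filter_upwards [ae_mem_halfLine s] with x hx using integrable_evolve_unweight_slice hm hη hx h2
  · filter_upwards [ae_mem_halfLine s] with x hx using memLp_evolve_unweight_slice hm hη hx h2

theorem memLp_sliceFourierInv_evolve (hm : 0 < m) (hη : η ≠ 0) (hs : s ^ 2 = 1) {α : ℝ → Spinor}
    (hα : StronglyMeasurable α) (h2 : MemLp α 2) :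
    MemLp (sliceFourierInv (evolve m η s (unweight α))) 2 (volume.restrict (halfPlane s)) := by
  refine ⟨(stronglyMeasurable_sliceFourierInv (stronglyMeasurable_evolve m η s
    (stronglyMeasurable_unweight hα))).aestronglyMeasurable, ?_⟩
  rw [eLpNorm_sliceFourierInv_evolve hm hη hα h2]
  exact (memLp_evolve_unweight hm hη hs hα h2).2

theorem sliceFourierInv_evolve_sub (hm : 0 < m) (hη : η ≠ 0) {α β : ℝ → Spinor}
    (hα : MemLp α 2) (hβ : MemLp β 2) {p : ℝ × ℝ} (hp : p.1 ∈ halfLine s) :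
    sliceFourierInv (evolve m η s (unweight fun ξ => α ξ - β ξ)) p =
      sliceFourierInv (evolve m η s (unweight α)) p -
        sliceFourierInv (evolve m η s (unweight β)) p := by
  have := fourierInv_fun_sub (integrable_evolve_unweight_slice hm hη hp hα)
    (integrable_evolve_unweight_slice hm hη hp hβ) p.2
  simp only [sliceFourierInv, ← this]
  ext1 ξ
  simp only [evolve, unweight, smul_sub]

/-- The map from `α` to the solution is linear and bounded from `L²(ℝ)` to `L²` of the half-plane.
-/
theorem tendsto_sliceFourierInv_evolve_truncate (hm : 0 < m) (hη : η ≠ 0) (hs : s ^ 2 = 1)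
    {α : ℝ → Spinor} (hα : StronglyMeasurable α) (h2 : MemLp α 2) :
    Tendsto (fun N => eLpNorm (fun p => sliceFourierInv (evolve m η s (unweight (truncate N α))) p -
      sliceFourierInv (evolve m η s (unweight α)) p) 2 (volume.restrict (halfPlane s)))
      atTop (𝓝 0) := by
  obtain ⟨C, hC⟩ := exists_eLpNorm_evolve_unweight_le hm hη hs
  refine tendsto_zero_of_sq ?_
  have h0 := ((ENNReal.continuous_pow 2).tendsto 0).comp (tendsto_eLpNorm_truncate_sub h2)
  have h1 := ENNReal.Tendsto.const_mul (a := ENNReal.ofReal C) h0 (Or.inr ENNReal.ofReal_ne_top)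
  simp only [ne_eq, OfNat.ofNat_ne_zero, not_false_eq_true, zero_pow, mul_zero] at h1
  refine tendsto_of_tendsto_of_tendsto_of_le_of_le tendsto_const_nhds h1 (fun N => bot_le)
    fun N => ?_
  have hm' : StronglyMeasurable fun ξ => truncate N α ξ - α ξ :=
    (stronglyMeasurable_truncate N hα).sub hα
  have hl : MemLp (fun ξ => truncate N α ξ - α ξ) 2 := (memLp_truncate N h2).sub h2
  refine le_trans (le_of_eq ?_) (hC _ hm')
  beta_reduce
  rw [← eLpNorm_sliceFourierInv_evolve hm hη hm' hl]
  congr 1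
  refine eLpNorm_congr_ae ((ae_halfPlane_mem s).mono fun p hp => ?_)
  exact (sliceFourierInv_evolve_sub hm hη (memLp_truncate N h2) h2 hp).symm

theorem besselWeight_neg_half_le (ξ : ℝ) : besselWeight (-1 / 2) ξ ≤ 1 :=
  Real.rpow_le_one_of_one_le_of_nonpos (by nlinarith [sq_nonneg ξ]) (by norm_num)

theorem besselWeight_neg_smul_unweight (α : ℝ → Spinor) (ξ : ℝ) :
    (besselWeight (-1 / 2) ξ : ℂ) • unweight α ξ = α ξ := by
  rw [unweight, ← Complex.coe_smul (besselWeight (1 / 2) ξ), smul_smul, ← Complex.ofReal_mul,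
    mul_comm, neg_div, besselWeight_mul_neg, Complex.ofReal_one, one_smul]

theorem tendsto_add_of_le {a b c : ℕ → ℝ≥0∞} (h : ∀ n, a n ≤ b n + c n)
    (hb : Tendsto b atTop (𝓝 0)) (hc : Tendsto c atTop (𝓝 0)) : Tendsto a atTop (𝓝 0) :=
  tendsto_of_tendsto_of_tendsto_of_le_of_le tendsto_const_nhds (by simpa using hb.add hc)
    (fun n => bot_le) h

/-- Truncation to frequencies `|ξ| ≤ N` preserves the eigenvalue equation and gives smooth solutions
`v N`. Cutting these off in space gives test functions within `1 / (N + 1)` of them in graph norm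
and on the line. A triangle inequality through `v N` yields the weak equation and the trace at the
same time. -/
theorem halfPlane_existence (hm : 0 < m) (hη : η ≠ 0) (hs : s ^ 2 = 1)
    {α : Lp Spinor 2 (volume : Measure ℝ)} {f : ℝ × ℝ → Spinor}
    (hsym : ∀ᵐ ξ : ℝ, symbol m z (2 * Real.pi * ξ) (unweight α ξ) =
      ((-(s * kappa m η (2 * Real.pi * ξ)) : ℝ) : ℂ) • unweight α ξ)
    (hf : f =ᵐ[volume.restrict (halfPlane s)] sliceFourierInv (evolve m η s (unweight α))) :
    HSigma (halfPlane s) f (fun p => gradTerm m z (f p)) ∧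
    IsDirichletTrace (halfPlane s) f (fun p => gradTerm m z (f p)) (sobolevDist α) := by
  have hα := Lp.stronglyMeasurable α
  have h2 := Lp.memLp α
  set μ := (volume : Measure (ℝ × ℝ)).restrict (halfPlane s) with hμ
  have hfL : MemLp f 2 μ := (memLp_congr_ae hf).2 (memLp_sliceFourierInv_evolve hm hη hs hα h2)
  have hgL : MemLp (fun p => gradTerm m z (f p)) 2 μ := (gradTerm m z).comp_memLp' hfL
  set D : ℕ → ℝ → Spinor := fun N => unweight (truncate N α) with hD
  set v : ℕ → ℝ × ℝ → Spinor := fun N => sliceFourierInv (evolve m η s (D N)) with hv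
  have hDi : ∀ N, Integrable (D N) := fun N => integrable_unweight_truncate N hα h2
  have hD2 : ∀ N, MemLp (D N) 2 := fun N => memLp_unweight_truncate N hα h2
  have hDs : ∀ N ξ, D N ξ ≠ 0 → ξ ∈ Set.Icc (-(N : ℝ)) N := fun N ξ h =>
    mem_of_truncate_ne_zero (α := α) fun h0 => h (by simp [hD, unweight, h0])
  have hvc : ∀ N, ContDiff ℝ ∞ (v N) := fun N =>
    -- Smoothness does not involve `z`; any value will do.
    (contDiff_sliceFourierInv_evolve (z := 0) (hDi N) (hDs N)).1
  have hvg : ∀ N p, sigmaGrad (v N) p = gradTerm m z (v N p) := fun N =>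
    (contDiff_sliceFourierInv_evolve (hDi N) (hDs N)).2 (ae_symbol_truncate N hsym)
  have hv2 : ∀ N, MemLp (v N) 2 μ := fun N =>
    memLp_sliceFourierInv_evolve hm hη hs (stronglyMeasurable_truncate N hα) (memLp_truncate N h2)
  -- On the line the exponential factor equals `1`.
  have hv0 : ∀ N, (fun y => v N (0, y)) = 𝓕⁻ (D N) := fun N => by
    rw [hv]
    beta_reduce
    rw [sliceFourierInv_slice]
    congr 1
    ext1 ξ
    simp [evolve, decayExp]
  have hv02 : ∀ N, MemLp (fun y => v N (0, y)) 2 volume := fun N => by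
    rw [hv0]
    refine ⟨(memLp_congr_ae (coeFn_fourierInv_toLp (hDi N) (hD2 N))).1 (Lp.memLp _) |>.1, ?_⟩
    rw [eLpNorm_fourierInv (hDi N) (hD2 N)]
    exact (hD2 N).2
  have hε : ∀ N : ℕ, 0 < ((N : ℝ≥0∞) + 1)⁻¹ := fun N => by simp
  have hεlim : Tendsto (fun N : ℕ => ((N : ℝ≥0∞) + 1)⁻¹) atTop (𝓝 0) := by
    have := (tendsto_add_atTop_iff_nat 1).2 ENNReal.tendsto_inv_nat_nhds_zero
    exact_mod_cast this
  choose u hu h1 h3 h4 using fun N =>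
    exists_schwartz_approx (hvc N) (hvg N) (hv2 N) (hv02 N) (hε N)
  have hvf : Tendsto (fun N => eLpNorm (fun p => v N p - f p) 2 μ) atTop (𝓝 0) := by
    refine (tendsto_sliceFourierInv_evolve_truncate hm hη hs hα h2).congr fun N => ?_
    refine eLpNorm_congr_ae (hf.mono fun p hp => ?_)
    beta_reduce
    rw [hp]
  have T1 : Tendsto (fun N => eLpNorm (fun p => u N p - f p) 2 μ) atTop (𝓝 0) := by
    refine tendsto_add_of_le (fun N => ?_) hεlim hvf
    refine le_trans (le_trans (le_of_eq ?_) (eLpNorm_add_le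
      (f := fun p => u N p - v N p) (g := fun p => v N p - f p)
      ((u N).continuous.sub (hvc N).continuous).aestronglyMeasurable ((hv2 N).sub hfL).1
      (by norm_num))) (add_le_add_left (h1 N) _)
    congr 1
    ext1 p
    simp
  have T2 : Tendsto (fun N => eLpNorm (fun p => sigmaGrad (u N) p - gradTerm m z (f p)) 2 μ) atTop
      (𝓝 0) := by
    refine tendsto_add_of_le (fun N => ?_) hεlim (tendsto_eLpNorm_clm (gradTerm m z) hvf)
    refine le_trans (le_trans (le_of_eq ?_) (eLpNorm_add_le
      (f := fun p => sigmaGrad (u N) p - gradTerm m z (v N p))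
      (g := fun p => gradTerm m z (v N p - f p))
      ((continuous_sigmaGrad (u N)).sub
        ((gradTerm m z).continuous.comp (hvc N).continuous)).aestronglyMeasurable
      ((gradTerm m z).comp_memLp' ((hv2 N).sub hfL)).1
      (by norm_num))) (add_le_add_left (h3 N) _)
    congr 1
    ext1 p
    simp
  have T3 : Tendsto (fun N => eLpNorm (fun ξ => (besselWeight (-1 / 2) ξ : ℂ) •
      𝓕 (lineRestrict (u N)) ξ - α ξ) 2 volume) atTop (𝓝 0) := by
    refine tendsto_add_of_le (fun N => ?_) hεlim (tendsto_eLpNorm_truncate_sub h2)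
    have hw : Continuous fun ξ => (besselWeight (-1 / 2) ξ : ℂ) :=
      Complex.continuous_ofReal.comp (continuous_besselWeight _)
    have hm1 : AEStronglyMeasurable (fun ξ => 𝓕 (lineRestrict (u N)) ξ - D N ξ) volume :=
      (𝓕 (lineRestrict (u N))).continuous.aestronglyMeasurable.sub (hD2 N).1
    refine le_trans (le_trans (le_of_eq ?_) (eLpNorm_add_le
      (f := fun ξ => (besselWeight (-1 / 2) ξ : ℂ) • (𝓕 (lineRestrict (u N)) ξ - D N ξ))
      (g := fun ξ => truncate N α ξ - α ξ)
      (hw.aestronglyMeasurable.smul hm1) ((memLp_truncate N h2).sub h2).1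
      (by norm_num))) (add_le_add_left ?_ _)
    · congr 1
      ext1 ξ
      simp only [smul_sub, hD, besselWeight_neg_smul_unweight, Pi.add_apply]
      abel
    -- The weight of order `-1/2` is at most `1`, so closeness in plain `L²` on the line is enough.
    · refine (eLpNorm_mono (g := fun ξ => 𝓕 (lineRestrict (u N)) ξ - D N ξ) fun ξ => ?_).trans ?_
      · rw [norm_smul, Complex.norm_real, Real.norm_eq_abs, abs_of_pos (besselWeight_pos _ _)]
        exact mul_le_of_le_one_left (norm_nonneg _) (besselWeight_neg_half_le ξ)
      · have := eLpNorm_fourier_sub (lineRestrict (u N)).integrable ((lineRestrict (u N)).memLp 2)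
          (hDi N) (hD2 N)
        rw [← SchwartzMap.fourier_coe] at this
        rw [this, ← hv0]
        exact h4 N
  exact ⟨⟨hfL, hgL, isWeakSigmaGrad_of_tendsto hfL hgL T1 T2⟩, memSobolev_sobolevDist α, u, hu, T1,
    T2, tendstoSobolev_iff.2 T3⟩

end Solution

/-! ### Algebra of the critical case -/

section Critical

variable {m η τ : ℝ}

theorem eta_ne_zero (hcrit : η ^ 2 - τ ^ 2 = 4) : η ≠ 0 := by
  rintro rfl
  nlinarith [sq_nonneg τ]

theorem ratio_sq (hcrit : η ^ 2 - τ ^ 2 = 4) : η ^ 2 * (1 - (τ / η) ^ 2) = 4 := by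
  have := eta_ne_zero hcrit
  field_simp
  exact hcrit

theorem abs_ratio_lt_one (hcrit : η ^ 2 - τ ^ 2 = 4) : |τ / η| < 1 := by
  have h := ratio_sq hcrit
  rw [← sq_lt_one_iff_abs_lt_one]
  by_contra! h1
  nlinarith [sq_nonneg η, mul_nonneg (sq_nonneg η) (sub_nonneg.2 h1)]

theorem one_sub_ratio_pos (hcrit : η ^ 2 - τ ^ 2 = 4) : 0 < 1 - τ / η := by
  linarith [(abs_lt.1 (abs_ratio_lt_one hcrit)).2]

theorem one_add_ratio_pos (hcrit : η ^ 2 - τ ^ 2 = 4) : 0 < 1 + τ / η := by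
  linarith [(abs_lt.1 (abs_ratio_lt_one hcrit)).1]

/-- This matches the decay rate of the transverse equation at `z_*` with the `κ` of the statement.
-/
theorem sq_sub_zStar_sq (hcrit : η ^ 2 - τ ^ 2 = 4) :
    m ^ 2 - zStar m η τ ^ 2 = 4 * m ^ 2 / η ^ 2 := by
  have := eta_ne_zero hcrit
  rw [zStar]
  field_simp
  linear_combination m ^ 2 * hcrit

/-- The diagonal entries are proportional to `4 - (η² - τ²)`, so criticality is what makes `Λ`
antidiagonal. The matrix to be inverted has determinant `1 + (η² - τ²) / 4 = 2`. -/
theorem Lam_eq (hcrit : η ^ 2 - τ ^ 2 = 4) :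
    Lam η τ = !![0, -Complex.I * ((η - τ) / 2 : ℝ); -Complex.I * ((η + τ) / 2 : ℝ), 0] := by
  have hc : (η : ℂ) ^ 2 - (τ : ℂ) ^ 2 = 4 := by exact_mod_cast hcrit
  set A := Complex.I • σ₁ - (1 / 2 : ℂ) • ((η : ℂ) • 1 + (τ : ℂ) • σ₃) with hA
  have hd : A.det = 2 := by
    simp [hA, Matrix.det_fin_two, σ₁, σ₃]
    linear_combination (1 / 4) * hc
  have hu : IsUnit A.det := by rw [hd]; exact isUnit_iff_ne_zero.2 two_ne_zero
  have e : Complex.I • σ₁ + (1 / 2 : ℂ) • ((η : ℂ) • 1 + (τ : ℂ) • σ₃) =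
      A * !![0, -Complex.I * ((η - τ) / 2 : ℝ); -Complex.I * ((η + τ) / 2 : ℝ), 0] := by
    ext i j
    fin_cases i <;> fin_cases j <;>
    simp [hA, σ₁, σ₃, Matrix.mul_apply, Fin.sum_univ_two]
    · linear_combination (η + τ) / 2 * Complex.I_sq
    · linear_combination (-Complex.I / 4) * hc
    · linear_combination (-Complex.I / 4) * hc
    · linear_combination (η - τ) / 2 * Complex.I_sq
  rw [Lam, ← hA, e, Matrix.nonsing_inv_mul_cancel_left _ _ hu]

/-- Here `-i (n · σ) = i σ₁`, and collecting `u` and `v` on opposite sides gives the two brackets in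
the definition of `Λ`. -/
theorem transmission_iff_eq_act_Lam (hcrit : η ^ 2 - τ ^ 2 = 4) (u v : Spinor) :
    act (-Complex.I • sigmaDot normal) (u - v) =
      act ((1 / 2 : ℂ) • ((η : ℂ) • 1 + (τ : ℂ) • σ₃)) (u + v) ↔ u = act (Lam η τ) v := by
  have hc : (η : ℂ) ^ 2 - (τ : ℂ) ^ 2 = 4 := by exact_mod_cast hcrit
  rw [Lam_eq hcrit]
  constructor
  · intro h
    have h0 := congrArg (fun w : Spinor => w 0) h
    have h1 := congrArg (fun w : Spinor => w 1) h
    simp [act_apply, sigmaDot, normal, σ₁, σ₂, σ₃] at h0 h1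
    ext i
    fin_cases i <;> simp [act_apply]
    · linear_combination (-(η - τ) / 4) * h0 - (Complex.I / 2) * h1 - (u 0 + v 0) / 8 * hc +
        (u 0 - v 0) / 2 * Complex.I_sq
    · linear_combination (-(η + τ) / 4) * h1 - (Complex.I / 2) * h0 - (u 1 + v 1) / 8 * hc +
        (u 1 - v 1) / 2 * Complex.I_sq
  · rintro rfl
    ext i
    fin_cases i <;> simp [act_apply, sigmaDot, normal, σ₁, σ₂, σ₃]
    · linear_combination (Complex.I / 4 * v 1) * hc - (η + τ) / 2 * v 0 * Complex.I_sq
    · linear_combination (Complex.I / 4 * v 0) * hc - (η - τ) / 2 * v 1 * Complex.I_sq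

/-- An antidiagonal matrix anticommutes with `k σ₃`. The anticommutator with the off-diagonal part
of `A(k)` is the scalar `z η + m τ`, which vanishes exactly at `z = z_*`, independently of `k`. -/
theorem symbol_act_Lam (hcrit : η ^ 2 - τ ^ 2 = 4) (k : ℝ) (u : Spinor) :
    symbol m (zStar m η τ) k (act (Lam η τ) u) = -act (Lam η τ) (symbol m (zStar m η τ) k u) := by
  have hη : (η : ℂ) ≠ 0 := by exact_mod_cast eta_ne_zero hcrit
  rw [Lam_eq hcrit]
  ext i
  fin_cases i <;> simp [act_apply, symbol, zStar] <;> field_simp <;> ring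

theorem abs_lt_kappa (hm : 0 < m) (hη : η ≠ 0) (k : ℝ) : |k| < kappa m η k := by
  rw [← Real.sqrt_sq_eq_abs, kappa]
  exact Real.sqrt_lt_sqrt (sq_nonneg k) (by linarith [show 0 < 4 * m ^ 2 / η ^ 2 by positivity])

theorem kappa_add_pos (hm : 0 < m) (hη : η ≠ 0) (k : ℝ) : 0 < kappa m η k + k := by
  linarith [(abs_lt.1 (abs_lt_kappa hm hη k)).1]

theorem kappa_sub_pos (hm : 0 < m) (hη : η ≠ 0) (k : ℝ) : 0 < kappa m η k - k := by
  linarith [(abs_lt.1 (abs_lt_kappa hm hη k)).2]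

/-- The first component of the amplitude. -/
def amplitudeFst (m η τ k : ℝ) : ℝ := Real.sqrt ((1 - τ / η) * (kappa m η k + k))

/-- The second component of the amplitude, up to the factor `-i`. -/
def amplitudeSnd (m η τ k : ℝ) : ℝ := Real.sqrt ((1 + τ / η) * (kappa m η k - k))

theorem amplitude_zero (m η τ k : ℝ) : amplitude m η τ k 0 = amplitudeFst m η τ k := rfl

theorem amplitude_one (m η τ k : ℝ) :
    amplitude m η τ k 1 = -Complex.I * amplitudeSnd m η τ k := rfl

theorem amplitudeFst_pos (hm : 0 < m) (hcrit : η ^ 2 - τ ^ 2 = 4) (k : ℝ) :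
    0 < amplitudeFst m η τ k :=
  Real.sqrt_pos.2 (mul_pos (one_sub_ratio_pos hcrit) (kappa_add_pos hm (eta_ne_zero hcrit) k))

theorem amplitudeFst_sq (hm : 0 < m) (hcrit : η ^ 2 - τ ^ 2 = 4) (k : ℝ) :
    amplitudeFst m η τ k ^ 2 = (1 - τ / η) * (kappa m η k + k) :=
  Real.sq_sqrt (mul_pos (one_sub_ratio_pos hcrit) (kappa_add_pos hm (eta_ne_zero hcrit) k)).le

theorem amplitudeSnd_sq (hm : 0 < m) (hcrit : η ^ 2 - τ ^ 2 = 4) (k : ℝ) :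
    amplitudeSnd m η τ k ^ 2 = (1 + τ / η) * (kappa m η k - k) :=
  Real.sq_sqrt (mul_pos (one_add_ratio_pos hcrit) (kappa_sub_pos hm (eta_ne_zero hcrit) k)).le

theorem kappa_sq_sub (hcrit : η ^ 2 - τ ^ 2 = 4) (k : ℝ) :
    (kappa m η k + k) * (kappa m η k - k) = m ^ 2 * ((1 + τ / η) * (1 - τ / η)) := by
  have h := kappa_sq m η k
  rw [← sq_sub_zStar_sq hcrit, zStar] at h
  linear_combination h

/-- Both sides are nonnegative, and their squares agree by `(κ + k)(κ - k) = m² (1 + τ/η)(1 - τ/η)`.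
-/
theorem kappa_sub_mul_amplitudeFst (hm : 0 < m) (hcrit : η ^ 2 - τ ^ 2 = 4) (k : ℝ) :
    (kappa m η k - k) * amplitudeFst m η τ k = m * (1 - τ / η) * amplitudeSnd m η τ k := by
  have h1 := one_sub_ratio_pos hcrit
  have h2 := kappa_sub_pos hm (eta_ne_zero hcrit) k
  refine (sq_eq_sq₀ (by unfold amplitudeFst; positivity) (by unfold amplitudeSnd; positivity)).1 ?_
  rw [mul_pow, mul_pow, amplitudeFst_sq hm hcrit, amplitudeSnd_sq hm hcrit]
  linear_combination (kappa m η k - k) * (1 - τ / η) * kappa_sq_sub (m := m) hcrit k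

theorem kappa_add_mul_amplitudeSnd (hm : 0 < m) (hcrit : η ^ 2 - τ ^ 2 = 4) (k : ℝ) :
    (kappa m η k + k) * amplitudeSnd m η τ k = m * (1 + τ / η) * amplitudeFst m η τ k := by
  have h1 := one_add_ratio_pos hcrit
  have h2 := kappa_add_pos hm (eta_ne_zero hcrit) k
  refine (sq_eq_sq₀ (by unfold amplitudeSnd; positivity) (by unfold amplitudeFst; positivity)).1 ?_
  rw [mul_pow, mul_pow, amplitudeFst_sq hm hcrit, amplitudeSnd_sq hm hcrit]
  linear_combination (kappa m η k + k) * (1 + τ / η) * kappa_sq_sub (m := m) hcrit k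

theorem symbol_amplitude (hm : 0 < m) (hcrit : η ^ 2 - τ ^ 2 = 4) (k : ℝ) :
    symbol m (zStar m η τ) k (amplitude m η τ k) = (kappa m η k : ℂ) • amplitude m η τ k := by
  have h1 : ((kappa m η k : ℂ) - k) * amplitudeFst m η τ k =
      m * (1 - τ / η) * amplitudeSnd m η τ k := by
    exact_mod_cast kappa_sub_mul_amplitudeFst hm hcrit k
  have h2 : ((kappa m η k : ℂ) + k) * amplitudeSnd m η τ k =
      m * (1 + τ / η) * amplitudeFst m η τ k := by
    exact_mod_cast kappa_add_mul_amplitudeSnd hm hcrit k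
  ext i
  fin_cases i <;> simp [act_apply, symbol, zStar, amplitude_zero, amplitude_one]
  · linear_combination -h1 - m * (1 - τ / η) * amplitudeSnd m η τ k * Complex.I_sq
  · linear_combination Complex.I * h2

/-- The eigenvalue `κ` of the symbol is simple. -/
theorem eq_smul_amplitude (hm : 0 < m) (hcrit : η ^ 2 - τ ^ 2 = 4) {k : ℝ} {u : Spinor}
    (h : symbol m (zStar m η τ) k u = (kappa m η k : ℂ) • u) :
    u = (u 0 / amplitudeFst m η τ k) • amplitude m η τ k := by
  have hA : (amplitudeFst m η τ k : ℂ) ≠ 0 := by exact_mod_cast (amplitudeFst_pos hm hcrit k).ne'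
  -- Up to the factor `i` this is the upper right entry of `A(k)` at `z_*`. Being nonzero, it lets
  -- the first row determine `u 1` from `u 0`.
  have hq : (m : ℂ) * (1 - τ / η) ≠ 0 := by
    exact_mod_cast (mul_pos hm (one_sub_ratio_pos hcrit)).ne'
  have h1 : ((kappa m η k : ℂ) - k) * amplitudeFst m η τ k =
      m * (1 - τ / η) * amplitudeSnd m η τ k := by
    exact_mod_cast kappa_sub_mul_amplitudeFst hm hcrit k
  have h0 := congrArg (fun w : Spinor => w 0) h
  simp [act_apply, symbol, zStar] at h0
  ext i
  fin_cases i <;> simp [amplitude_zero, amplitude_one]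
  · field_simp
  · refine mul_left_cancel₀ hq ?_
    have h2 : (m : ℂ) * (1 - τ / η) * (amplitudeSnd m η τ k / amplitudeFst m η τ k) =
        kappa m η k - k := by
      rw [← mul_div_assoc, ← h1, mul_div_cancel_right₀ _ hA]
    linear_combination -Complex.I * h0 + m * (1 - τ / η) * u 1 * Complex.I_sq +
      Complex.I * u 0 * h2

theorem norm_amplitude_sq (hm : 0 < m) (hcrit : η ^ 2 - τ ^ 2 = 4) (k : ℝ) :
    ‖amplitude m η τ k‖ ^ 2 = 2 * kappa m η k - 2 * (τ / η) * k := by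
  rw [EuclideanSpace.norm_sq_eq, Fin.sum_univ_two, amplitude_zero, amplitude_one]
  simp only [norm_mul, norm_neg, Complex.norm_I, one_mul, Complex.norm_real, Real.norm_eq_abs,
    sq_abs, amplitudeFst_sq hm hcrit, amplitudeSnd_sq hm hcrit]
  ring

/-- `Λ` swaps the components with factors `η (1 ∓ τ/η) / 2`, and `η² (1 - (τ/η)²) = 4`. The result
is `‖a‖²` with the sign of `k` reversed, so that the two squared norms add up to `4 κ`. -/
theorem norm_act_Lam_amplitude_sq (hm : 0 < m) (hcrit : η ^ 2 - τ ^ 2 = 4) (k : ℝ) :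
    ‖act (Lam η τ) (amplitude m η τ k)‖ ^ 2 = 2 * kappa m η k + 2 * (τ / η) * k := by
  have hη := eta_ne_zero hcrit
  have h := ratio_sq hcrit
  rw [EuclideanSpace.norm_sq_eq, Fin.sum_univ_two, act_apply, act_apply, amplitude_zero,
    amplitude_one, Lam_eq hcrit]
  simp only [Matrix.of_apply, Matrix.cons_val', Matrix.cons_val_zero, Matrix.cons_val_one,
    Matrix.cons_val_fin_one, zero_mul, zero_add, add_zero, norm_mul, norm_neg, Complex.norm_I,
    one_mul, Complex.norm_real, Real.norm_eq_abs, mul_pow, sq_abs, amplitudeFst_sq hm hcrit,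
    amplitudeSnd_sq hm hcrit]
  have e1 : (η - τ) / 2 = η * (1 - τ / η) / 2 := by field_simp
  have e2 : (η + τ) / 2 = η * (1 + τ / η) / 2 := by field_simp
  rw [e1, e2]
  linear_combination (1 / 4) * ((1 - τ / η) * (kappa m η k - k) +
    (1 + τ / η) * (kappa m η k + k)) * h

end Critical

/-! ### The explicit eigenfunctions as superpositions of decaying modes -/

section Profile

variable {m η τ s : ℝ} {Ξ : ℝ → ℂ}

theorem lintegral_comp_two_pi_mul (g : ℝ → ℝ≥0∞) :
    ∫⁻ ξ, g (2 * Real.pi * ξ) = ENNReal.ofReal (1 / (2 * Real.pi)) * ∫⁻ k, g k := by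
  have h : (2 * Real.pi : ℝ) ≠ 0 := by positivity
  have := lintegral_map_equiv (μ := (volume : Measure ℝ)) g
    (Homeomorph.mulLeft₀ (2 * Real.pi) h).toMeasurableEquiv
  have e : ⇑(Homeomorph.mulLeft₀ (2 * Real.pi) h).toMeasurableEquiv =
    fun x => 2 * Real.pi * x := rfl
  rw [e, Real.map_volume_mul_left h, lintegral_smul_measure] at this
  rw [← this, abs_of_pos (by positivity), one_div, smul_eq_mul]

theorem memLp_comp_two_pi_mul (hm : StronglyMeasurable Ξ) (h : MemLp Ξ 2) :
    MemLp (fun ξ => Ξ (2 * Real.pi * ξ)) 2 := by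
  refine ⟨(hm.comp_measurable (measurable_const_mul _)).aestronglyMeasurable, ?_⟩
  have : eLpNorm (fun ξ => Ξ (2 * Real.pi * ξ)) 2 volume ^ 2 < ⊤ := by
    rw [eLpNorm_two_sq, lintegral_comp_two_pi_mul fun k => ‖Ξ k‖ₑ ^ 2, ← eLpNorm_two_sq]
    exact ENNReal.mul_lt_top ENNReal.ofReal_lt_top (ENNReal.pow_lt_top h.2)
  exact (ENNReal.pow_lt_top_iff.1 this).resolve_right (by norm_num)

/-- The Fourier transform of the trace of `ψ_Ξ` on the line from the left. -/
def profile (m η τ : ℝ) (Ξ : ℝ → ℂ) (ξ : ℝ) : Spinor :=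
  ((Real.sqrt Real.pi : ℝ) * Ξ (2 * Real.pi * ξ) : ℂ) • amplitude m η τ (2 * Real.pi * ξ)

/-- The matrix in the definition of `ψ_Ξ` on the side of the line given by the sign of `s`. -/
def sideMatrix (η τ s : ℝ) : Matrix (Fin 2) (Fin 2) ℂ := if 0 < s then Lam η τ else 1

theorem heaviside_add_eq_sideMatrix (hs : s ^ 2 = 1) {x : ℝ} (hx : x ∈ halfLine s) :
    heaviside x • Lam η τ + heaviside (-x) • 1 = sideMatrix η τ s := by
  rcases sq_eq_one_iff.1 hs with rfl | rfl
  · have h : 0 < x := by simpa [halfLine] using hx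
    have h' : ¬ x < 0 := h.not_gt
    simp [heaviside, sideMatrix, h, h']
  · have h : x < 0 := by simpa [halfLine] using hx
    have h' : ¬ 0 < x := h.not_gt
    have h1 : ¬ (0 : ℝ) < -1 := by norm_num
    simp [heaviside, sideMatrix, h, h', h1]

theorem abs_eq_mul_of_mem_halfLine (hs : s ^ 2 = 1) {x : ℝ} (hx : x ∈ halfLine s) :
    |x| = s * x := by
  rcases sq_eq_one_iff.1 hs with rfl | rfl
  · have h : 0 < x := by simpa [halfLine] using hx
    rw [abs_of_pos h, one_mul]
  · have h : x < 0 := by simpa [halfLine] using hx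
    rw [abs_of_neg h, neg_one_mul]

theorem continuous_amplitude (m η τ : ℝ) : Continuous (amplitude m η τ) := by
  have := continuous_kappa m η
  unfold amplitude
  refine (PiLp.continuous_toLp 2 _).comp (continuous_pi fun i => ?_)
  fin_cases i
  · simp only [Fin.zero_eta, Matrix.cons_val_zero]
    fun_prop
  · simp only [Fin.mk_one, Matrix.cons_val_one, Matrix.cons_val_fin_one]
    fun_prop

theorem stronglyMeasurable_profile (hΞ : StronglyMeasurable Ξ) :
    StronglyMeasurable (profile m η τ Ξ) :=
  (stronglyMeasurable_const.mul (hΞ.comp_measurable (measurable_const_mul _))).smul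
    ((continuous_amplitude m η τ).comp (by fun_prop)).stronglyMeasurable

/-- The trace of `ψ_Ξ`, transformed by the matrix `M`, as an element of the weighted space. -/
def weightedProfile (m η τ : ℝ) (M : Matrix (Fin 2) (Fin 2) ℂ) (Ξ : ℝ → ℂ) (ξ : ℝ) : Spinor :=
  besselWeight (-1 / 2) ξ • act M (profile m η τ Ξ ξ)

theorem besselWeight_half_mul (ξ : ℝ) : besselWeight (1 / 2) ξ * besselWeight (-1 / 2) ξ = 1 := by
  rw [neg_div, besselWeight_mul_neg]

theorem unweight_weightedProfile (M : Matrix (Fin 2) (Fin 2) ℂ) (Ξ : ℝ → ℂ) :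
    unweight (weightedProfile m η τ M Ξ) = fun ξ => act M (profile m η τ Ξ ξ) := by
  ext1 ξ
  rw [unweight, weightedProfile, smul_smul, besselWeight_half_mul, one_smul]

theorem stronglyMeasurable_weightedProfile (M : Matrix (Fin 2) (Fin 2) ℂ)
    (hΞ : StronglyMeasurable Ξ) : StronglyMeasurable (weightedProfile m η τ M Ξ) :=
  (continuous_besselWeight _).stronglyMeasurable.smul
    ((act M).continuous.comp_stronglyMeasurable (stronglyMeasurable_profile hΞ))

/-- With `exists_besselWeight_sq_le` this shows that `κ` and the squared weight are comparable. -/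
theorem exists_kappa_le (m η : ℝ) :
    ∃ C : ℝ, 0 < C ∧ ∀ ξ, kappa m η (2 * Real.pi * ξ) ≤ C * besselWeight (1 / 2) ξ ^ 2 := by
  set C := (2 * Real.pi) ^ 2 + 4 * m ^ 2 / η ^ 2
  refine ⟨Real.sqrt C, by positivity, fun ξ => ?_⟩
  rw [besselWeight_half_sq, ← Real.sqrt_mul (by positivity), kappa]
  refine Real.sqrt_le_sqrt ?_
  have h : 0 ≤ 4 * m ^ 2 / η ^ 2 := by positivity
  have h' := mul_nonneg h (sq_nonneg ξ)
  simp only [C]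
  nlinarith [sq_nonneg Real.pi]

theorem norm_amplitude_sq_le (hm : 0 < m) (hcrit : η ^ 2 - τ ^ 2 = 4) (k : ℝ) :
    ‖amplitude m η τ k‖ ^ 2 ≤ 4 * kappa m η k := by
  -- The two squared norms sum to `4 κ`, and the other one is nonnegative.
  have h := (norm_act_Lam_amplitude_sq hm hcrit k).symm.trans_ge (sq_nonneg _)
  rw [norm_amplitude_sq hm hcrit]
  linarith

/-- The amplitude grows like `√κ`, which is the rate that the weight of order `-1/2` removes. -/
theorem exists_norm_weightedProfile_le (hm : 0 < m) (hcrit : η ^ 2 - τ ^ 2 = 4)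
    (M : Matrix (Fin 2) (Fin 2) ℂ) :
    ∃ C : ℝ, ∀ (Ξ : ℝ → ℂ) ξ, ‖weightedProfile m η τ M Ξ ξ‖ ≤ C * ‖Ξ (2 * Real.pi * ξ)‖ := by
  obtain ⟨C, hC, h⟩ := exists_kappa_le m η
  refine ⟨‖act M‖ * (Real.sqrt Real.pi * (2 * Real.sqrt C)), fun Ξ ξ => ?_⟩
  have ha : ‖amplitude m η τ (2 * Real.pi * ξ)‖ ≤ 2 * Real.sqrt C * besselWeight (1 / 2) ξ := by
    have hb := besselWeight_pos (1 / 2) ξ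
    refine (sq_le_sq₀ (norm_nonneg _) (by positivity)).1 ?_
    rw [mul_pow, mul_pow, Real.sq_sqrt hC.le]
    have := norm_amplitude_sq_le hm hcrit (2 * Real.pi * ξ)
    linarith [h ξ]
  have hb := besselWeight_pos (-1 / 2) ξ
  rw [weightedProfile, norm_smul, Real.norm_eq_abs, abs_of_pos hb]
  calc besselWeight (-1 / 2) ξ * ‖act M (profile m η τ Ξ ξ)‖
      ≤ besselWeight (-1 / 2) ξ * (‖act M‖ * (Real.sqrt Real.pi * ‖Ξ (2 * Real.pi * ξ)‖ *
        (2 * Real.sqrt C * besselWeight (1 / 2) ξ))) := by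
        refine mul_le_mul_of_nonneg_left (((act M).le_opNorm _).trans
          (mul_le_mul_of_nonneg_left ?_ (norm_nonneg _))) hb.le
        rw [profile, norm_smul, norm_mul, Complex.norm_real, Real.norm_eq_abs,
          abs_of_nonneg (Real.sqrt_nonneg _)]
        gcongr
    _ = _ := by
        linear_combination (‖act M‖ * Real.sqrt Real.pi * ‖Ξ (2 * Real.pi * ξ)‖ *
          (2 * Real.sqrt C)) * besselWeight_half_mul ξ

theorem memLp_weightedProfile (hm : 0 < m) (hcrit : η ^ 2 - τ ^ 2 = 4)
    (M : Matrix (Fin 2) (Fin 2) ℂ) (hΞ : StronglyMeasurable Ξ) (h2 : MemLp Ξ 2) :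
    MemLp (weightedProfile m η τ M Ξ) 2 := by
  obtain ⟨C, hC⟩ := exists_norm_weightedProfile_le hm hcrit M
  exact (memLp_comp_two_pi_mul hΞ h2).of_le_mul
    (stronglyMeasurable_weightedProfile M hΞ).aestronglyMeasurable
    (Eventually.of_forall fun ξ => hC Ξ ξ)

theorem sqrt_pi_smul_psiIntegrand (hs : s ^ 2 = 1) {x : ℝ} (hx : x ∈ halfLine s) (y ξ : ℝ) :
    ((Real.sqrt Real.pi : ℝ) : ℂ) • psiIntegrand m η τ Ξ x y (2 * Real.pi * ξ) =
      Complex.exp (((2 * Real.pi * inner ℝ ξ y : ℝ) : ℂ) * Complex.I) •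
        evolve m η s (profile m η τ Ξ) (x, ξ) := by
  rw [psiIntegrand, evolve, profile, decayExp, ← Complex.coe_smul, Complex.ofReal_exp, smul_smul,
    smul_smul, smul_smul, abs_eq_mul_of_mem_halfLine hs hx]
  congr 1
  have e : Complex.exp (Complex.I * (2 * Real.pi * ξ : ℝ) * y -
      kappa m η (2 * Real.pi * ξ) * (s * x : ℝ)) =
      Complex.exp (((2 * Real.pi * inner ℝ ξ y : ℝ) : ℂ) * Complex.I) *
        Complex.exp ((-(s * kappa m η (2 * Real.pi * ξ)) * x : ℝ) : ℂ) := by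
    rw [← Complex.exp_add]
    congr 1
    simp only [RCLike.inner_apply, conj_trivial]
    push_cast
    ring
  rw [e]
  ring

theorem integrable_psiIntegrand (hm : 0 < m) (hcrit : η ^ 2 - τ ^ 2 = 4)
    (hΞ : StronglyMeasurable Ξ) (h2 : MemLp Ξ 2) {x : ℝ} (hx : x ≠ 0) (y : ℝ) :
    Integrable fun k => psiIntegrand m η τ Ξ x y k := by
  obtain ⟨s, hs, hxs⟩ : ∃ s : ℝ, s ^ 2 = 1 ∧ x ∈ halfLine s := by
    rcases lt_or_gt_of_ne hx with h | h
    · exact ⟨-1, by norm_num, by simpa [halfLine] using h⟩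
    · exact ⟨1, by norm_num, by simpa [halfLine] using h⟩
  rw [← integrable_comp_mul_left_iff _ (R := 2 * Real.pi) (by positivity)]
  have h := integrable_evolve_unweight_slice hm (eta_ne_zero hcrit) hxs
    (memLp_weightedProfile hm hcrit 1 hΞ h2)
  have e : (fun ξ => act 1 (profile m η τ Ξ ξ)) = profile m η τ Ξ := by
    ext1 ξ; simp [act]
  rw [unweight_weightedProfile, e] at h
  have hc : Continuous fun ξ : ℝ =>
      Complex.exp (((2 * Real.pi * inner ℝ ξ y : ℝ) : ℂ) * Complex.I) := by fun_prop
  have h' : Integrable fun ξ => Complex.exp (((2 * Real.pi * inner ℝ ξ y : ℝ) : ℂ) * Complex.I) •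
      evolve m η s (profile m η τ Ξ) (x, ξ) := by
    refine h.mono (hc.aestronglyMeasurable.smul h.1) (Eventually.of_forall fun ξ => ?_)
    rw [norm_smul, Complex.norm_exp_ofReal_mul_I, one_mul]
  simp_rw [← sqrt_pi_smul_psiIntegrand hs hxs] at h'
  have hπ : ((Real.sqrt Real.pi : ℝ) : ℂ) ≠ 0 := by
    exact_mod_cast (Real.sqrt_pos.2 Real.pi_pos).ne'
  exact (integrable_smul_iff hπ _).1 h'

/-- The substitution `k = 2 π ξ` turns the integral defining `ψ_Ξ` into an inverse Fourier integral
of decaying modes, so that both half-plane lemmas apply to it. -/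
theorem psiXi_eq (hm : 0 < m) (hcrit : η ^ 2 - τ ^ 2 = 4) (hs : s ^ 2 = 1)
    (hΞ : StronglyMeasurable Ξ) (h2 : MemLp Ξ 2) {p : ℝ × ℝ} (hp : p.1 ∈ halfLine s) :
    psiXi m η τ Ξ p = sliceFourierInv
      (evolve m η s (unweight (weightedProfile m η τ (sideMatrix η τ s) Ξ))) p := by
  have hp0 : p.1 ≠ 0 := by
    intro h
    simp [halfLine, h] at hp
  have hi := integrable_psiIntegrand hm hcrit hΞ h2 hp0 p.2
  have hi' := (integrable_comp_mul_left_iff _ (R := 2 * Real.pi) (by positivity)).2 hi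
  have hi'' : Integrable fun ξ =>
      ((Real.sqrt Real.pi : ℝ) : ℂ) • psiIntegrand m η τ Ξ p.1 p.2 (2 * Real.pi * ξ) :=
    hi'.smul ((Real.sqrt Real.pi : ℝ) : ℂ)
  have hcv := Measure.integral_comp_mul_left (fun k => psiIntegrand m η τ Ξ p.1 p.2 k)
    (2 * Real.pi)
  have hπ := Real.pi_pos
  have hsq : Real.sqrt Real.pi ≠ 0 := (Real.sqrt_pos.2 hπ).ne'
  have e1 : ∫ k, psiIntegrand m η τ Ξ p.1 p.2 k =
      ((2 * Real.pi : ℝ) : ℂ) • ∫ ξ, psiIntegrand m η τ Ξ p.1 p.2 (2 * Real.pi * ξ) := by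
    rw [hcv, abs_of_pos (by positivity), Complex.coe_smul, smul_smul,
      mul_inv_cancel₀ (by positivity), one_smul]
  rw [psiXi, heaviside_add_eq_sideMatrix hs hp, e1, map_smul, smul_smul, ← Complex.ofReal_mul]
  -- The prefactor of `ψ_Ξ` times the Jacobian `2 π`; this is the `√π` in `profile`.
  have e2 : 1 / (2 * Real.sqrt Real.pi) * (2 * Real.pi) = Real.sqrt Real.pi := by
    field_simp
    rw [Real.sq_sqrt hπ.le]
  rw [e2, ← map_smul, ← integral_smul,
    ← (act (sideMatrix η τ s)).integral_comp_comm hi'', sliceFourierInv, Real.fourierInv_eq']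
  refine integral_congr_ae (Eventually.of_forall fun ξ => ?_)
  beta_reduce
  rw [sqrt_pi_smul_psiIntegrand hs hp, map_smul, evolve, evolve, unweight_weightedProfile]
  congr 1
  rw [← Complex.coe_smul, map_smul, Complex.coe_smul]

theorem halfPlane_union_ae_eq_univ :
    (halfPlane 1 ∪ halfPlane (-1) : Set (ℝ × ℝ)) =ᵐ[volume] Set.univ := by
  have : ∀ᵐ p : ℝ × ℝ, p ∈ halfPlane 1 ∪ halfPlane (-1) := by
    rw [halfPlane_one, halfPlane_neg_one]
    refine ae_of_ae_halfPlanes ?_ ?_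
    · filter_upwards [ae_restrict_mem isOpen_OmegaPlus.measurableSet] with p hp using Or.inl hp
    · filter_upwards [ae_restrict_mem isOpen_OmegaMinus.measurableSet] with p hp using Or.inr hp
  filter_upwards [this] with p hp
  exact propext ⟨fun _ => trivial, fun _ => hp⟩

theorem lintegral_eq_add_halfPlanes (g : ℝ × ℝ → ℝ≥0∞) :
    ∫⁻ p, g p = (∫⁻ p in halfPlane 1, g p) + ∫⁻ p in halfPlane (-1), g p := by
  have hd : Disjoint (halfPlane 1) (halfPlane (-1)) := by
    rw [halfPlane_one, halfPlane_neg_one, Set.disjoint_left]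
    intro p h1 h2
    exact lt_asymm (show 0 < p.1 from h1) h2
  rw [← lintegral_union (isOpen_halfPlane _).measurableSet hd, ← setLIntegral_univ]
  exact setLIntegral_congr halfPlane_union_ae_eq_univ.symm

theorem psiXi_ae_eq (hm : 0 < m) (hcrit : η ^ 2 - τ ^ 2 = 4) (hs : s ^ 2 = 1)
    (hΞ : StronglyMeasurable Ξ) (h2 : MemLp Ξ 2) :
    psiXi m η τ Ξ =ᵐ[volume.restrict (halfPlane s)] sliceFourierInv
      (evolve m η s (unweight (weightedProfile m η τ (sideMatrix η τ s) Ξ))) :=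
  (ae_halfPlane_mem s).mono fun _ hp => psiXi_eq hm hcrit hs hΞ h2 hp

theorem enorm_sq_eq_ofReal {E : Type*} [NormedAddCommGroup E] (v : E) :
    ‖v‖ₑ ^ 2 = ENNReal.ofReal (‖v‖ ^ 2) := by
  rw [← ofReal_norm, ENNReal.ofReal_pow (norm_nonneg _)]

/-- At each frequency the two sides contribute `π |Ξ|² (‖Λ a‖² + ‖a‖²) / (2 κ) = 2 π |Ξ|²`, and `dξ
= dk / (2 π)`. -/
theorem eLpNorm_psiXi_sq (hm : 0 < m) (hcrit : η ^ 2 - τ ^ 2 = 4)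
    (hΞ : StronglyMeasurable Ξ) (h2 : MemLp Ξ 2) :
    eLpNorm (psiXi m η τ Ξ) 2 volume ^ 2 = eLpNorm Ξ 2 volume ^ 2 := by
  have hη := eta_ne_zero hcrit
  have side : ∀ s : ℝ, s ^ 2 = 1 → ∫⁻ p in halfPlane s, ‖psiXi m η τ Ξ p‖ₑ ^ 2 =
      ∫⁻ ξ, ‖act (sideMatrix η τ s) (profile m η τ Ξ ξ)‖ₑ ^ 2 *
        ENNReal.ofReal (1 / (2 * kappa m η (2 * Real.pi * ξ))) := fun s hs => by
    have hw := stronglyMeasurable_weightedProfile (m := m) (η := η) (τ := τ) (sideMatrix η τ s) hΞ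
    have hw2 := memLp_weightedProfile hm hcrit (sideMatrix η τ s) hΞ h2
    rw [← eLpNorm_two_sq, eLpNorm_congr_ae (psiXi_ae_eq hm hcrit hs hΞ h2),
      eLpNorm_sliceFourierInv_evolve hm hη hw hw2,
      eLpNorm_evolve_sq hm hη hs (stronglyMeasurable_unweight hw), unweight_weightedProfile]
  have hκ := continuous_kappa m η
  have meas : Measurable fun ξ => ‖act (sideMatrix η τ 1) (profile m η τ Ξ ξ)‖ₑ ^ 2 *
      ENNReal.ofReal (1 / (2 * kappa m η (2 * Real.pi * ξ))) :=
    (((act _).continuous.comp_stronglyMeasurable (stronglyMeasurable_profile hΞ)).enorm.pow_const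
      2).mul (by fun_prop)
  rw [eLpNorm_two_sq, lintegral_eq_add_halfPlanes, side 1 (by norm_num), side (-1) (by norm_num),
    ← lintegral_add_left meas]
  have e1 : sideMatrix η τ 1 = Lam η τ := by simp [sideMatrix]
  have e2 : sideMatrix η τ (-1) = 1 := if_neg (by norm_num)
  have key : ∀ ξ, ‖act (sideMatrix η τ 1) (profile m η τ Ξ ξ)‖ₑ ^ 2 *
      ENNReal.ofReal (1 / (2 * kappa m η (2 * Real.pi * ξ))) +
      ‖act (sideMatrix η τ (-1)) (profile m η τ Ξ ξ)‖ₑ ^ 2 *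
        ENNReal.ofReal (1 / (2 * kappa m η (2 * Real.pi * ξ))) =
      ENNReal.ofReal (2 * Real.pi) * ‖Ξ (2 * Real.pi * ξ)‖ₑ ^ 2 := fun ξ => by
    have hκ := kappa_pos hm hη (2 * Real.pi * ξ)
    have hone : ∀ v : Spinor, act 1 v = v := fun v => by simp [act]
    rw [e1, e2, hone, ← add_mul, enorm_sq_eq_ofReal, enorm_sq_eq_ofReal, enorm_sq_eq_ofReal,
      ← ENNReal.ofReal_add (by positivity) (by positivity), ← ENNReal.ofReal_mul (by positivity),
      ← ENNReal.ofReal_mul (by positivity)]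
    congr 1
    rw [profile, map_smul, norm_smul, norm_smul, mul_pow, mul_pow, norm_amplitude_sq hm hcrit,
      norm_act_Lam_amplitude_sq hm hcrit, norm_mul, Complex.norm_real, Real.norm_eq_abs, mul_pow,
      sq_abs, Real.sq_sqrt Real.pi_pos.le]
    set κ := kappa m η (2 * Real.pi * ξ)
    have e : ∀ a : ℝ, (a * (2 * κ + 2 * (τ / η) * (2 * Real.pi * ξ)) +
        a * (2 * κ - 2 * (τ / η) * (2 * Real.pi * ξ))) * (1 / (2 * κ)) = 2 * a := fun a => by
      rw [← mul_add, add_add_sub_cancel]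
      field_simp
      norm_num
    rw [e]
    ring
  simp_rw [key]
  rw [lintegral_const_mul' _ _ ENNReal.ofReal_ne_top, lintegral_comp_two_pi_mul fun k => ‖Ξ k‖ₑ ^ 2,
    ← mul_assoc, ← ENNReal.ofReal_mul (by positivity), eLpNorm_two_sq,
    mul_one_div_cancel (by positivity), ENNReal.ofReal_one, one_mul]

theorem eLpNorm_psiXi (hm : 0 < m) (hcrit : η ^ 2 - τ ^ 2 = 4)
    (hΞ : StronglyMeasurable Ξ) (h2 : MemLp Ξ 2) :
    eLpNorm (psiXi m η τ Ξ) 2 volume = eLpNorm Ξ 2 volume :=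
  (ENNReal.pow_right_strictMono two_ne_zero).injective (eLpNorm_psiXi_sq hm hcrit hΞ h2)

theorem aestronglyMeasurable_psiXi (hm : 0 < m) (hcrit : η ^ 2 - τ ^ 2 = 4)
    (hΞ : StronglyMeasurable Ξ) (h2 : MemLp Ξ 2) :
    AEStronglyMeasurable (psiXi m η τ Ξ) volume := by
  have side : ∀ s : ℝ, s ^ 2 = 1 →
      AEStronglyMeasurable (psiXi m η τ Ξ) (volume.restrict (halfPlane s)) := fun s hs =>
    (stronglyMeasurable_sliceFourierInv (stronglyMeasurable_evolve m η s
      (stronglyMeasurable_unweight (stronglyMeasurable_weightedProfile _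
        hΞ)))).aestronglyMeasurable.congr (psiXi_ae_eq hm hcrit hs hΞ h2).symm
  rw [← Measure.restrict_univ (μ := volume), ← Measure.restrict_congr_set
    halfPlane_union_ae_eq_univ, aestronglyMeasurable_union_iff]
  exact ⟨side 1 (by norm_num), side (-1) (by norm_num)⟩

theorem memLp_psiXi (hm : 0 < m) (hcrit : η ^ 2 - τ ^ 2 = 4)
    (hΞ : StronglyMeasurable Ξ) (h2 : MemLp Ξ 2) : MemLp (psiXi m η τ Ξ) 2 volume :=
  ⟨aestronglyMeasurable_psiXi hm hcrit hΞ h2, by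
    rw [eLpNorm_psiXi hm hcrit hΞ h2]; exact h2.2⟩

end Profile

/-! ### The eigenspace -/

theorem sliceFourierInv_evolve_congr {m η s : ℝ} {D D' : ℝ → Spinor} (h : D =ᵐ[volume] D') :
    sliceFourierInv (evolve m η s D) = sliceFourierInv (evolve m η s D') := by
  ext1 p
  rw [sliceFourierInv, sliceFourierInv, Real.fourierInv_eq', Real.fourierInv_eq']
  refine integral_congr_ae ?_
  filter_upwards [h] with ξ hξ
  simp only [evolve, hξ]

theorem unweight_congr {α β : ℝ → Spinor} (h : α =ᵐ[volume] β) :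
    unweight α =ᵐ[volume] unweight β := by
  filter_upwards [h] with ξ hξ
  rw [unweight, unweight, hξ]

/-- The equation `z f = -i g + m σ₃ f` solved for `g`. -/
theorem smul_eq_iff_eq_gradTerm {m z : ℝ} {f g : Spinor} :
    (z : ℂ) • f = -Complex.I • g + (m : ℂ) • act σ₃ f ↔ g = gradTerm m z f := by
  constructor
  · intro h
    have h0 := congrArg (fun w : Spinor => w 0) h
    have h1 := congrArg (fun w : Spinor => w 1) h
    ext i
    fin_cases i <;>
    simp [act_apply, gradTerm, σ₃] at h0 h1 ⊢
    · linear_combination -Complex.I * h0 + g 0 * Complex.I_sq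
    · linear_combination -Complex.I * h1 + g 1 * Complex.I_sq
  · rintro rfl
    ext i
    fin_cases i <;>
    simp [act_apply, gradTerm, σ₃]
    · linear_combination ((z - m) * f 0) * Complex.I_sq
    · linear_combination ((z + m) * f 1) * Complex.I_sq

section Eigenspace

variable {m η τ s : ℝ} {Ξ : ℝ → ℂ}

/-- On the right the sign flips because `Λ` anticommutes with the symbol; on the left nothing
changes. -/
theorem symbol_sideMatrix (hcrit : η ^ 2 - τ ^ 2 = 4) (hs : s ^ 2 = 1) {k κ : ℝ} {u : Spinor}
    (h : symbol m (zStar m η τ) k u = (κ : ℂ) • u) :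
    symbol m (zStar m η τ) k (act (sideMatrix η τ s) u) =
      ((-(s * κ) : ℝ) : ℂ) • act (sideMatrix η τ s) u := by
  rcases sq_eq_one_iff.1 hs with rfl | rfl
  · have e : sideMatrix η τ 1 = Lam η τ := by simp [sideMatrix]
    rw [e, symbol_act_Lam hcrit, h, map_smul]
    simp
  · have e : sideMatrix η τ (-1) = 1 := if_neg (by norm_num)
    have hone : act 1 u = u := by simp [act]
    rw [e, hone, h]
    simp

theorem symbol_profile (hm : 0 < m) (hcrit : η ^ 2 - τ ^ 2 = 4) (Ξ : ℝ → ℂ) (ξ : ℝ) :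
    symbol m (zStar m η τ) (2 * Real.pi * ξ) (profile m η τ Ξ ξ) =
      (kappa m η (2 * Real.pi * ξ) : ℂ) • profile m η τ Ξ ξ := by
  rw [profile, map_smul, symbol_amplitude hm hcrit, smul_comm]

/-- The profile lies in the `κ`-eigenspace and its image under `Λ` in the `-κ`-eigenspace, so
`halfPlane_existence` applies on both sides. The transmission condition holds because the right
trace is `Λ` times the left one by construction. -/
theorem isDiracValue_of_ae_eq_psiXi (hm : 0 < m) (hcrit : η ^ 2 - τ ^ 2 = 4)
    (hΞ : StronglyMeasurable Ξ) (h2 : MemLp Ξ 2) {ψ : L2Spinor}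
    (hψ : ψ =ᵐ[volume] psiXi m η τ Ξ) :
    IsDiracValue m η τ ψ ((zStar m η τ : ℂ) • ψ) := by
  have hη := eta_ne_zero hcrit
  set α : ℝ → Lp Spinor 2 (volume : Measure ℝ) := fun s =>
    (memLp_weightedProfile hm hcrit (sideMatrix η τ s) hΞ h2).toLp _ with hαd
  have hα : ∀ s, α s =ᵐ[volume] weightedProfile m η τ (sideMatrix η τ s) Ξ := fun s =>
    MemLp.coeFn_toLp _
  have hu : ∀ s, unweight (α s) =ᵐ[volume] fun ξ => act (sideMatrix η τ s) (profile m η τ Ξ ξ) :=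
    fun s => by
      rw [← unweight_weightedProfile]
      exact unweight_congr (hα s)
  have side : ∀ s : ℝ, s ^ 2 = 1 →
      HSigma (halfPlane s) ψ (fun p => gradTerm m (zStar m η τ) (ψ p)) ∧
      IsDirichletTrace (halfPlane s) ψ (fun p => gradTerm m (zStar m η τ) (ψ p))
        (sobolevDist (α s)) := fun s hs => by
    refine halfPlane_existence hm hη hs ?_ ?_
    · filter_upwards [hu s] with ξ hξ
      rw [hξ]
      exact symbol_sideMatrix hcrit hs (symbol_profile hm hcrit Ξ ξ)
    · rw [sliceFourierInv_evolve_congr (unweight_congr (hα s))]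
      exact EventuallyEq.trans (ae_restrict_of_ae hψ) (psiXi_ae_eq hm hcrit hs hΞ h2)
  have hval : ∀ Ω : Set (ℝ × ℝ), ∀ᵐ p ∂((volume : Measure (ℝ × ℝ)).restrict Ω),
      ((zStar m η τ : ℂ) • ψ : L2Spinor) p =
        -Complex.I • gradTerm m (zStar m η τ) (ψ p) + (m : ℂ) • act σ₃ (ψ p) := fun Ω => by
    filter_upwards [ae_restrict_of_ae (Lp.coeFn_smul (zStar m η τ : ℂ) ψ)] with p hp
    rw [hp, Pi.smul_apply]
    exact smul_eq_iff_eq_gradTerm.2 rfl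
  have sp := side 1 (by norm_num)
  have sm := side (-1) (by norm_num)
  rw [halfPlane_one] at sp
  rw [halfPlane_neg_one] at sm
  refine ⟨_, _, _, _, sp.1, sm.1, sp.2, sm.2, transmission_sobolevDist_iff.2 ?_, hval _, hval _⟩
  filter_upwards [hα 1, hα (-1)] with ξ h1 h3
  rw [transmission_iff_eq_act_Lam hcrit, h1, h3, weightedProfile, weightedProfile]
  have e : sideMatrix η τ 1 = Lam η τ := by simp [sideMatrix]
  have e' : sideMatrix η τ (-1) = 1 := if_neg (by norm_num)
  have hone : ∀ u : Spinor, act 1 u = u := fun u => by simp [act]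
  rw [e, e', hone, ← Complex.coe_smul, ← Complex.coe_smul, map_smul]

/-- The density `Ξ` for which `D` is the Fourier transform of the trace of `ψ_Ξ` from the left. -/
def density (m η τ : ℝ) (D : ℝ → Spinor) (k : ℝ) : ℂ :=
  D ((2 * Real.pi)⁻¹ * k) 0 / ((Real.sqrt Real.pi * amplitudeFst m η τ k : ℝ) : ℂ)

theorem stronglyMeasurable_density {D : ℝ → Spinor} (hD : StronglyMeasurable D) :
    StronglyMeasurable (density m η τ D) := by
  have hκ := continuous_kappa m η
  have h1 : Measurable fun k => D ((2 * Real.pi)⁻¹ * k) 0 :=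
    (((EuclideanSpace.proj (𝕜 := ℂ) (0 : Fin 2)).continuous.comp_stronglyMeasurable hD).comp_measurable
      (measurable_const_mul _)).measurable
  have h3 : Measurable fun k => ((Real.sqrt Real.pi * amplitudeFst m η τ k : ℝ) : ℂ) := by
    unfold amplitudeFst
    fun_prop
  exact (h1.div h3).stronglyMeasurable

theorem profile_density (hm : 0 < m) (hcrit : η ^ 2 - τ ^ 2 = 4) {D : ℝ → Spinor} {ξ : ℝ}
    (h : symbol m (zStar m η τ) (2 * Real.pi * ξ) (D ξ) =
      (kappa m η (2 * Real.pi * ξ) : ℂ) • D ξ) :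
    profile m η τ (density m η τ D) ξ = D ξ := by
  have hA : (amplitudeFst m η τ (2 * Real.pi * ξ) : ℂ) ≠ 0 := by
    exact_mod_cast (amplitudeFst_pos hm hcrit _).ne'
  have hπ : ((Real.sqrt Real.pi : ℝ) : ℂ) ≠ 0 := by
    exact_mod_cast (Real.sqrt_pos.2 Real.pi_pos).ne'
  rw [eq_smul_amplitude hm hcrit h, profile, density, inv_mul_cancel_left₀ (by positivity)]
  congr 1
  push_cast
  have e : ((D ξ 0 / amplitudeFst m η τ (2 * Real.pi * ξ)) •
      amplitude m η τ (2 * Real.pi * ξ)) 0 = D ξ 0 := by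
    simp [amplitude_zero, hA]
  field_simp

/-- Since `|k| < κ` and `|τ/η| < 1`, the amplitude is bounded below by a multiple of `√κ`; this
returns integrability from the profile to `Ξ`. -/
theorem norm_amplitude_sq_ge (hm : 0 < m) (hcrit : η ^ 2 - τ ^ 2 = 4) (k : ℝ) :
    2 * (1 - |τ / η|) * kappa m η k ≤ ‖amplitude m η τ k‖ ^ 2 := by
  rw [norm_amplitude_sq hm hcrit]
  have h1 := abs_lt_kappa hm (eta_ne_zero hcrit) k
  have h2 : τ / η * k ≤ |τ / η| * |k| := (le_abs_self _).trans (abs_mul _ _).le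
  nlinarith [abs_nonneg (τ / η), abs_nonneg k]

/-- The integral in `x` divides `‖a‖²` by `2 κ`, and the quotient is at least `1 - |τ/η| > 0`. One
half-plane is therefore enough to control `Ξ`. -/
theorem memLp_of_memLp_evolve_profile (hm : 0 < m) (hcrit : η ^ 2 - τ ^ 2 = 4) (hs : s ^ 2 = 1)
    (hΞ : StronglyMeasurable Ξ)
    (h : MemLp (evolve m η s (profile m η τ Ξ)) 2 (volume.restrict (halfPlane s))) :
    MemLp Ξ 2 := by
  have hη := eta_ne_zero hcrit
  have hc : 0 < 1 - |τ / η| := sub_pos.2 (abs_ratio_lt_one hcrit)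
  have h1 := ENNReal.pow_lt_top (n := 2) h.2
  rw [eLpNorm_evolve_sq hm hη hs (stronglyMeasurable_profile hΞ)] at h1
  have h3 : ENNReal.ofReal (Real.pi * (1 - |τ / η|)) *
      (ENNReal.ofReal (1 / (2 * Real.pi)) * eLpNorm Ξ 2 volume ^ 2) < ⊤ := by
    refine lt_of_le_of_lt ?_ h1
    rw [eLpNorm_two_sq, ← lintegral_comp_two_pi_mul fun k => ‖Ξ k‖ₑ ^ 2,
      ← lintegral_const_mul' _ _ ENNReal.ofReal_ne_top]
    refine lintegral_mono fun ξ => ?_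
    have hκ := kappa_pos hm hη (2 * Real.pi * ξ)
    beta_reduce
    rw [enorm_sq_eq_ofReal, enorm_sq_eq_ofReal, ← ENNReal.ofReal_mul (by positivity),
      ← ENNReal.ofReal_mul (by positivity)]
    refine ENNReal.ofReal_le_ofReal ?_
    have hg := norm_amplitude_sq_ge hm hcrit (2 * Real.pi * ξ)
    rw [profile, norm_smul, mul_pow, norm_mul, Complex.norm_real, Real.norm_eq_abs, mul_pow,
      sq_abs, Real.sq_sqrt Real.pi_pos.le, mul_one_div, le_div_iff₀ (by positivity)]
    calc _ = Real.pi * ‖Ξ (2 * Real.pi * ξ)‖ ^ 2 *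
          (2 * (1 - |τ / η|) * kappa m η (2 * Real.pi * ξ)) := by ring
      _ ≤ _ := mul_le_mul_of_nonneg_left hg (by have := Real.pi_pos; positivity)
  refine ⟨hΞ.aestronglyMeasurable, ?_⟩
  have hπ := Real.pi_pos
  have h4 := ENNReal.lt_top_of_mul_ne_top_right h3.ne
    (ENNReal.ofReal_pos.2 (mul_pos hπ hc)).ne'
  have h5 := ENNReal.lt_top_of_mul_ne_top_right h4.ne
    (ENNReal.ofReal_pos.2 (by positivity : 0 < 1 / (2 * Real.pi))).ne'
  exact (ENNReal.pow_lt_top_iff.1 h5).resolve_right (by norm_num)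

/-- `halfPlane_solution` puts the left trace in the `κ`-eigenspace, where its first component
defines `Ξ`. The transmission condition forces the right trace to be `Λ` times the left one, so the
same `Ξ` describes both sides. -/
theorem exists_ae_eq_psiXi (hm : 0 < m) (hcrit : η ^ 2 - τ ^ 2 = 4) {ψ : L2Spinor}
    (h : IsDiracValue m η τ ψ ((zStar m η τ : ℂ) • ψ)) :
    ∃ Ξ : ℝ → ℂ, StronglyMeasurable Ξ ∧ MemLp Ξ 2 ∧ ψ =ᵐ[volume] psiXi m η τ Ξ := by
  have hη := eta_ne_zero hcrit
  obtain ⟨gp, gm, tp, tm, hp, hq, ⟨tp1, u, hu, u1, u2, u3⟩, ⟨tm1, v, hv, v1, v2, v3⟩, ht, ep, em⟩ := h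
  obtain ⟨α, rfl⟩ := exists_eq_sobolevDist tp1
  obtain ⟨β, rfl⟩ := exists_eq_sobolevDist tm1
  have hgrad : ∀ {Ω : Set (ℝ × ℝ)} {g : ℝ × ℝ → Spinor},
      (∀ᵐ p ∂((volume : Measure (ℝ × ℝ)).restrict Ω), ((zStar m η τ : ℂ) • ψ : L2Spinor) p =
        -Complex.I • g p + (m : ℂ) • act σ₃ (ψ p)) →
      ∀ᵐ p ∂((volume : Measure (ℝ × ℝ)).restrict Ω), g p = gradTerm m (zStar m η τ) (ψ p) :=
    fun {Ω g} h => by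
      filter_upwards [h, ae_restrict_of_ae (Lp.coeFn_smul (zStar m η τ : ℂ) ψ)] with p h1 h3
      rw [h3, Pi.smul_apply] at h1
      exact smul_eq_iff_eq_gradTerm.1 h1
  have gp' := hgrad ep
  have gm' := hgrad em
  have hpL := hp.memLp
  have hqL := hq.memLp
  rw [← halfPlane_one] at u1 u2 gp' hpL
  rw [← halfPlane_neg_one] at v1 v2 gm' hqL
  have hα := Lp.stronglyMeasurable α
  have hβ := Lp.stronglyMeasurable β
  have sp := halfPlane_solution hm hη (sq_sub_zStar_sq hcrit) (by norm_num) hpL gp' hu u1 u2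
    hα (Lp.memLp α) (tendstoSobolev_iff.1 u3)
  have sq := halfPlane_solution hm hη (sq_sub_zStar_sq hcrit) (by norm_num) hqL gm' hv v1 v2
    hβ (Lp.memLp β) (tendstoSobolev_iff.1 v3)
  set Ξ := density m η τ (unweight β) with hΞd
  have hΞ : StronglyMeasurable Ξ := stronglyMeasurable_density (stronglyMeasurable_unweight hβ)
  have hprof : profile m η τ Ξ =ᵐ[volume] unweight β := by
    filter_upwards [sq.1] with ξ hξ
    rw [neg_one_mul, neg_neg] at hξ
    exact profile_density hm hcrit hξ
  have hprofp : (fun ξ => act (Lam η τ) (profile m η τ Ξ ξ)) =ᵐ[volume] unweight α := by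
    filter_upwards [hprof, transmission_sobolevDist_iff.1 ht] with ξ h1 h3
    rw [transmission_iff_eq_act_Lam hcrit] at h3
    rw [h1, unweight, unweight, h3, ← Complex.coe_smul, map_smul, Complex.coe_smul]
  have hΞ2 : MemLp Ξ 2 := by
    -- The left side is used, where the profile is the trace itself, without `Λ`.
    refine memLp_of_memLp_evolve_profile hm hcrit (s := -1) (by norm_num) hΞ ?_
    refine (memLp_congr_ae ?_).2 (memLp_evolve_unweight hm hη (by norm_num) hβ (Lp.memLp β))
    filter_upwards [ae_halfPlane_of_ae_snd hprof] with p h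
    rw [evolve, evolve, h]
  have e : sideMatrix η τ 1 = Lam η τ := by simp [sideMatrix]
  have e' : sideMatrix η τ (-1) = 1 := if_neg (by norm_num)
  have hone : ∀ u : Spinor, act 1 u = u := fun u => by simp [act]
  have fin : ∀ {s : ℝ} {γ : ℝ → Spinor}, s ^ 2 = 1 →
      ψ =ᵐ[volume.restrict (halfPlane s)] sliceFourierInv (evolve m η s (unweight γ)) →
      (fun ξ => act (sideMatrix η τ s) (profile m η τ Ξ ξ)) =ᵐ[volume] unweight γ →
      ψ =ᵐ[volume.restrict (halfPlane s)] psiXi m η τ Ξ := fun {s γ} hs h1 h3 => by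
    refine h1.trans ?_
    rw [← sliceFourierInv_evolve_congr h3, ← unweight_weightedProfile]
    exact (psiXi_ae_eq hm hcrit hs hΞ hΞ2).symm
  refine ⟨Ξ, hΞ, hΞ2, ae_of_ae_halfPlanes ?_ ?_⟩
  · rw [← halfPlane_one]
    exact fin (by norm_num) sp.2 (by rwa [e])
  · rw [← halfPlane_neg_one]
    exact fin (by norm_num) sq.2 (by simpa only [e', hone] using hprof)

theorem psiXi_congr {Ξ Ξ' : ℝ → ℂ} (h : Ξ =ᵐ[volume] Ξ') : psiXi m η τ Ξ = psiXi m η τ Ξ' := by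
  ext1 p
  rw [psiXi, psiXi]
  congr 2
  refine integral_congr_ae ?_
  filter_upwards [h] with k hk
  rw [psiIntegrand, psiIntegrand, hk]

theorem ae_fst_ne_zero : ∀ᵐ p ∂(volume : Measure (ℝ × ℝ)), p.1 ≠ 0 := by
  have : ∀ᵐ x ∂(volume : Measure ℝ), x ≠ 0 := by simp [ae_iff]
  exact Measure.quasiMeasurePreserving_fst.ae this

/-- Additivity is claimed only almost everywhere: on the line `x = 0` the integrals may diverge, and
the default value `0` of the integral is not additive. -/
theorem psiXi_add (hm : 0 < m) (hcrit : η ^ 2 - τ ^ 2 = 4) (Ξ Ξ' : Lp ℂ 2 (volume : Measure ℝ)) :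
    psiXi m η τ (Ξ + Ξ' : Lp ℂ 2 (volume : Measure ℝ)) =ᵐ[volume]
      psiXi m η τ Ξ + psiXi m η τ Ξ' := by
  filter_upwards [ae_fst_ne_zero] with p hp
  have i1 := integrable_psiIntegrand hm hcrit (Lp.stronglyMeasurable Ξ) (Lp.memLp Ξ) hp p.2
  have i2 := integrable_psiIntegrand hm hcrit (Lp.stronglyMeasurable Ξ') (Lp.memLp Ξ') hp p.2
  rw [Pi.add_apply, psiXi_congr (Lp.coeFn_add Ξ Ξ'), psiXi, psiXi, psiXi, ← smul_add, ← map_add,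
    ← integral_add i1 i2]
  simp only [psiIntegrand, Pi.add_apply, add_mul, add_smul]

theorem psiXi_smul (c : ℂ) (Ξ : Lp ℂ 2 (volume : Measure ℝ)) :
    psiXi m η τ (c • Ξ : Lp ℂ 2 (volume : Measure ℝ)) = c • psiXi m η τ Ξ := by
  have h : ∀ x y k, psiIntegrand m η τ (c • (Ξ : ℝ → ℂ)) x y k =
      c • psiIntegrand m η τ Ξ x y k := fun x y k => by
    rw [psiIntegrand, psiIntegrand, Pi.smul_apply, smul_eq_mul, mul_assoc, smul_smul]
  ext1 p
  rw [Pi.smul_apply, psiXi_congr (Lp.coeFn_smul c Ξ), psiXi, psiXi]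
  simp only [h]
  rw [integral_smul, map_smul, smul_comm]

/-- The map `Ξ ↦ ψ_Ξ` with values in the eigenspace. -/
def psiLinearMap (hm : 0 < m) (hcrit : η ^ 2 - τ ^ 2 = 4) :
    Lp ℂ 2 (volume : Measure ℝ) →ₗ[ℂ] eigenspace (diracOp m η τ) (zStar m η τ : ℂ) where
  toFun Ξ := ⟨(memLp_psiXi hm hcrit (Lp.stronglyMeasurable Ξ) (Lp.memLp Ξ)).toLp _,
    mem_eigenspace_diracOp_iff.2 (isDiracValue_of_ae_eq_psiXi hm hcrit (Lp.stronglyMeasurable Ξ)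
      (Lp.memLp Ξ) (MemLp.coeFn_toLp _))⟩
  map_add' Ξ Ξ' := by
    refine Subtype.ext ?_
    exact MemLp.toLp_congr (memLp_psiXi hm hcrit (Lp.stronglyMeasurable (Ξ + Ξ'))
      (Lp.memLp (Ξ + Ξ'))) ((memLp_psiXi hm hcrit (Lp.stronglyMeasurable Ξ) (Lp.memLp Ξ)).add
      (memLp_psiXi hm hcrit (Lp.stronglyMeasurable Ξ') (Lp.memLp Ξ'))) (psiXi_add hm hcrit Ξ Ξ')
  map_smul' c Ξ := by
    refine Subtype.ext ?_
    exact MemLp.toLp_congr (memLp_psiXi hm hcrit (Lp.stronglyMeasurable (c • Ξ))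
      (Lp.memLp (c • Ξ))) ((memLp_psiXi hm hcrit (Lp.stronglyMeasurable Ξ)
      (Lp.memLp Ξ)).const_smul c) (Eventually.of_forall fun p => by rw [psiXi_smul])

theorem norm_toLp_psiXi (hm : 0 < m) (hcrit : η ^ 2 - τ ^ 2 = 4)
    (Ξ : Lp ℂ 2 (volume : Measure ℝ)) :
    ‖(memLp_psiXi hm hcrit (Lp.stronglyMeasurable Ξ) (Lp.memLp Ξ)).toLp (psiXi m η τ Ξ)‖ =
      ‖Ξ‖ := by
  rw [Lp.norm_toLp, eLpNorm_psiXi hm hcrit (Lp.stronglyMeasurable Ξ) (Lp.memLp Ξ), Lp.norm_def]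

theorem psiLinearMap_injective (hm : 0 < m) (hcrit : η ^ 2 - τ ^ 2 = 4) :
    Function.Injective (psiLinearMap hm hcrit) := by
  rw [injective_iff_map_eq_zero]
  intro Ξ h
  have h' : (psiLinearMap hm hcrit Ξ : L2Spinor) = 0 := by rw [h]; rfl
  rw [← norm_eq_zero, ← norm_toLp_psiXi hm hcrit]
  exact norm_eq_zero.2 h'

end Eigenspace

/-! ### Infinite dimension of `L²(ℝ)` and the main theorem. -/

theorem not_finiteDimensional_Lp_two :
    ¬ FiniteDimensional ℂ (Lp ℂ 2 (volume : Measure ℝ)) := by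
  intro h
  have hfin : ∀ n : ℕ, volume (Set.Ioc (n : ℝ) (n + 1)) ≠ ⊤ := fun n => by simp
  -- Indicators of disjoint unit intervals form an infinite orthonormal family.
  have ho : Orthonormal ℂ fun n : ℕ =>
      indicatorConstLp 2 (measurableSet_Ioc (a := (n : ℝ)) (b := n + 1)) (hfin n) (1 : ℂ) := by
    rw [orthonormal_iff_ite]
    intro i j
    rw [L2.inner_indicatorConstLp_indicatorConstLp _ _ (hfin i) (hfin j)]
    split_ifs with hij
    · subst hij
      simp [Measure.real]
    · have : Disjoint (Set.Ioc (i : ℝ) (i + 1)) (Set.Ioc (j : ℝ) (j + 1)) := by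
        have := Set.pairwise_disjoint_Ioc_intCast ℝ (i := (i : ℤ)) (j := (j : ℤ))
          (by exact_mod_cast hij)
        simpa [Function.onFun] using this
      rw [this.inter_eq]
      simp
  exact Set.infinite_univ (Set.finite_univ_iff.2 ho.linearIndependent.finite_of_isNoetherian)

end DiracLine

end

theorem theorem1p2 (m η τ : ℝ) (hm : 0 < m) (hcrit : η ^ 2 - τ ^ 2 = 4) :
    ¬ FiniteDimensional ℂ
        (DiracLine.eigenspace (DiracLine.diracOp m η τ) (DiracLine.zStar m η τ : ℂ)) ∧
    (∀ Ξ : Lp ℂ 2 (volume : Measure ℝ),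
      (∀ x y : ℝ, x ≠ 0 → Integrable (fun k => DiracLine.psiIntegrand m η τ Ξ x y k) volume) ∧
      ∃ hΞ : MemLp (DiracLine.psiXi m η τ Ξ) 2 (volume : Measure (ℝ × ℝ)),
        ‖hΞ.toLp (DiracLine.psiXi m η τ Ξ)‖ = ‖Ξ‖) ∧
    (∀ ψ : DiracLine.L2Spinor,
      ψ ∈ DiracLine.eigenspace (DiracLine.diracOp m η τ) (DiracLine.zStar m η τ : ℂ) ↔
        ∃ Ξ : Lp ℂ 2 (volume : Measure ℝ),
          ψ =ᵐ[(volume : Measure (ℝ × ℝ))] DiracLine.psiXi m η τ Ξ) := by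
  -- A finite-dimensional eigenspace would make `L²(ℝ)` finite-dimensional through the injective map
  -- `Ξ ↦ ψ_Ξ`.
  refine ⟨fun h => DiracLine.not_finiteDimensional_Lp_two
    (FiniteDimensional.of_injective _ (DiracLine.psiLinearMap_injective hm hcrit)), fun Ξ => ?_,
    fun ψ => ?_⟩
  · have h1 := Lp.stronglyMeasurable Ξ
    exact ⟨fun x y hx => DiracLine.integrable_psiIntegrand hm hcrit h1 (Lp.memLp Ξ) hx y,
      DiracLine.memLp_psiXi hm hcrit h1 (Lp.memLp Ξ), DiracLine.norm_toLp_psiXi hm hcrit Ξ⟩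
  · rw [DiracLine.mem_eigenspace_diracOp_iff]
    constructor
    · intro h
      obtain ⟨Ξ, -, h2, h3⟩ := DiracLine.exists_ae_eq_psiXi hm hcrit h
      refine ⟨h2.toLp Ξ, ?_⟩
      rwa [DiracLine.psiXi_congr h2.coeFn_toLp]
    · rintro ⟨Ξ, h⟩
      exact DiracLine.isDiracValue_of_ae_eq_psiXi hm hcrit (Lp.stronglyMeasurable Ξ)
        (Lp.memLp Ξ) h
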